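/- Let $N\in\mathbb N$, $1<p<N$, $p^*=\frac{Np}{N-p}$, $0\le\mu<\left(\frac{N-p}{p}\right)^p$, and let $\gamma_2$ be the larger of the two roots in $[0,\infty)$ of $$\gamma^{p-2}\big[(p-1)\gamma^2-(N-p)\gamma\big]+\mu=0 .$$ Let $A>0$ and $\alpha>p$. Then there are constants $R_0>1$ and $C>0$, depending only on $N,p,\mu,A,\alpha$, such that the following holds. Let $\Omega\subset\mathbb R^N$ be an exterior domain (open, connected, with $\Omega^c=\mathbb R^N\setminus\Omega$ bounded), let $f\in L^{N/p}(\Omega)$ satisfy $f(x)\le A|x|^{-\alpha}$ for a.e. $x\in\Omega$, and let $$u\in\mathcal D^{1,p}(\Omega)=\{v\in L^{p^*}(\Omega): v \text{ weakly differentiable},\ \nabla v\in L^p(\Omega)\}$$ be a weak subsolution in $\Omega$ of $-\Delta_pu-\frac{\mu}{|x|^p}|u|^{p-2}u=f|u|^{p-2}u$, that is, $$\int_\Omega\Big(|\nabla u|^{p-2}\nabla u\cdot\nabla\varphi-\frac{\mu}{|x|^p}|u|^{p-2}u\varphi\Big)\,dx\le\int_\Omega f|u|^{p-2}u\varphi\,dx\qquad\text{for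 all }0\le\varphi\in C_0^\infty(\Omega).$$ Then for every $R_1\ge R_0$ with $\Omega^c\subset B_{R_1}(0)$, $$u(x)\le C\,M\,\Big(\frac{|x|}{R_1}\Big)^{-\gamma_2}\qquad\text{for a.e. }x\in\mathbb R^N\setminus B_{R_1}(0),\qquad M=\sup_{\partial B_{R_1}(0)}u^+\in[0,\infty].$$ (If $M=\infty$ the inequality holds trivially.) In particular, $u(x)\le C'M|x|^{-\gamma_2}$ there, with $C'=CR_1^{\gamma_2}$; when $\Omega^c\subset B_{R_0}(0)$ one can take $R_1=R_0$, and then $R_1$ and $C'$ depend only on $N,p,\mu,A,\alpha$. Here the supremum of the Sobolev function $u^+$ over the sphere is understood as usual: it is the infimum of the $t\ge0$ such that $u^+\le t$ on $\partial B_{R_1}(0)$, meaning that $\zeta\,(u^+-t)^+\in W_0^{1,p}\big(\{|x|>R_1\}\big)$ (the closure of $C_0^\infty(\{|x|>R_1\})$ in $W^{1,p}(\{|x|>R_1\})$) for every $\zeta\in C_0^\infty(\mathbb R^N)$. -/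

import Mathlib

open MeasureTheory Metric Filter Topology
open scoped ENNReal NNReal ContDiff

noncomputable section

namespace HardySobolev

variable {N : ℕ}

/-- `φ ∈ C_c^∞(Ω)`. -/
def IsTestFunction (Ω : Set (EuclideanSpace ℝ (Fin N)))
    (φ : EuclideanSpace ℝ (Fin N) → ℝ) : Prop :=
  ContDiff ℝ ∞ φ ∧ HasCompactSupport φ ∧ tsupport φ ⊆ Ω

/-- `u` is weakly differentiable in the open set `Ω`, with weak gradient `G`
(only the values of `u` and `G` on `Ω` matter). -/
def HasWeakGradient (Ω : Set (EuclideanSpace ℝ (Fin N)))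
    (u : EuclideanSpace ℝ (Fin N) → ℝ)
    (G : EuclideanSpace ℝ (Fin N) → EuclideanSpace ℝ (Fin N)) : Prop :=
  LocallyIntegrableOn u Ω ∧ LocallyIntegrableOn G Ω ∧
    ∀ φ, IsTestFunction Ω φ → ∀ i : Fin N,
      ∫ x in Ω, u x * (gradient φ x) i = - ∫ x in Ω, (G x) i * φ x

/-- The critical Sobolev exponent `p* = N p / (N - p)`. -/
def sobolevExponent (N : ℕ) (p : ℝ) : ℝ := N * p / (N - p)

/-- `u ∈ L^{p*}(Ω)` is weakly differentiable in `Ω` with weak gradient `G ∈ L^p(Ω)`. -/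
def HasD1pGradient (p : ℝ) (Ω : Set (EuclideanSpace ℝ (Fin N)))
    (u : EuclideanSpace ℝ (Fin N) → ℝ)
    (G : EuclideanSpace ℝ (Fin N) → EuclideanSpace ℝ (Fin N)) : Prop :=
  MemLp u (ENNReal.ofReal (sobolevExponent N p)) (volume.restrict Ω) ∧
    HasWeakGradient Ω u G ∧ MemLp G (ENNReal.ofReal p) (volume.restrict Ω)

/-- The function space `𝒟^{1,p}(Ω)`. -/
def MemD1p (p : ℝ) (Ω : Set (EuclideanSpace ℝ (Fin N)))
    (u : EuclideanSpace ℝ (Fin N) → ℝ) : Prop :=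
  ∃ G, HasD1pGradient p Ω u G

/-- `u ∈ 𝒟^{1,p}(Ω)` is a weak subsolution in `Ω` of
`-Δ_p u - μ |x|^{-p} |u|^{p-2} u = f |u|^{p-2} u`. (The weak gradient `G = ∇u` is unique up to
null sets, and for `f ∈ L^{N/p}(Ω)`, `1 < p < N`, all the integrals converge absolutely.) -/
def IsWeakSubsolution (p μ : ℝ) (Ω : Set (EuclideanSpace ℝ (Fin N)))
    (f u : EuclideanSpace ℝ (Fin N) → ℝ) : Prop :=
  ∃ G, HasD1pGradient p Ω u G ∧
    ∀ φ, IsTestFunction Ω φ → (∀ x, 0 ≤ φ x) →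
      ∫ x in Ω, (‖G x‖ ^ (p - 2) * inner ℝ (G x) (gradient φ x)
          - μ / ‖x‖ ^ p * (|u x| ^ (p - 2) * u x * φ x))
        ≤ ∫ x in Ω, f x * (|u x| ^ (p - 2) * u x * φ x)

/-- An exterior domain: open, connected, with bounded complement. -/
structure IsExteriorDomain (Ω : Set (EuclideanSpace ℝ (Fin N))) : Prop where
  isOpen : IsOpen Ω
  isConnected : IsConnected Ω
  isBounded_compl : Bornology.IsBounded Ωᶜ

/-- `w ∈ W_0^{1,p}(D)`: `w ∈ W^{1,p}(D)` is a limit in `W^{1,p}(D)` of functions in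
`C_c^∞(D)`. -/
def MemW0 (p : ℝ) (D : Set (EuclideanSpace ℝ (Fin N)))
    (w : EuclideanSpace ℝ (Fin N) → ℝ) : Prop :=
  ∃ G, HasWeakGradient D w G ∧
    MemLp w (ENNReal.ofReal p) (volume.restrict D) ∧
    MemLp G (ENNReal.ofReal p) (volume.restrict D) ∧
    ∃ φ : ℕ → EuclideanSpace ℝ (Fin N) → ℝ, (∀ n, IsTestFunction D (φ n)) ∧
      Tendsto (fun n => eLpNorm (fun x => φ n x - w x) (ENNReal.ofReal p)
        (volume.restrict D)) atTop (𝓝 0) ∧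
      Tendsto (fun n => eLpNorm (fun x => gradient (φ n) x - G x) (ENNReal.ofReal p)
        (volume.restrict D)) atTop (𝓝 0)

/-- The Sobolev function `w` satisfies `w ≤ t` on `∂D`, in the usual sense that `(w - t)⁺`
vanishes on `∂D` as an element of `W_0^{1,p}`; the cut-off `ζ` makes the condition local, so that
nothing is required at infinity when `D` is unbounded. -/
def LeOnBoundary (p : ℝ) (D : Set (EuclideanSpace ℝ (Fin N)))
    (w : EuclideanSpace ℝ (Fin N) → ℝ) (t : ℝ) : Prop :=
  ∀ ζ : EuclideanSpace ℝ (Fin N) → ℝ, ContDiff ℝ ∞ ζ → HasCompactSupport ζ →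
    MemW0 p D (fun x => ζ x * max (w x - t) 0)

/-- `sup_{∂D} w ∈ [0, ∞]` for a nonnegative Sobolev function `w`: the infimum of the `t ≥ 0`
with `w ≤ t` on `∂D` (it is `∞` if there is no such `t`). -/
def boundarySup (p : ℝ) (D : Set (EuclideanSpace ℝ (Fin N)))
    (w : EuclideanSpace ℝ (Fin N) → ℝ) : ℝ≥0∞ :=
  ⨅ (t : ℝ≥0) (_ : LeOnBoundary p D w t), (t : ℝ≥0∞)

/-- The nonnegative roots of `γ^{p-2} [(p-1) γ² - (N-p) γ] + μ = 0`. For `1 < p < N` and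
`0 ≤ μ < ((N-p)/p)^p` there are exactly two of them, `γ₁ < γ₂`. -/
def exponentRoots (N : ℕ) (p μ : ℝ) : Set ℝ :=
  {γ | 0 ≤ γ ∧ γ ^ (p - 2) * ((p - 1) * γ ^ 2 - (N - p) * γ) + μ = 0}

/-- `γ₂`, the larger of the two roots. -/
def gamma₂ (N : ℕ) (p μ : ℝ) : ℝ := sSup (exponentRoots N p μ)

end HardySobolev

end

noncomputable section

namespace HardySobolev

/-! ### Convergence of mollifications in `L^p`. -/

section Mollification

open ContinuousLinearMap
open scoped Convolution

variable {N : ℕ} {F : Type*} [NormedAddCommGroup F]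

/-! The proof compares `u` with an explicit radial supersolution. Put `ε = α - p` and `V(x) = c
|x|^(-γ₂) exp(-(δ/ε) |x|^(-ε))`, whose logarithmic slope is `w = γ₂ - δ |x|^(-ε)`. Then `-Δ_p V = W
V^(p-1)` with `W = |x|^(-p) [(N-p) w^(p-1) - (p-1) w^p + (p-1) w^(p-2) ε δ |x|^(-ε)]`. The function
`(p-1) w^p - (N-p) w^(p-1) + μ` is nonpositive on `[(N-p)/p, γ₂]`, so for `|x| ≥ R₀` the first two
terms of `W` give at least `μ |x|^(-p)`, and with `δ` chosen suitably the last one gives at least `2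
A |x|^(-α)`. Hence `W` strictly exceeds the potential `b = μ |x|^(-p) + f` of the subsolution
(`gamma₂_spec`, `exists_barrier_constants`, `barrier_weak_equation`). The exponential factor lies
between `exp(-δ/ε)` and `1`, so `V` is comparable with `|x|^(-γ₂)`.

The comparison `u ≤ V` rests on Picone's inequality. With `s = u/V` and a truncation `κ_j` living on
`1 < s < 2j`, the inequality for `u` is tested with `η u κ_j(s)`, the equation for `V` with `η V s^p
κ_j(s)`, and the two are added. The density becomes `κ_j` times a nonnegative Picone term, plus `s
κ_j'` times a nonnegative monotonicity term, plus `(W - b) u^p κ_j` (`excess_pointwise`,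
`excess_inequality`). Only two errors have no sign: the one from `κ_j' < 0`, confined to `s ≥ j`,
and the flux against `∇η`, confined to `|x| ≥ ρ`. The first vanishes as `j → ∞`; the second vanishes
as `ρ → ∞` using just `∇u ∈ L^p` and `u ∈ L^{p*}`. What remains is `(W - b) u^p κ_j = 0` almost
everywhere, that is, `u ≤ V` (`le_of_leOnBoundary`).

The functions `u κ_j(u/V)` are reached through smooth approximations of `u`
(`weak_inequality_composite`), and test functions are allowed up to the sphere because flux and
density vanish where `u ≤ V`, in particular where `u` is close to its boundary bound
(`weak_inequality_up_to_boundary`). Normalising `V` slightly above an admissible bound `t` on the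
sphere, then removing the excess and taking the infimum over `t`, yields the estimate with `C =
exp(δ/ε)`. -/

theorem tendsto_eLpNorm_translate_sub {p : ℝ≥0∞} (hp : 1 ≤ p) (hp' : p ≠ ⊤)
    {g : EuclideanSpace ℝ (Fin N) → F} (hg : MemLp g p volume) :
    Tendsto (fun t : EuclideanSpace ℝ (Fin N) => eLpNorm (fun x => g (x - t) - g x) p volume)
      (𝓝 0) (𝓝 0) := by
  have : Fact (1 ≤ p) := ⟨hp⟩
  let T : C(EuclideanSpace ℝ (Fin N), C(EuclideanSpace ℝ (Fin N), EuclideanSpace ℝ (Fin N))) :=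
    ContinuousMap.curry ⟨fun z => z.2 - z.1, by fun_prop⟩
  have hT : ∀ t, MeasurePreserving (T t) (volume : Measure (EuclideanSpace ℝ (Fin N))) volume :=
    fun t => measurePreserving_sub_right volume t
  have h0 : Tendsto (fun t => Lp.compMeasurePreserving (T t) (hT t) (hg.toLp g)) (𝓝 0)
      (𝓝 (Lp.compMeasurePreserving (T 0) (hT 0) (hg.toLp g))) :=
    Tendsto.compMeasurePreservingLp tendsto_const_nhds (T.continuous.tendsto 0) hT (hT 0) hp'
  have h1 : Lp.compMeasurePreserving (T 0) (hT 0) (hg.toLp g) = hg.toLp g := by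
    rw [Lp.toLp_compMeasurePreserving hg (hT 0)]
    congr 1
    ext x
    simp [T]
  rw [h1, tendsto_iff_edist_tendsto_0] at h0
  refine h0.congr fun t => ?_
  rw [Lp.toLp_compMeasurePreserving hg (hT t), Lp.edist_toLp_toLp]
  rfl

variable [NormedSpace ℝ F] [CompleteSpace F]

/-- The mollification error is an average of `g(· - t) - g` over small `t`, so it is controlled by
the continuity of translations in `L^p`. -/
theorem tendsto_eLpNorm_mollify_sub {p : ℝ} (hp : 1 ≤ p)
    {g : EuclideanSpace ℝ (Fin N) → F} (hg : MemLp g (ENNReal.ofReal p) volume)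
    {φ : ℕ → ContDiffBump (0 : EuclideanSpace ℝ (Fin N))}
    (hφ : Tendsto (fun m => (φ m).rOut) atTop (𝓝 0)) :
    Tendsto (fun m => eLpNorm (fun x => ((φ m).normed volume ⋆[lsmul ℝ ℝ, volume] g) x - g x)
      (ENNReal.ofReal p) volume) atTop (𝓝 0) := by
  have hp0 : 0 < p := by linarith
  have hp1 : (1 : ℝ≥0∞) ≤ ENNReal.ofReal p := by simpa using hp
  have hgl : LocallyIntegrable g volume := hg.locallyIntegrable hp1
  have key : ∀ m (ε : ℝ≥0∞), (∀ t ∈ ball (0 : EuclideanSpace ℝ (Fin N)) (φ m).rOut,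
      eLpNorm (fun x => g (x - t) - g x) (ENNReal.ofReal p) volume ≤ ε) →
      eLpNorm (fun x => ((φ m).normed volume ⋆[lsmul ℝ ℝ, volume] g) x - g x)
        (ENNReal.ofReal p) volume ≤ ε := by
    intro m ε hε
    set ρ := (φ m).normed (volume : Measure (EuclideanSpace ℝ (Fin N))) with hρ
    have hρc : Continuous ρ := (φ m).continuous_normed
    have hρm : Measurable (fun t => ENNReal.ofReal (ρ t)) := hρc.measurable.ennreal_ofReal
    have hρ1 : ∫⁻ t, ENNReal.ofReal (ρ t) = 1 := by
      rw [← ofReal_integral_eq_lintegral_ofReal (φ m).integrable_normed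
        (Eventually.of_forall (φ m).nonneg_normed), (φ m).integral_normed, ENNReal.ofReal_one]
    -- The kernel is turned into a probability measure, so that Jensen's inequality becomes
    -- monotonicity of `L^p` norms in the exponent; Tonelli then exchanges the two integrals.
    set ν := (volume : Measure (EuclideanSpace ℝ (Fin N))).withDensity
      (fun t => ENNReal.ofReal (ρ t)) with hν
    have : IsProbabilityMeasure ν := ⟨by simp [hν, hρ1]⟩
    have hac : ν ≪ volume := withDensity_absolutelyContinuous _ _
    have hmeas : ∀ x, AEStronglyMeasurable (fun t => g (x - t) - g x) volume := fun x =>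
      (hg.1.comp_quasiMeasurePreserving
        (quasiMeasurePreserving_sub_left volume x)).sub aestronglyMeasurable_const
    have pt : ∀ x, ‖(ρ ⋆[lsmul ℝ ℝ, volume] g) x - g x‖ₑ ^ p
        ≤ ∫⁻ t, ENNReal.ofReal (ρ t) * ‖g (x - t) - g x‖ₑ ^ p := by
      intro x
      have hi1 : Integrable (fun t => ρ t • g (x - t)) volume :=
        (φ m).hasCompactSupport_normed.convolutionExists_left (lsmul ℝ ℝ) hρc hgl x
      have hi2 : Integrable (fun t => ρ t • g x) volume :=
        (φ m).integrable_normed.smul_const _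
      have e1 : (ρ ⋆[lsmul ℝ ℝ, volume] g) x - g x = ∫ t, ρ t • (g (x - t) - g x) := by
        simp_rw [smul_sub]
        rw [integral_sub hi1 hi2, integral_smul_const, hρ, (φ m).integral_normed, one_smul]
        rfl
      have e2 : ‖(ρ ⋆[lsmul ℝ ℝ, volume] g) x - g x‖ₑ ≤ eLpNorm (fun t => g (x - t) - g x) 1 ν := by
        rw [e1, eLpNorm_one_eq_lintegral_enorm]
        refine (enorm_integral_le_lintegral_enorm _).trans (le_of_eq ?_)
        rw [hν, lintegral_withDensity_eq_lintegral_mul₀ hρm.aemeasurable (hmeas x).enorm]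
        refine lintegral_congr fun t => ?_
        rw [enorm_smul, Pi.mul_apply, Real.enorm_of_nonneg ((φ m).nonneg_normed t)]
      have e3 := e2.trans (eLpNorm_le_eLpNorm_of_exponent_le hp1 ((hmeas x).mono_ac hac))
      calc _ ≤ (eLpNorm (fun t => g (x - t) - g x) (ENNReal.ofReal p) ν) ^ p := by gcongr
        _ = _ := by
          rw [eLpNorm_eq_lintegral_rpow_enorm_toReal (by simpa using hp0) ENNReal.ofReal_ne_top,
            ENNReal.toReal_ofReal hp0.le, ← ENNReal.rpow_mul, one_div_mul_cancel hp0.ne',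
            ENNReal.rpow_one, hν,
            lintegral_withDensity_eq_lintegral_mul₀ hρm.aemeasurable ((hmeas x).enorm.pow_const _)]
          rfl
    have hjoint : AEMeasurable (Function.uncurry fun x t =>
        ENNReal.ofReal (ρ t) * ‖g (x - t) - g x‖ₑ ^ p)
        ((volume : Measure (EuclideanSpace ℝ (Fin N))).prod volume) := by
      have a1 : AEStronglyMeasurable
          (fun z : EuclideanSpace ℝ (Fin N) × EuclideanSpace ℝ (Fin N) => g (z.1 - z.2))
          (volume.prod volume) :=
        hg.1.comp_quasiMeasurePreserving (quasiMeasurePreserving_sub volume volume)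
      have a2 : AEStronglyMeasurable
          (fun z : EuclideanSpace ℝ (Fin N) × EuclideanSpace ℝ (Fin N) => g z.1)
          (volume.prod volume) := hg.1.comp_fst
      exact (hρm.comp measurable_snd).aemeasurable.mul ((a1.sub a2).enorm.pow_const _)
    have main : ∫⁻ x, ‖(ρ ⋆[lsmul ℝ ℝ, volume] g) x - g x‖ₑ ^ p ≤ ε ^ p := by
      calc _ ≤ ∫⁻ x, ∫⁻ t, ENNReal.ofReal (ρ t) * ‖g (x - t) - g x‖ₑ ^ p := lintegral_mono pt
        _ = ∫⁻ t, ∫⁻ x, ENNReal.ofReal (ρ t) * ‖g (x - t) - g x‖ₑ ^ p :=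
          lintegral_lintegral_swap hjoint
        _ ≤ ∫⁻ t, ENNReal.ofReal (ρ t) * ε ^ p := by
          refine lintegral_mono fun t => ?_
          rw [lintegral_const_mul' _ _ ENNReal.ofReal_ne_top]
          by_cases ht : t ∈ ball (0 : EuclideanSpace ℝ (Fin N)) (φ m).rOut
          · gcongr
            have h := hε t ht
            rw [eLpNorm_eq_lintegral_rpow_enorm_toReal (by simpa using hp0) ENNReal.ofReal_ne_top,
              ENNReal.toReal_ofReal hp0.le, one_div] at h
            exact (ENNReal.rpow_inv_le_iff hp0).1 h
          · have : ρ t = 0 := by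
              rw [← Function.notMem_support, hρ, (φ m).support_normed_eq]; exact ht
            simp [this]
        _ = ε ^ p := by
          rw [lintegral_mul_const _ hρm, hρ1, one_mul]
    rw [eLpNorm_eq_lintegral_rpow_enorm_toReal (by simpa using hp0) ENNReal.ofReal_ne_top,
      ENNReal.toReal_ofReal hp0.le, one_div]
    exact (ENNReal.rpow_inv_le_iff hp0).2 main
  rw [ENNReal.tendsto_nhds_zero]
  intro ε hε
  have h := (ENNReal.tendsto_nhds_zero.1
    (tendsto_eLpNorm_translate_sub hp1 ENNReal.ofReal_ne_top hg)) ε hε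
  obtain ⟨r, hr, hball⟩ := Metric.eventually_nhds_iff_ball.1 h
  filter_upwards [hφ.eventually (gt_mem_nhds hr)] with m hm
  exact key m ε fun t ht => hball t (ball_subset_ball hm.le ht)

end Mollification

/-! ### Smooth approximation of weakly differentiable functions on compact sets. -/

section SmoothApproximation

open ContinuousLinearMap
open scoped Convolution

variable {N : ℕ}

theorem gradient_apply_coord (f : EuclideanSpace ℝ (Fin N) → ℝ) (x : EuclideanSpace ℝ (Fin N))
    (i : Fin N) : gradient f x i = fderiv ℝ f x (EuclideanSpace.single i 1) := by
  have h : inner ℝ (gradient f x) (EuclideanSpace.single i (1 : ℝ))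
      = fderiv ℝ f x (EuclideanSpace.single i 1) := by
    rw [gradient, InnerProductSpace.toDual_symm_apply]
  rw [← h, EuclideanSpace.inner_single_right]
  simp

theorem inner_gradient_eq_fderiv (f : EuclideanSpace ℝ (Fin N) → ℝ)
    (x y : EuclideanSpace ℝ (Fin N)) : inner ℝ (gradient f x) y = fderiv ℝ f x y := by
  rw [gradient, InnerProductSpace.toDual_symm_apply]

theorem gradient_of_notMem_tsupport {c : EuclideanSpace ℝ (Fin N) → ℝ}
    {x : EuclideanSpace ℝ (Fin N)} (hx : x ∉ tsupport c) : gradient c x = 0 := by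
  have : fderiv ℝ c x = 0 := by
    by_contra h
    exact hx (support_fderiv_subset ℝ h)
  rw [gradient, this, map_zero]

/-- On a compact subset of the domain, a mollified weakly differentiable function has the
mollified weak gradient as its gradient. -/
theorem gradient_mollify {D K : Set (EuclideanSpace ℝ (Fin N))} {δ : ℝ}
    (hK : IsCompact K) (hKD : cthickening δ K ⊆ D)
    {u : EuclideanSpace ℝ (Fin N) → ℝ} {G : EuclideanSpace ℝ (Fin N) → EuclideanSpace ℝ (Fin N)}
    (hu : HasWeakGradient D u G) (φ : ContDiffBump (0 : EuclideanSpace ℝ (Fin N)))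
    (hφ : φ.rOut ≤ δ) {x : EuclideanSpace ℝ (Fin N)} (hx : x ∈ K) :
    gradient (φ.normed volume ⋆[lsmul ℝ ℝ, volume] (cthickening δ K).indicator u) x
      = (φ.normed volume ⋆[lsmul ℝ ℝ, volume] (cthickening δ K).indicator G) x := by
  obtain ⟨hu1, hu2, hu3⟩ := hu
  set K' := cthickening δ K with hK'
  have hK'c : IsCompact K' := hK.cthickening
  have hK'm : MeasurableSet K' := hK'c.measurableSet
  have hui : Integrable (K'.indicator u) volume :=
    (hu1.integrableOn_compact_subset hKD hK'c).integrable_indicator hK'm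
  have hGi : Integrable (K'.indicator G) volume :=
    (hu2.integrableOn_compact_subset hKD hK'c).integrable_indicator hK'm
  set ρ := φ.normed (volume : Measure (EuclideanSpace ℝ (Fin N))) with hρ
  have hρs : HasCompactSupport ρ := φ.hasCompactSupport_normed
  have hρd : ContDiff ℝ ∞ ρ := φ.contDiff_normed
  -- The kernel centred at `x` is itself a test function in `D`; inserting it into the definition of
  -- the weak gradient is the whole proof.
  set ψ : EuclideanSpace ℝ (Fin N) → ℝ := fun y => ρ (x - y) with hψ
  have hsupp : tsupport ψ ⊆ K' := by
    have h1 : Function.support ψ ⊆ closedBall x φ.rOut := by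
      intro y hy
      have : x - y ∈ Function.support ρ := hy
      rw [hρ, φ.support_normed_eq, mem_ball, dist_zero_right] at this
      rw [mem_closedBall, dist_comm, dist_eq_norm]
      exact this.le
    refine (closure_minimal h1 isClosed_closedBall).trans ?_
    refine (closedBall_subset_closedBall hφ).trans ?_
    exact closedBall_subset_cthickening hx δ
  have htest : IsTestFunction D ψ := by
    refine ⟨hρd.comp (contDiff_const.sub contDiff_id), ?_, hsupp.trans hKD⟩
    exact hK'c.of_isClosed_subset (isClosed_tsupport _) hsupp
  have hψ0 : ∀ y, y ∉ K' → ψ y = 0 := fun y hy => image_eq_zero_of_notMem_tsupport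
    fun h => hy (hsupp h)
  have hψg : ∀ y i, gradient ψ y i = - fderiv ℝ ρ (x - y) (EuclideanSpace.single i 1) := by
    intro y i
    rw [gradient_apply_coord]
    have h1 : HasFDerivAt ψ ((fderiv ℝ ρ (x - y)).comp (-ContinuousLinearMap.id ℝ _)) y :=
      ((hρd.differentiable (by simp)).differentiableAt.hasFDerivAt).comp y
        ((hasFDerivAt_id y).const_sub x)
    rw [h1.fderiv]
    simp
  have hψg0 : ∀ y, y ∉ K' → gradient ψ y = 0 := fun y hy =>
    gradient_of_notMem_tsupport fun h => hy (hsupp h)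
  ext i
  rw [gradient_apply_coord]
  have hd := hρs.hasFDerivAt_convolution_left (μ := volume) (lsmul ℝ ℝ : ℝ →L[ℝ] ℝ →L[ℝ] ℝ)
    (hρd.of_le (by simp)) hui.locallyIntegrable x
  rw [hd.fderiv, convolution_eq_swap]
  have hint : Integrable (fun t => (precompL (EuclideanSpace ℝ (Fin N))
      (lsmul ℝ ℝ : ℝ →L[ℝ] ℝ →L[ℝ] ℝ) (fderiv ℝ ρ (x - t))) (K'.indicator u t)) volume :=
    (HasCompactSupport.convolutionExists_left (μ := volume)
      (precompL (EuclideanSpace ℝ (Fin N)) (lsmul ℝ ℝ : ℝ →L[ℝ] ℝ →L[ℝ] ℝ))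
      (hρs.fderiv (𝕜 := ℝ)) (hρd.continuous_fderiv (by simp)) hui.locallyIntegrable x).integrable_swap
  rw [ContinuousLinearMap.integral_apply hint, convolution_eq_swap]
  have hint2 : Integrable (fun t => (lsmul ℝ ℝ : ℝ →L[ℝ] _ →L[ℝ] _) (ρ (x - t)) (K'.indicator G t))
      volume :=
    (HasCompactSupport.convolutionExists_left (μ := volume)
      (lsmul ℝ ℝ) hρs hρd.continuous hGi.locallyIntegrable x).integrable_swap
  have hcoord : (∫ t, (lsmul ℝ ℝ : ℝ →L[ℝ] _ →L[ℝ] _) (ρ (x - t)) (K'.indicator G t)) i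
      = ∫ t, ((lsmul ℝ ℝ : ℝ →L[ℝ] _ →L[ℝ] _) (ρ (x - t)) (K'.indicator G t)) i :=
    ((EuclideanSpace.proj i : EuclideanSpace ℝ (Fin N) →L[ℝ] ℝ).integral_comp_comm hint2).symm
  rw [hcoord]
  have h3 := hu3 ψ htest i
  rw [setIntegral_eq_integral_of_forall_compl_eq_zero
    (fun y hy => by rw [hψg0 y (fun h => hy (hKD h))]; simp),
    setIntegral_eq_integral_of_forall_compl_eq_zero
    (fun y hy => by rw [hψ0 y (fun h => hy (hKD h))]; simp)] at h3
  rw [← neg_inj, ← integral_neg] 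
  rw [eq_comm]
  convert h3.symm using 1
  · congr 1
    refine integral_congr_ae (Eventually.of_forall fun t => ?_)
    by_cases ht : t ∈ K'
    · simp [ht, hψ, mul_comm]
    · simp [ht, hψ0 t ht]
  · refine integral_congr_ae (Eventually.of_forall fun t => ?_)
    by_cases ht : t ∈ K'
    · simp [ht, hψg, mul_comm]
    · simp [ht, hψg0 t ht]

/-- Mollification after cutting off to a compact neighbourhood of `K`. Almost-everywhere convergence
of the functions (Lebesgue points) suffices later, since they enter only through bounded
nonlinearities; the gradients enter linearly and need `L^p` convergence. -/
theorem exists_smooth_approximation {D K : Set (EuclideanSpace ℝ (Fin N))} (hD : IsOpen D)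
    (hK : IsCompact K) (hKD : K ⊆ D)
    {u : EuclideanSpace ℝ (Fin N) → ℝ} {G : EuclideanSpace ℝ (Fin N) → EuclideanSpace ℝ (Fin N)}
    (hu : HasWeakGradient D u G) {p : ℝ} (hp : 1 ≤ p)
    (hG : MemLp G (ENNReal.ofReal p) (volume.restrict D)) :
    ∃ v : ℕ → EuclideanSpace ℝ (Fin N) → ℝ, (∀ m, ContDiff ℝ ∞ (v m)) ∧
      (∀ᵐ x ∂(volume.restrict K), Tendsto (fun m => v m x) atTop (𝓝 (u x))) ∧
      Tendsto (fun m => eLpNorm (fun x => gradient (v m) x - G x) (ENNReal.ofReal p)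
        (volume.restrict K)) atTop (𝓝 0) := by
  obtain ⟨δ, hδ, hδD⟩ := hK.exists_cthickening_subset_open hD hKD
  set K' := cthickening δ K with hK'
  have hK'c : IsCompact K' := hK.cthickening
  have hK'm : MeasurableSet K' := hK'c.measurableSet
  have hKK' : K ⊆ K' := self_subset_cthickening K
  have hui : Integrable (K'.indicator u) volume :=
    (hu.1.integrableOn_compact_subset hδD hK'c).integrable_indicator hK'm
  have hGp : MemLp (K'.indicator G) (ENNReal.ofReal p) volume := by
    rw [memLp_indicator_iff_restrict hK'm]
    exact hG.mono_measure (Measure.restrict_mono hδD le_rfl)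
  let φ : ℕ → ContDiffBump (0 : EuclideanSpace ℝ (Fin N)) := fun m =>
    ⟨δ / (m + 1) / 2, δ / (m + 1), by positivity, half_lt_self (by positivity)⟩
  have hφ0 : Tendsto (fun m => (φ m).rOut) atTop (𝓝 0) := by
    have := (tendsto_one_div_add_atTop_nhds_zero_nat (𝕜 := ℝ)).const_mul δ
    simpa [φ, div_eq_mul_inv] using this
  have hφδ : ∀ m, (φ m).rOut ≤ δ := fun m =>
    div_le_self hδ.le (by linarith [(Nat.cast_nonneg m : (0 : ℝ) ≤ m)])
  refine ⟨fun m => (φ m).normed volume ⋆[lsmul ℝ ℝ, volume] K'.indicator u, fun m => ?_, ?_, ?_⟩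
  · exact (φ m).hasCompactSupport_normed.contDiff_convolution_left _ (φ m).contDiff_normed
      hui.locallyIntegrable
  -- The factor `2` is the fixed ratio of outer to inner radius of the bumps.
  · have h := ContDiffBump.ae_convolution_tendsto_right_of_locallyIntegrable (K := 2) hφ0
      (Eventually.of_forall fun m => by simp only [φ]; linarith) hui.locallyIntegrable
    filter_upwards [ae_restrict_of_ae h, ae_restrict_mem hK.measurableSet] with x hx hxK
    rwa [Set.indicator_of_mem (hKK' hxK)] at hx
  · refine tendsto_of_tendsto_of_tendsto_of_le_of_le tendsto_const_nhds
      (tendsto_eLpNorm_mollify_sub hp hGp hφ0) (fun _ => zero_le) fun m => ?_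
    refine (le_of_eq ?_).trans (eLpNorm_mono_measure _ (Measure.restrict_le_self (s := K)))
    refine eLpNorm_congr_ae ?_
    filter_upwards [ae_restrict_mem hK.measurableSet] with x hxK
    rw [gradient_mollify hK hδD hu (φ m) (hφδ m) hxK, Set.indicator_of_mem (hKK' hxK)]

end SmoothApproximation

/-! ### Passage to the limit in weak inequalities. -/

section CompositeLimit

variable {α E : Type*} [MeasurableSpace α] {ν : Measure α} [NormedAddCommGroup E]
  [InnerProductSpace ℝ E]

theorem lintegral_enorm_inner_le {p q : ℝ} (hpq : p.HolderConjugate q) {Y W : α → E}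
    (hY : AEStronglyMeasurable Y ν) (hW : AEStronglyMeasurable W ν) :
    ∫⁻ x, ‖(inner ℝ (Y x) (W x) : ℝ)‖ₑ ∂ν
      ≤ eLpNorm Y (ENNReal.ofReal q) ν * eLpNorm W (ENNReal.ofReal p) ν := by
  have : ENNReal.HolderTriple (ENNReal.ofReal q) (ENNReal.ofReal p) 1 :=
    ⟨by
      rw [← ENNReal.ofReal_inv_of_pos hpq.symm.pos, ← ENNReal.ofReal_inv_of_pos hpq.pos,
        ← ENNReal.ofReal_add hpq.symm.inv_nonneg hpq.inv_nonneg, hpq.symm.inv_add_inv_eq_one]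
      simp⟩
  have h := eLpNorm_le_eLpNorm_mul_eLpNorm_of_nnnorm (r := 1) (p := ENNReal.ofReal q)
    (q := ENNReal.ofReal p) hY hW
    (fun y w => (inner ℝ y w : ℝ)) 1 (Eventually.of_forall fun x => by
      rw [one_mul]; exact nnnorm_inner_le_nnnorm _ _)
  simpa [eLpNorm_one_eq_lintegral_enorm] using h

theorem integrable_inner_of_memLp {p q : ℝ} (hpq : p.HolderConjugate q) {Y W : α → E}
    (hY : MemLp Y (ENNReal.ofReal q) ν) (hW : MemLp W (ENNReal.ofReal p) ν) :
    Integrable (fun x => (inner ℝ (Y x) (W x) : ℝ)) ν :=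
  ⟨hY.1.inner hW.1, (lintegral_enorm_inner_le hpq hY.1 hW.1).trans_lt
    (ENNReal.mul_lt_top hY.2 hW.2)⟩

/-- Passage to the limit in `∫ Y · ∇φ + H φ` along `φ = F(x, v(x))` with
`∇φ = A(x, v(x)) + B(x, v(x)) ∇v`, when `v → u` almost everywhere and `∇v → G` in `L^p`. -/
theorem tendsto_integral_composite [IsFiniteMeasure ν] {p q : ℝ} (hpq : p.HolderConjugate q)
    {Y : α → E} (hY : MemLp Y (ENNReal.ofReal q) ν) {H : α → ℝ} (hH : Integrable H ν)
    {v : ℕ → α → ℝ} {u : α → ℝ} {Dv : ℕ → α → E} {G : α → E}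
    (hv : ∀ᵐ x ∂ν, Tendsto (fun m => v m x) atTop (𝓝 (u x)))
    (hDvm : ∀ m, AEStronglyMeasurable (Dv m) ν)
    (hDv : Tendsto (fun m => eLpNorm (fun x => Dv m x - G x) (ENNReal.ofReal p) ν) atTop (𝓝 0))
    (hG : MemLp G (ENNReal.ofReal p) ν)
    {F B : α → ℝ → ℝ} {A : α → ℝ → E} {C : ℝ}
    (hFc : ∀ᵐ x ∂ν, Continuous (F x)) (hAc : ∀ᵐ x ∂ν, Continuous (A x))
    (hBc : ∀ᵐ x ∂ν, Continuous (B x))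
    (hFb : ∀ᵐ x ∂ν, ∀ s, |F x s| ≤ C) (hAb : ∀ᵐ x ∂ν, ∀ s, ‖A x s‖ ≤ C)
    (hBb : ∀ᵐ x ∂ν, ∀ s, |B x s| ≤ C)
    (hFm : ∀ m, AEStronglyMeasurable (fun x => F x (v m x)) ν)
    (hAm : ∀ m, AEStronglyMeasurable (fun x => A x (v m x)) ν)
    (hBm : ∀ m, AEStronglyMeasurable (fun x => B x (v m x)) ν) :
    Integrable (fun x => inner ℝ (Y x) (A x (u x) + B x (u x) • G x) + H x * F x (u x)) ν ∧
    Tendsto (fun m => ∫ x, (inner ℝ (Y x) (A x (v m x) + B x (v m x) • Dv m x)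
        + H x * F x (v m x)) ∂ν) atTop
      (𝓝 (∫ x, (inner ℝ (Y x) (A x (u x) + B x (u x) • G x) + H x * F x (u x)) ∂ν)) := by
  have hq1 : (1 : ℝ≥0∞) ≤ ENNReal.ofReal q := by simpa using hpq.symm.lt.le
  have hYi : Integrable Y ν := memLp_one_iff_integrable.1 (hY.mono_exponent hq1)
  have hYG := integrable_inner_of_memLp hpq hY hG
  set b : α → ℝ := fun x => C * ‖Y x‖ + C * |(inner ℝ (Y x) (G x) : ℝ)| + C * |H x| with hb
  have hbi : Integrable b ν :=
    ((hYi.norm.const_mul C).add (hYG.abs.const_mul C)).add (hH.abs.const_mul C)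
  -- Writing `Dv = G + (Dv - G)` splits the integrand into `T`, which converges by domination by
  -- `b`, and `S`, whose `L^1` norm tends to zero by Hölder.
  set T : ℕ → α → ℝ := fun m x => inner ℝ (Y x) (A x (v m x))
    + B x (v m x) * inner ℝ (Y x) (G x) + H x * F x (v m x) with hT
  set S : ℕ → α → ℝ := fun m x => B x (v m x) * inner ℝ (Y x) (Dv m x - G x) with hS
  have hTm : ∀ m, AEStronglyMeasurable (T m) ν := fun m =>
    ((hY.1.inner (hAm m)).add ((hBm m).mul hYG.1)).add (hH.1.mul (hFm m))
  have hbound : ∀ w : α → ℝ, ∀ᵐ x ∂ν, ‖inner ℝ (Y x) (A x (w x))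
      + B x (w x) * inner ℝ (Y x) (G x) + H x * F x (w x)‖ ≤ b x := by
    intro w
    filter_upwards [hFb, hAb, hBb] with x h1 h2 h3
    refine (norm_add_le _ _).trans (add_le_add ((norm_add_le _ _).trans (add_le_add ?_ ?_)) ?_)
    · refine (norm_inner_le_norm _ _).trans ?_
      rw [mul_comm]
      exact mul_le_mul_of_nonneg_right (h2 _) (norm_nonneg _)
    · rw [norm_mul]
      exact mul_le_mul_of_nonneg_right (h3 _) (norm_nonneg _)
    · rw [norm_mul, mul_comm]
      exact mul_le_mul_of_nonneg_right (h1 _) (norm_nonneg _)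
  set L : α → ℝ := fun x => inner ℝ (Y x) (A x (u x))
    + B x (u x) * inner ℝ (Y x) (G x) + H x * F x (u x) with hL
  have hlim : ∀ᵐ x ∂ν, Tendsto (fun m => T m x) atTop (𝓝 (L x)) := by
    filter_upwards [hv, hFc, hAc, hBc] with x h0 h1 h2 h3
    refine ((Tendsto.inner tendsto_const_nhds ?_).add (Tendsto.mul_const _ ?_)).add
      (Tendsto.const_mul _ ?_)
    · exact (h2.tendsto _).comp h0
    · exact (h3.tendsto _).comp h0
    · exact (h1.tendsto _).comp h0
  have hTlim := tendsto_integral_of_dominated_convergence b hTm hbi (fun m => hbound (v m)) hlim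
  have hLi : Integrable L ν :=
    hbi.mono' (aestronglyMeasurable_of_tendsto_ae atTop hTm hlim) (hbound u)
  have hSle : ∀ m, ∫⁻ x, ‖S m x‖ₑ ∂ν ≤ ENNReal.ofReal C * (eLpNorm Y (ENNReal.ofReal q) ν *
      eLpNorm (fun x => Dv m x - G x) (ENNReal.ofReal p) ν) := by
    intro m
    refine le_trans ?_ (mul_le_mul_right
      (lintegral_enorm_inner_le hpq hY.1 ((hDvm m).sub hG.1)) _)
    rw [← lintegral_const_mul' _ _ ENNReal.ofReal_ne_top]
    refine lintegral_mono_ae ?_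
    filter_upwards [hBb] with x h3
    simp only [hS, enorm_mul, Pi.sub_apply]
    gcongr
    rw [Real.enorm_eq_ofReal_abs]
    exact ENNReal.ofReal_le_ofReal (h3 _)
  have hSb0 : Tendsto (fun m => ENNReal.ofReal C * (eLpNorm Y (ENNReal.ofReal q) ν *
      eLpNorm (fun x => Dv m x - G x) (ENNReal.ofReal p) ν)) atTop (𝓝 0) := by
    have h1 := ENNReal.Tendsto.const_mul hDv (Or.inr hY.2.ne)
    have h2 := ENNReal.Tendsto.const_mul h1 (Or.inr (ENNReal.ofReal_ne_top (r := C)))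
    simpa using h2
  have hS0 : Tendsto (fun m => ∫⁻ x, ‖S m x‖ₑ ∂ν) atTop (𝓝 0) :=
    tendsto_of_tendsto_of_tendsto_of_le_of_le tendsto_const_nhds hSb0 (fun _ => zero_le) hSle
  have hSm : ∀ m, AEStronglyMeasurable (S m) ν := fun m =>
    (hBm m).mul (hY.1.inner ((hDvm m).sub hG.1))
  have hSi : ∀ᶠ m in atTop, Integrable (S m) ν := by
    filter_upwards [hS0.eventually (gt_mem_nhds ENNReal.zero_lt_top)] with m hm
    exact ⟨hSm m, hm⟩
  have hSlim : Tendsto (fun m => ∫ x, S m x ∂ν) atTop (𝓝 0) := by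
    rw [tendsto_zero_iff_enorm_tendsto_zero]
    exact tendsto_of_tendsto_of_tendsto_of_le_of_le tendsto_const_nhds hS0 (fun _ => zero_le)
      fun m => enorm_integral_le_lintegral_enorm _
  have eL : (fun x => inner ℝ (Y x) (A x (u x) + B x (u x) • G x) + H x * F x (u x)) = L := by
    ext x
    simp only [hL, inner_add_right, real_inner_smul_right]
  rw [eL]
  refine ⟨hLi, ?_⟩
  have := hTlim.add hSlim
  rw [add_zero] at this
  refine this.congr' ?_
  filter_upwards [hSi] with m hm
  rw [← integral_add (hbi.mono' (hTm m) (hbound (v m))) hm]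
  refine integral_congr_ae (Eventually.of_forall fun x => ?_)
  simp only [hT, hS, inner_add_right, real_inner_smul_right, inner_sub_right]
  ring

end CompositeLimit

/-! ### Test functions of the form `c V g(u / V)`. -/

section CompositeTest

variable {N : ℕ}

/-- The gradient of `c * V * g (v / V)`, split into the part `compositeA` which does not contain
`∇v` and the factor `compositeB` of `∇v`. -/
def compositeA (c V : EuclideanSpace ℝ (Fin N) → ℝ) (g : ℝ → ℝ) (x : EuclideanSpace ℝ (Fin N))
    (s : ℝ) : EuclideanSpace ℝ (Fin N) :=
  (V x * g (s / V x)) • gradient c x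
    + (c x * (g (s / V x) - s / V x * deriv g (s / V x))) • gradient V x

/-- The factor of `∇v` in the gradient of `c * V * g (v / V)`. -/
def compositeB (c V : EuclideanSpace ℝ (Fin N) → ℝ) (g : ℝ → ℝ) (x : EuclideanSpace ℝ (Fin N))
    (s : ℝ) : ℝ :=
  c x * deriv g (s / V x)

theorem contDiff_composite {D : Set (EuclideanSpace ℝ (Fin N))}
    {c V v : EuclideanSpace ℝ (Fin N) → ℝ} {g : ℝ → ℝ} (hc : IsTestFunction D c)
    (hV : ∀ x ∈ D, ContDiffAt ℝ ∞ V x) (hV0 : ∀ x ∈ D, 0 < V x) (hg : ContDiff ℝ ∞ g)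
    (hv : ContDiff ℝ ∞ v) : ContDiff ℝ ∞ (fun x => c x * V x * g (v x / V x)) := by
  rw [contDiff_iff_contDiffAt]
  intro x
  by_cases hx : x ∈ tsupport c
  · have hxD := hc.2.2 hx
    exact (hc.1.contDiffAt.mul (hV x hxD)).mul
      (hg.contDiffAt.comp x (hv.contDiffAt.div (hV x hxD) (hV0 x hxD).ne'))
  · have h0 : (fun x => c x * V x * g (v x / V x)) =ᶠ[𝓝 x] fun _ => 0 := by
      filter_upwards [notMem_tsupport_iff_eventuallyEq.1 hx] with y hy
      simp [hy]
    exact contDiffAt_const.congr_of_eventuallyEq h0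

theorem tsupport_composite_subset (c V v : EuclideanSpace ℝ (Fin N) → ℝ) (g : ℝ → ℝ) :
    tsupport (fun x => c x * V x * g (v x / V x)) ⊆ tsupport c := by
  refine closure_mono fun x hx => ?_
  contrapose! hx
  simp only [Function.mem_support, not_not] at hx ⊢
  simp [hx]

theorem gradient_composite {D : Set (EuclideanSpace ℝ (Fin N))}
    {c V v : EuclideanSpace ℝ (Fin N) → ℝ} {g : ℝ → ℝ} (hc : ContDiff ℝ ∞ c)
    (hV : ∀ x ∈ D, ContDiffAt ℝ ∞ V x) (hV0 : ∀ x ∈ D, 0 < V x) (hg : ContDiff ℝ ∞ g)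
    (hv : ContDiff ℝ ∞ v) {x : EuclideanSpace ℝ (Fin N)} (hx : x ∈ D) :
    gradient (fun x => c x * V x * g (v x / V x)) x
      = compositeA c V g x (v x) + compositeB c V g x (v x) • gradient v x := by
  have h1 := (hc.differentiable (by simp)).differentiableAt (x := x) |>.hasFDerivAt
  have h2 := ((hV x hx).differentiableAt (by simp)).hasFDerivAt
  have h3 := (hv.differentiable (by simp)).differentiableAt (x := x) |>.hasFDerivAt
  have hVx := (hV0 x hx).ne'
  have h4 := ((hg.differentiable (by simp)).differentiableAt (x := v x / V x)).hasDerivAt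
  have h6 : HasFDerivAt (fun y => (V y)⁻¹) (-(V x ^ 2)⁻¹ • fderiv ℝ V x) x :=
    (hasDerivAt_inv hVx).comp_hasFDerivAt x h2
  have h5 := (h1.mul h2).mul (h4.comp_hasFDerivAt (f := fun y => v y / V y) x
    ((h3.mul h6).congr_of_eventuallyEq (Eventually.of_forall fun y => div_eq_mul_inv _ _)))
  refine ext_inner_right ℝ fun y => ?_
  rw [inner_gradient_eq_fderiv]
  rw [show fderiv ℝ (fun x => c x * V x * g (v x / V x)) x = _ from h5.fderiv]
  simp only [compositeA, compositeB, inner_add_left, real_inner_smul_left, inner_gradient_eq_fderiv]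
  simp
  field_simp
  ring

theorem continuousOn_gradient {D : Set (EuclideanSpace ℝ (Fin N))}
    {V : EuclideanSpace ℝ (Fin N) → ℝ}
    (hV : ∀ x ∈ D, ContDiffAt ℝ ∞ V x) : ContinuousOn (gradient V) D := by
  intro x hx
  refine ContinuousAt.continuousWithinAt ?_
  exact (InnerProductSpace.toDual ℝ _).symm.continuous.continuousAt.comp
    ((hV x hx).continuousAt_fderiv (by simp))

theorem continuous_gradient {c : EuclideanSpace ℝ (Fin N) → ℝ} (hc : ContDiff ℝ ∞ c) :
    Continuous (gradient c) := by
  rw [← continuousOn_univ]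
  exact continuousOn_gradient fun x _ => hc.contDiffAt

theorem exists_bound_of_hasCompactSupport {g : ℝ → ℝ} (hg : Continuous g)
    (hgs : HasCompactSupport g) : ∃ C, ∀ s, |g s| ≤ C := hg.bounded_above_of_compact_support hgs

/-- A weak differential inequality may be tested with `c * V * g (u / V)`. -/
theorem weak_inequality_composite {D : Set (EuclideanSpace ℝ (Fin N))} (hD : IsOpen D)
    {u : EuclideanSpace ℝ (Fin N) → ℝ} {G : EuclideanSpace ℝ (Fin N) → EuclideanSpace ℝ (Fin N)}
    (hu : HasWeakGradient D u G) {p q : ℝ} (hpq : p.HolderConjugate q)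
    (hG : MemLp G (ENNReal.ofReal p) (volume.restrict D))
    {c V : EuclideanSpace ℝ (Fin N) → ℝ} {g : ℝ → ℝ} (hc : IsTestFunction D c)
    (hc0 : ∀ x, 0 ≤ c x)
    (hV : ∀ x ∈ D, ContDiffAt ℝ ∞ V x) (hV0 : ∀ x ∈ D, 0 < V x) (hg : ContDiff ℝ ∞ g)
    (hgs : HasCompactSupport g) (hg0 : ∀ s, 0 ≤ g s)
    {Y : EuclideanSpace ℝ (Fin N) → EuclideanSpace ℝ (Fin N)} {H : EuclideanSpace ℝ (Fin N) → ℝ}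
    (hY : MemLp Y (ENNReal.ofReal q) (volume.restrict (tsupport c)))
    (hH : IntegrableOn H (tsupport c))
    (hineq : ∀ φ, IsTestFunction D φ → (∀ x, 0 ≤ φ x) →
      ∫ x in D, (inner ℝ (Y x) (gradient φ x) + H x * φ x) ≤ 0) :
    IntegrableOn (fun x => inner ℝ (Y x) (compositeA c V g x (u x)
      + compositeB c V g x (u x) • G x) + H x * (c x * V x * g (u x / V x))) D ∧
    ∫ x in D, (inner ℝ (Y x) (compositeA c V g x (u x)
      + compositeB c V g x (u x) • G x) + H x * (c x * V x * g (u x / V x))) ≤ 0 := by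
  set K := tsupport c with hK
  have hKc : IsCompact K := hc.2.1
  have hKD : K ⊆ D := hc.2.2
  have hKm : MeasurableSet K := hKc.measurableSet
  obtain ⟨v, hvs, hvt, hvg⟩ := exists_smooth_approximation hD hKc hKD hu hpq.lt.le hG
  have : IsFiniteMeasure (volume.restrict K) := ⟨by simpa using hKc.measure_lt_top⟩
  have hVK : ContinuousOn V K := fun x hx => (hV x (hKD hx)).continuousAt.continuousWithinAt
  have hgV : ContinuousOn (gradient V) K := (continuousOn_gradient hV).mono hKD
  have hcc : Continuous c := hc.1.continuous
  have hgc : Continuous (gradient c) := continuous_gradient hc.1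
  have hdg : Continuous (deriv g) := hg.continuous_deriv (by simp)
  have hVne : ∀ x ∈ K, V x ≠ 0 := fun x hx => (hV0 x (hKD hx)).ne'
  have hdiv : ∀ w : EuclideanSpace ℝ (Fin N) → ℝ, Continuous w →
      ContinuousOn (fun x => w x / V x) K := fun w hw => hw.continuousOn.div hVK hVne
  obtain ⟨C1, hC1⟩ := hKc.exists_bound_of_continuousOn hcc.continuousOn
  obtain ⟨C2, hC2⟩ := hKc.exists_bound_of_continuousOn hgc.continuousOn
  obtain ⟨C3, hC3⟩ := hKc.exists_bound_of_continuousOn hVK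
  obtain ⟨C4, hC4⟩ := hKc.exists_bound_of_continuousOn hgV
  obtain ⟨C5, hC5⟩ := exists_bound_of_hasCompactSupport hg.continuous hgs
  obtain ⟨C6, hC6⟩ := exists_bound_of_hasCompactSupport hdg hgs.deriv
  -- The product `s g'(s)` comes from differentiating `V` inside the quotient; it is bounded because
  -- `g'` has compact support.
  obtain ⟨C7, hC7⟩ := exists_bound_of_hasCompactSupport (g := fun s => s * deriv g s)
    (continuous_id.mul hdg) (hgs.deriv.mul_left)
  set M : ℝ := |C1| + |C2| + |C3| + |C4| + |C5| + |C6| + |C7| with hM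
  have a1 := abs_nonneg C1
  have a2 := abs_nonneg C2
  have a3 := abs_nonneg C3
  have a4 := abs_nonneg C4
  have a5 := abs_nonneg C5
  have a6 := abs_nonneg C6
  have a7 := abs_nonneg C7
  have hM0 : 0 ≤ M := by positivity
  have b1 : ∀ x ∈ K, |c x| ≤ M := fun x hx => by
    linarith [(hC1 x hx).trans (le_abs_self C1), Real.norm_eq_abs (c x)]
  have b2 : ∀ x ∈ K, ‖gradient c x‖ ≤ M := fun x hx => by
    linarith [(hC2 x hx).trans (le_abs_self C2)]
  have b3 : ∀ x ∈ K, |V x| ≤ M := fun x hx => by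
    linarith [(hC3 x hx).trans (le_abs_self C3), Real.norm_eq_abs (V x)]
  have b4 : ∀ x ∈ K, ‖gradient V x‖ ≤ M := fun x hx => by
    linarith [(hC4 x hx).trans (le_abs_self C4)]
  have b5 : ∀ s, |g s| ≤ M := fun s => by linarith [(hC5 s).trans (le_abs_self C5)]
  have b6 : ∀ s, |deriv g s| ≤ M := fun s => by linarith [(hC6 s).trans (le_abs_self C6)]
  have b7 : ∀ s, |s * deriv g s| ≤ M := fun s => by linarith [(hC7 s).trans (le_abs_self C7)]
  -- One constant for all coefficients: `M²` for the factor of `∇v`, `M³` for the test function, and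
  -- `M³ + 2 M³` for the part of the gradient without `∇v`.
  set C : ℝ := M * M + 3 * (M * M * M) with hC
  have hM2 : 0 ≤ M * M := by positivity
  have hM3 : 0 ≤ M * M * M := by positivity
  have key := tendsto_integral_composite (ν := volume.restrict K) hpq hY hH (v := v) (u := u)
    (Dv := fun m => gradient (v m)) (G := G) hvt ?_ hvg
    (hG.mono_measure (Measure.restrict_mono hKD le_rfl))
    (F := fun x s => c x * V x * g (s / V x)) (A := compositeA c V g) (B := compositeB c V g)
    (C := C) ?_ ?_ ?_ ?_ ?_ ?_ ?_ ?_ ?_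
  · have hzero : ∀ x, x ∉ K → ∀ s, inner ℝ (Y x) (compositeA c V g x s
        + compositeB c V g x s • G x) + H x * (c x * V x * g (s / V x)) = 0 := by
      intro x hx s
      have h1 : c x = 0 := image_eq_zero_of_notMem_tsupport hx
      have h2 : gradient c x = 0 := gradient_of_notMem_tsupport hx
      simp [compositeA, compositeB, h1, h2]
    have hle : ∀ m, ∫ x in K, (inner ℝ (Y x) (compositeA c V g x (v m x)
        + compositeB c V g x (v m x) • gradient (v m) x)
        + H x * (c x * V x * g (v m x / V x))) ≤ 0 := by
      intro m
      have ht : IsTestFunction D (fun x => c x * V x * g (v m x / V x)) :=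
        ⟨contDiff_composite hc hV hV0 hg (hvs m),
          hKc.of_isClosed_subset (isClosed_tsupport _) (tsupport_composite_subset c V (v m) g),
          (tsupport_composite_subset c V (v m) g).trans hKD⟩
      have h := hineq _ ht fun x => by
        by_cases hx : x ∈ K
        · exact mul_nonneg (mul_nonneg (hc0 x) (hV0 x (hKD hx)).le) (hg0 _)
        · simp [image_eq_zero_of_notMem_tsupport hx]
      refine le_trans (le_of_eq ?_) h
      rw [setIntegral_eq_of_subset_of_forall_sdiff_eq_zero hD.measurableSet hKD]
      · refine setIntegral_congr_fun hKm fun x hx => ?_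
        rw [gradient_composite hc.1 hV hV0 hg (hvs m) (hKD hx)]
      · intro x hx
        have h0 : x ∉ tsupport (fun x => c x * V x * g (v m x / V x)) :=
          fun h => hx.2 (tsupport_composite_subset c V (v m) g h)
        rw [gradient_of_notMem_tsupport h0]
        simp [image_eq_zero_of_notMem_tsupport hx.2]
    refine ⟨(integrableOn_iff_integrable_of_support_subset ?_).2
      ((integrableOn_iff_integrable_of_support_subset ?_).1 key.1), ?_⟩
    · intro x hx
      by_contra h
      exact hx (hzero x (fun h' => h (hKD h')) _)
    · intro x hx
      by_contra h
      exact hx (hzero x h _)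
    · rw [setIntegral_eq_of_subset_of_forall_sdiff_eq_zero hD.measurableSet hKD
        fun x hx => hzero x hx.2 _]
      exact le_of_tendsto' key.2 hle
  · intro m
    exact (continuous_gradient (hvs m)).aestronglyMeasurable
  · filter_upwards [ae_restrict_mem hKm] with x hx
    exact continuous_const.mul (hg.continuous.comp (continuous_id.div_const _))
  · filter_upwards [ae_restrict_mem hKm] with x hx
    have h1 : Continuous fun s : ℝ => g (s / V x) := hg.continuous.comp (continuous_id.div_const _)
    have h2 : Continuous fun s : ℝ => deriv g (s / V x) := hdg.comp (continuous_id.div_const _)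
    unfold compositeA
    fun_prop
  · filter_upwards [ae_restrict_mem hKm] with x hx
    exact continuous_const.mul (hdg.comp (continuous_id.div_const _))
  · filter_upwards [ae_restrict_mem hKm] with x hx s
    have : |c x * V x * g (s / V x)| ≤ M * M * M := by
      rw [abs_mul, abs_mul]
      have := b1 x hx
      have := b3 x hx
      have := b5 (s / V x)
      gcongr
    linarith
  · filter_upwards [ae_restrict_mem hKm] with x hx s
    have e1 : ‖(V x * g (s / V x)) • gradient c x‖ ≤ M * M * M := by
      rw [norm_smul, norm_mul, Real.norm_eq_abs, Real.norm_eq_abs]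
      have := b2 x hx
      have := b3 x hx
      have := b5 (s / V x)
      gcongr
    have e2 : ‖(c x * (g (s / V x) - s / V x * deriv g (s / V x))) • gradient V x‖
        ≤ M * (M + M) * M := by
      rw [norm_smul, norm_mul, Real.norm_eq_abs, Real.norm_eq_abs]
      have := b1 x hx
      have := b4 x hx
      have : |g (s / V x) - s / V x * deriv g (s / V x)| ≤ M + M :=
        (abs_sub _ _).trans (add_le_add (b5 _) (b7 _))
      gcongr
    refine (norm_add_le _ _).trans ?_
    linarith
  · filter_upwards [ae_restrict_mem hKm] with x hx s
    have : |compositeB c V g x s| ≤ M * M := by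
      rw [compositeB, abs_mul]
      have := b1 x hx
      have := b6 (s / V x)
      gcongr
    linarith
  · intro m
    exact (contDiff_composite hc hV hV0 hg (hvs m)).continuous.aestronglyMeasurable
  · intro m
    have h0 := hdiv (v m) (hvs m).continuous
    have h1 := hg.continuous.comp_continuousOn h0
    have h2 := hdg.comp_continuousOn h0
    refine ContinuousOn.aestronglyMeasurable ?_ hKm
    exact ((hVK.mul h1).smul hgc.continuousOn).add
      ((hcc.continuousOn.mul (h1.sub (h0.mul h2))).smul hgV)
  · intro m
    exact (hcc.continuousOn.mul (hdg.comp_continuousOn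
      (hdiv (v m) (hvs m).continuous))).aestronglyMeasurable hKm

end CompositeTest

/-! ### Integration by parts for radial fields. -/

section RadialDivergence

variable {N : ℕ}

/-- The divergence theorem for the radial field `β (‖x‖²) x` against a test function. -/
theorem integral_inner_radial_gradient {D : Set (EuclideanSpace ℝ (Fin N))}
    {τ₀ : ℝ} (hD0 : ∀ x ∈ D, τ₀ < ‖x‖ ^ 2) {β β' : ℝ → ℝ}
    (hβ : ∀ τ, τ₀ < τ → HasDerivAt β (β' τ) τ) (hβ' : ContinuousOn β' (Set.Ioi τ₀))
    {φ : EuclideanSpace ℝ (Fin N) → ℝ} (hφ : IsTestFunction D φ) :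
    ∫ x in D, (inner ℝ (β (‖x‖ ^ 2) • x) (gradient φ x)
      + (2 * ‖x‖ ^ 2 * β' (‖x‖ ^ 2) + N * β (‖x‖ ^ 2)) * φ x) = 0 := by
  set K := tsupport φ with hK
  have hKc : IsCompact K := hφ.2.1
  have hKD : K ⊆ D := hφ.2.2
  have hpos : ∀ x ∈ K, τ₀ < ‖x‖ ^ 2 := fun x hx => hD0 x (hKD hx)
  have hφ0 : ∀ x, x ∉ K → φ x = 0 := fun x hx => image_eq_zero_of_notMem_tsupport hx
  have hdφ0 : ∀ x, x ∉ K → fderiv ℝ φ x = 0 := fun x hx => by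
    by_contra h
    exact hx (support_fderiv_subset ℝ h)
  have hgφ0 : ∀ x, x ∉ K → gradient φ x = 0 := fun x hx => gradient_of_notMem_tsupport hx
  have hβc : ContinuousOn (fun x : EuclideanSpace ℝ (Fin N) => β (‖x‖ ^ 2)) K := by
    intro x hx
    exact ((hβ _ (hpos x hx)).continuousAt.comp (f := fun x : EuclideanSpace ℝ (Fin N) => ‖x‖ ^ 2)
      (by fun_prop)).continuousWithinAt
  have hβ'c : ContinuousOn (fun x : EuclideanSpace ℝ (Fin N) => β' (‖x‖ ^ 2)) K :=
    hβ'.comp (by fun_prop) fun x hx => hpos x hx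
  have hint : ∀ w : EuclideanSpace ℝ (Fin N) → ℝ, ContinuousOn w K → (∀ x, x ∉ K → w x = 0) →
      Integrable w volume := by
    intro w hw hw0
    refine (integrableOn_iff_integrable_of_support_subset fun x hx => ?_).1
      (hw.integrableOn_compact hKc)
    by_contra h
    exact hx (hw0 x h)
  have hdφc : Continuous (fderiv ℝ φ) := hφ.1.continuous_fderiv (by simp)
  have hφc : Continuous φ := hφ.1.continuous
  have hi1 : ∀ i : Fin N, Integrable (fun x : EuclideanSpace ℝ (Fin N) =>
      β (‖x‖ ^ 2) * x i * fderiv ℝ φ x (EuclideanSpace.single i 1)) volume := fun i =>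
    hint _ ((hβc.mul (by fun_prop)).mul (by fun_prop)) fun x hx => by simp [hdφ0 x hx]
  have hi2 : ∀ i : Fin N, Integrable (fun x : EuclideanSpace ℝ (Fin N) =>
      (β' (‖x‖ ^ 2) * (2 * x i) * x i + β (‖x‖ ^ 2)) * φ x) volume := fun i =>
    hint _ ((((hβ'c.mul (by fun_prop)).mul (by fun_prop)).add hβc).mul (by fun_prop))
      fun x hx => by simp [hφ0 x hx]
  have hi3 : ∀ i : Fin N, Integrable (fun x : EuclideanSpace ℝ (Fin N) =>
      β (‖x‖ ^ 2) * x i * φ x) volume := fun i =>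
    hint _ ((hβc.mul (by fun_prop)).mul (by fun_prop)) fun x hx => by simp [hφ0 x hx]
  have hf : ∀ i : Fin N, ∀ x ∈ K, ∃ f' : EuclideanSpace ℝ (Fin N) →L[ℝ] ℝ,
      HasFDerivAt (fun x : EuclideanSpace ℝ (Fin N) => β (‖x‖ ^ 2) * x i) f' x ∧
      f' (EuclideanSpace.single i 1) = β' (‖x‖ ^ 2) * (2 * x i) * x i + β (‖x‖ ^ 2) := by
    intro i x hx
    have h1 : HasFDerivAt (fun x : EuclideanSpace ℝ (Fin N) => ‖x‖ ^ 2) _ x :=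
      (hasStrictFDerivAt_norm_sq x).hasFDerivAt
    have h2 := (hβ _ (hpos x hx)).comp_hasFDerivAt
      (f := fun x : EuclideanSpace ℝ (Fin N) => ‖x‖ ^ 2) x h1
    have h3 : HasFDerivAt (fun x : EuclideanSpace ℝ (Fin N) => x i)
        (EuclideanSpace.proj i : EuclideanSpace ℝ (Fin N) →L[ℝ] ℝ) x :=
      (EuclideanSpace.proj i : EuclideanSpace ℝ (Fin N) →L[ℝ] ℝ).hasFDerivAt
    refine ⟨_, h2.mul h3, ?_⟩
    simp [EuclideanSpace.inner_single_right]
    ring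
  have hcoord : ∀ i : Fin N, ∫ x : EuclideanSpace ℝ (Fin N),
      β (‖x‖ ^ 2) * x i * fderiv ℝ φ x (EuclideanSpace.single i 1)
      = - ∫ x : EuclideanSpace ℝ (Fin N),
        (β' (‖x‖ ^ 2) * (2 * x i) * x i + β (‖x‖ ^ 2)) * φ x := by
    intro i
    choose! f' hf1 hf2 using hf i
    have e : (fun x : EuclideanSpace ℝ (Fin N) =>
        (β' (‖x‖ ^ 2) * (2 * x i) * x i + β (‖x‖ ^ 2)) * φ x)
        = fun x => f' x (EuclideanSpace.single i 1) * φ x := by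
      ext x
      by_cases hx : x ∈ K
      · rw [hf2 x hx]
      · simp [hφ0 x hx]
    have hi2' := hi2 i
    rw [e] at hi2' ⊢
    exact integral_bilinear_hasFDerivAt_right_eq_neg_left_of_integrable
      (B := ContinuousLinearMap.mul ℝ ℝ) (f := fun x : EuclideanSpace ℝ (Fin N) =>
        β (‖x‖ ^ 2) * x i) (f' := f') (g := φ) (g' := fderiv ℝ φ) hi2' (hi1 i) (hi3 i)
      (fun x hx => hf1 x hx)
      (fun x _ => ((hφ.1.differentiable (by simp)) x).hasFDerivAt)
  rw [setIntegral_eq_integral_of_forall_compl_eq_zero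
    (fun y hy => by rw [hgφ0 y (fun h => hy (hKD h)), hφ0 y (fun h => hy (hKD h))]; simp)]
  have e1 : (fun x : EuclideanSpace ℝ (Fin N) => inner ℝ (β (‖x‖ ^ 2) • x) (gradient φ x))
      = fun x => ∑ i, β (‖x‖ ^ 2) * x i * fderiv ℝ φ x (EuclideanSpace.single i 1) := by
    ext x
    rw [PiLp.inner_apply]
    refine Finset.sum_congr rfl fun i _ => ?_
    rw [← gradient_apply_coord]
    simp
    ring
  have e2 : (fun x : EuclideanSpace ℝ (Fin N) =>
      (2 * ‖x‖ ^ 2 * β' (‖x‖ ^ 2) + N * β (‖x‖ ^ 2)) * φ x)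
      = fun x => ∑ i, (β' (‖x‖ ^ 2) * (2 * x i) * x i + β (‖x‖ ^ 2)) * φ x := by
    ext x
    rw [← Finset.sum_mul, Finset.sum_add_distrib]
    congr 2
    · conv_lhs => rw [EuclideanSpace.real_norm_sq_eq x]
      rw [Finset.mul_sum, Finset.sum_mul]
      refine Finset.sum_congr rfl fun i _ => ?_
      rw [EuclideanSpace.real_norm_sq_eq x]
      ring
    · simp
  have j1 : Integrable
      (fun x : EuclideanSpace ℝ (Fin N) => inner ℝ (β (‖x‖ ^ 2) • x) (gradient φ x)) volume := by
    rw [e1]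
    exact integrable_finsetSum _ fun i _ => hi1 i
  have j2 : Integrable (fun x : EuclideanSpace ℝ (Fin N) =>
      (2 * ‖x‖ ^ 2 * β' (‖x‖ ^ 2) + N * β (‖x‖ ^ 2)) * φ x) volume := by
    rw [e2]
    exact integrable_finsetSum _ fun i _ => hi2 i
  rw [integral_add j1 j2, e1, e2, integral_finsetSum _ fun i _ => hi1 i,
    integral_finsetSum _ fun i _ => hi2 i, ← Finset.sum_add_distrib]
  exact Finset.sum_eq_zero fun i _ => by rw [hcoord i, neg_add_cancel]

end RadialDivergence

/-! ### Pointwise inequalities for the `p`-Laplacian. -/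

section PointwiseInequalities

variable {E : Type*} [NormedAddCommGroup E]

theorem norm_rpow_sub_two_mul_norm {p : ℝ} (hp : 1 < p) (a : E) :
    ‖a‖ ^ (p - 2) * ‖a‖ = ‖a‖ ^ (p - 1) := by
  rcases eq_or_lt_of_le (norm_nonneg a) with h | h
  · rw [← h, Real.zero_rpow (by linarith : p - 1 ≠ 0), mul_zero]
  · rw [← Real.rpow_add_one h.ne']
    ring_nf

theorem norm_rpow_sub_one_mul_norm {p : ℝ} (hp : 1 < p) (a : E) :
    ‖a‖ ^ (p - 1) * ‖a‖ = ‖a‖ ^ p := by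
  rcases eq_or_lt_of_le (norm_nonneg a) with h | h
  · rw [← h, Real.zero_rpow (by linarith : p ≠ 0), mul_zero]
  · rw [← Real.rpow_add_one h.ne']
    ring_nf

/-- Young's inequality with exponents `p/(p-1)` and `p`, multiplied by `p`. -/
theorem mul_rpow_sub_one_mul_le {p x y : ℝ} (hp : 1 < p) (hx : 0 ≤ x) (hy : 0 ≤ y) :
    p * (x ^ (p - 1) * y) ≤ (p - 1) * x ^ p + y ^ p := by
  have hpq := Real.HolderConjugate.conjExponent hp
  have h := Real.young_inequality_of_nonneg (Real.rpow_nonneg hx (p - 1)) hy hpq.symm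
  have hq : (x ^ (p - 1)) ^ (p.conjExponent) = x ^ p := by
    rw [← Real.rpow_mul hx, hpq.sub_one_mul_conj]
  rw [hq] at h
  have hpp : 0 < p := by linarith
  have h' := mul_le_mul_of_nonneg_left h hpp.le
  refine h'.trans (le_of_eq ?_)
  have : p.conjExponent = p / (p - 1) := rfl
  rw [this]
  have : p - 1 ≠ 0 := by linarith
  field_simp

variable [InnerProductSpace ℝ E]

theorem rpow_sub_two_mul_inner_le {p : ℝ} (hp : 1 < p) (a b : E) :
    ‖a‖ ^ (p - 2) * inner ℝ a b ≤ ‖a‖ ^ (p - 1) * ‖b‖ := by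
  rw [← norm_rpow_sub_two_mul_norm hp, mul_assoc]
  gcongr
  exact real_inner_le_norm a b

/-- Convexity of `‖·‖ ^ p`. -/
theorem picone_nonneg {p : ℝ} (hp : 1 < p) (a b : E) :
    0 ≤ ‖b‖ ^ p + (p - 1) * ‖a‖ ^ p - p * (‖a‖ ^ (p - 2) * inner ℝ a b) := by
  have h1 := rpow_sub_two_mul_inner_le hp a b
  have h2 := mul_rpow_sub_one_mul_le hp (norm_nonneg a) (norm_nonneg b)
  nlinarith

theorem rpow_sub_two_mul_inner_self {p : ℝ} (hp : 1 < p) (a : E) :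
    ‖a‖ ^ (p - 2) * inner ℝ a a = ‖a‖ ^ p := by
  rw [real_inner_self_eq_norm_mul_norm, ← mul_assoc, norm_rpow_sub_two_mul_norm hp,
    norm_rpow_sub_one_mul_norm hp]

/-- By Cauchy–Schwarz the expression is at least `(‖b‖^(p-1) - ‖a‖^(p-1)) (‖b‖ - ‖a‖)`, whose
factors have the same sign. -/
theorem monotone_nonneg {p : ℝ} (hp : 1 < p) (a b : E) :
    0 ≤ inner ℝ (‖b‖ ^ (p - 2) • b - ‖a‖ ^ (p - 2) • a) (b - a) := by
  have h1 := rpow_sub_two_mul_inner_le hp a b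
  have h2 := rpow_sub_two_mul_inner_le hp b a
  have h3 : 0 ≤ (‖b‖ ^ (p - 1) - ‖a‖ ^ (p - 1)) * (‖b‖ - ‖a‖) := by
    rcases le_total ‖a‖ ‖b‖ with h | h
    · exact mul_nonneg (sub_nonneg.2 (Real.rpow_le_rpow (norm_nonneg _) h (by linarith)))
        (sub_nonneg.2 h)
    · exact mul_nonneg_of_nonpos_of_nonpos
        (sub_nonpos.2 (Real.rpow_le_rpow (norm_nonneg _) h (by linarith))) (sub_nonpos.2 h)
  rw [inner_sub_left, inner_sub_right, inner_sub_right]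
  simp only [real_inner_smul_left]
  have e1 := rpow_sub_two_mul_inner_self hp a
  have e2 := rpow_sub_two_mul_inner_self hp b
  have e3 := norm_rpow_sub_one_mul_norm hp a
  have e4 := norm_rpow_sub_one_mul_norm hp b
  nlinarith

theorem rpow_sub_one_mul_le_add {p x y : ℝ} (hp : 1 < p) (hx : 0 ≤ x) (hy : 0 ≤ y) :
    x ^ (p - 1) * y ≤ x ^ p + y ^ p := by
  have h := mul_rpow_sub_one_mul_le hp hx hy
  have h1 := Real.rpow_nonneg hx p
  have h2 := Real.rpow_nonneg hy p
  have h3 : 0 ≤ x ^ (p - 1) * y := mul_nonneg (Real.rpow_nonneg hx _) hy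
  nlinarith

/-- Needed where the truncation decreases, since the monotonicity term then has the wrong sign and
must be absorbed into an integrable error. -/
theorem monotone_le {p : ℝ} (hp : 1 < p) (a b : E) :
    inner ℝ (‖b‖ ^ (p - 2) • b - ‖a‖ ^ (p - 2) • a) (b - a) ≤ 3 * (‖a‖ ^ p + ‖b‖ ^ p) := by
  have h1 := rpow_sub_two_mul_inner_le hp a (-b)
  have h2 := rpow_sub_two_mul_inner_le hp b (-a)
  have h3 := rpow_sub_one_mul_le_add hp (norm_nonneg a) (norm_nonneg b)
  have h4 := rpow_sub_one_mul_le_add hp (norm_nonneg b) (norm_nonneg a)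
  rw [inner_sub_left, inner_sub_right, inner_sub_right]
  simp only [real_inner_smul_left]
  rw [rpow_sub_two_mul_inner_self hp a, rpow_sub_two_mul_inner_self hp b]
  rw [inner_neg_right, norm_neg] at h1 h2
  nlinarith

theorem picone_le {p : ℝ} (hp : 1 < p) (a b : E) :
    ‖b‖ ^ p + (p - 1) * ‖a‖ ^ p - p * (‖a‖ ^ (p - 2) * inner ℝ a b)
      ≤ 2 * p * (‖a‖ ^ p + ‖b‖ ^ p) := by
  have h1 := rpow_sub_two_mul_inner_le hp a (-b)
  rw [inner_neg_right, norm_neg] at h1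
  have h2 := rpow_sub_one_mul_le_add hp (norm_nonneg a) (norm_nonneg b)
  have h3 : 0 ≤ ‖a‖ ^ p := by positivity
  have h4 : 0 ≤ ‖b‖ ^ p := by positivity
  nlinarith

end PointwiseInequalities

/-! ### The characteristic function and the barrier profile in one variable. -/

section Barrier

/-- The derivative is `(p-1) w^(p-2) (p w - (N-p))`, which is positive beyond `(N-p)/p`. -/
theorem strictMonoOn_characteristic {N : ℕ} {p : ℝ} (μ : ℝ) (hp : 1 < p) (hpN : p < N) :
    StrictMonoOn (fun w : ℝ => (p - 1) * w ^ p - (N - p) * w ^ (p - 1) + μ)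
      (Set.Ici ((N - p) / p)) := by
  have ha : 0 < ((N : ℝ) - p) / p := div_pos (by linarith) (by linarith)
  refine strictMonoOn_of_deriv_pos (convex_Ici _) ?_ ?_
  · refine ContinuousOn.add (ContinuousOn.sub (ContinuousOn.mul continuousOn_const ?_)
      (ContinuousOn.mul continuousOn_const ?_)) continuousOn_const
    · exact continuousOn_id.rpow_const fun x hx => Or.inl (ha.trans_le hx).ne'
    · exact continuousOn_id.rpow_const fun x hx => Or.inl (ha.trans_le hx).ne'
  · intro w hw
    rw [interior_Ici, Set.mem_Ioi] at hw
    have hw0 : 0 < w := ha.trans hw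
    have h1 := Real.hasDerivAt_rpow_const (x := w) (p := p) (Or.inl hw0.ne')
    have h2 := Real.hasDerivAt_rpow_const (x := w) (p := p - 1) (Or.inl hw0.ne')
    have h3 := (((h1.const_mul (p - 1)).sub (h2.const_mul ((N : ℝ) - p))).add_const μ)
    rw [show deriv (fun w : ℝ => (p - 1) * w ^ p - (N - p) * w ^ (p - 1) + μ) w = _ from h3.deriv]
    have e : w ^ (p - 1) = w ^ (p - 1 - 1) * w := by
      rw [← Real.rpow_add_one hw0.ne']; ring_nf
    rw [e]
    have h4 : 0 < w ^ (p - 1 - 1) := Real.rpow_pos_of_pos hw0 _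
    have h5 : 0 < p * w - (N - p) := by
      have := (div_lt_iff₀ (by linarith : 0 < p)).1 hw
      linarith
    have : (p - 1) * (p * (w ^ (p - 1 - 1) * w)) - (N - p) * ((p - 1) * w ^ (p - 1 - 1))
        = (p - 1) * w ^ (p - 1 - 1) * (p * w - (N - p)) := by ring
    rw [this]
    have : 0 < p - 1 := by linarith
    positivity

/-- The characteristic function equals `μ - a^p < 0` at `a = (N-p)/p` and `μ ≥ 0` at `(N-p)/(p-1)`.
It increases strictly from `a` on, so its unique zero there is the largest root, and it is
nonpositive between `a` and that zero. -/
theorem gamma₂_spec {N : ℕ} {p μ : ℝ} (hp : 1 < p) (hpN : p < N) (hμ : 0 ≤ μ)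
    (hμ' : μ < (((N : ℝ) - p) / p) ^ p) :
    ((N : ℝ) - p) / p < gamma₂ N p μ ∧ ∀ w, ((N : ℝ) - p) / p ≤ w → w ≤ gamma₂ N p μ →
      (p - 1) * w ^ p - (N - p) * w ^ (p - 1) + μ ≤ 0 := by
  set a : ℝ := ((N : ℝ) - p) / p with ha'
  have hp0 : 0 < p := by linarith
  have ha : 0 < a := div_pos (by linarith) hp0
  have hmono := strictMonoOn_characteristic (N := N) μ hp hpN
  set Φ : ℝ → ℝ := fun w => (p - 1) * w ^ p - (N - p) * w ^ (p - 1) + μ with hΦ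
  have hroot : ∀ w, 0 < w → w ^ (p - 2) * ((p - 1) * w ^ 2 - (N - p) * w) + μ = Φ w := by
    intro w hw
    have e1 : w ^ (p - 1) = w ^ (p - 2) * w := by
      rw [← Real.rpow_add_one hw.ne']; ring_nf
    have e2 : w ^ p = w ^ (p - 2) * w ^ 2 := by
      rw [← Real.rpow_natCast w 2, ← Real.rpow_add hw]; norm_num
    simp only [hΦ, e1, e2]
    ring
  have hΦa : Φ a < 0 := by
    have e : a ^ p = a ^ (p - 1) * a := by
      rw [← Real.rpow_add_one ha.ne']; ring_nf
    have hN : (N : ℝ) - p = p * a := by rw [ha']; field_simp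
    have : Φ a = μ - a ^ p := by
      simp only [hΦ, hN, e]; ring
    linarith
  set b : ℝ := ((N : ℝ) - p) / (p - 1) with hb'
  have hp1 : 0 < p - 1 := by linarith
  have hab : a ≤ b := div_le_div_of_nonneg_left (by linarith) hp1 (by linarith)
  have hb0 : 0 < b := ha.trans_le hab
  have hΦb : 0 ≤ Φ b := by
    have e : b ^ p = b ^ (p - 1) * b := by
      rw [← Real.rpow_add_one hb0.ne']; ring_nf
    have hN : (N : ℝ) - p = (p - 1) * b := by rw [hb']; field_simp
    have : Φ b = μ := by simp only [hΦ, hN, e]; ring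
    linarith
  have hcont : ContinuousOn Φ (Set.Icc a b) := by
    have h : ∀ q : ℝ, ContinuousOn (fun w : ℝ => w ^ q) (Set.Icc a b) := fun q =>
      continuousOn_id.rpow_const fun x hx => Or.inl (ha.trans_le hx.1).ne'
    exact ((continuousOn_const.mul (h p)).sub (continuousOn_const.mul (h (p - 1)))).add
      continuousOn_const
  obtain ⟨r, hr, hr0⟩ := intermediate_value_Icc hab hcont ⟨hΦa.le, hΦb⟩
  have har : a < r := lt_of_le_of_ne hr.1 fun h => by rw [h] at hΦa; linarith
  have hgreat : IsGreatest (exponentRoots N p μ) r := by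
    refine ⟨⟨(ha.trans har).le, by rw [hroot r (ha.trans har)]; exact hr0⟩, ?_⟩
    rintro w ⟨hw0, hw⟩
    by_contra! hlt
    rw [hroot w ((ha.trans har).trans hlt)] at hw
    have : Φ r < Φ w := hmono hr.1 (hr.1.trans hlt.le) hlt
    linarith
  have hγ : gamma₂ N p μ = r := hgreat.csSup_eq
  rw [hγ]
  refine ⟨har, fun w h1 h2 => ?_⟩
  have := hmono.monotoneOn h1 (h1.trans h2) h2
  exact this.trans hr0.le

/-- The logarithmic slope `-r v' / v` of the barrier `v`, in terms of `τ = r ^ 2`. -/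
def barrierSlope (γ δ ε τ : ℝ) : ℝ := γ - δ * τ ^ (-(ε / 2))

/-- The barrier `r ^ (-γ) * exp (-(δ / ε) * r ^ (-ε))`, in terms of `τ = r ^ 2`. -/
def barrierProfile (γ δ ε τ : ℝ) : ℝ := τ ^ (-(γ / 2)) * Real.exp (-(δ / ε) * τ ^ (-(ε / 2)))

/-- The ratio `-Δ_p v / v ^ (p - 1)` for the barrier `v`, in terms of `τ = r ^ 2`. -/
def barrierRate (N : ℕ) (p γ δ ε τ : ℝ) : ℝ :=
  τ ^ (-(p / 2)) * ((N - p) * barrierSlope γ δ ε τ ^ (p - 1) - (p - 1) * barrierSlope γ δ ε τ ^ p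
    + (p - 1) * barrierSlope γ δ ε τ ^ (p - 2) * (ε * δ * τ ^ (-(ε / 2))))

theorem barrierProfile_pos (γ δ ε : ℝ) {τ : ℝ} (hτ : 0 < τ) : 0 < barrierProfile γ δ ε τ :=
  mul_pos (Real.rpow_pos_of_pos hτ _) (Real.exp_pos _)

theorem barrierProfile_sq {r : ℝ} (hr : 0 ≤ r) (γ δ ε : ℝ) : barrierProfile γ δ ε (r ^ 2)
    = r ^ (-γ) * Real.exp (-(δ / ε) * (r ^ 2) ^ (-(ε / 2))) := by
  rw [barrierProfile, ← Real.rpow_natCast r 2, ← Real.rpow_mul hr]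
  congr 2
  push_cast
  ring

theorem barrierProfile_sq_le {γ δ ε r : ℝ} (hδ : 0 ≤ δ) (hε : 0 < ε) (hr : 0 ≤ r) :
    barrierProfile γ δ ε (r ^ 2) ≤ r ^ (-γ) := by
  rw [barrierProfile_sq hr]
  refine mul_le_of_le_one_right (by positivity) ?_
  rw [Real.exp_le_one_iff, neg_mul, neg_nonpos]
  positivity

theorem le_barrierProfile_sq {γ δ ε r : ℝ} (hδ : 0 ≤ δ) (hε : 0 < ε) (hr : 1 ≤ r) :
    r ^ (-γ) * Real.exp (-(δ / ε)) ≤ barrierProfile γ δ ε (r ^ 2) := by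
  rw [barrierProfile_sq (by linarith)]
  have h : (r ^ 2) ^ (-(ε / 2)) ≤ 1 :=
    Real.rpow_le_one_of_one_le_of_nonpos (one_le_pow₀ hr) (by linarith)
  have h2 : -(δ / ε) ≤ -(δ / ε) * (r ^ 2) ^ (-(ε / 2)) := by
    have : 0 ≤ δ / ε := by positivity
    nlinarith
  gcongr

theorem hasDerivAt_barrierSlope (γ δ ε : ℝ) {τ : ℝ} (hτ : 0 < τ) :
    HasDerivAt (barrierSlope γ δ ε) (δ * ε / 2 * τ ^ (-(ε / 2)) / τ) τ := by
  have h1 := Real.hasDerivAt_rpow_const (x := τ) (p := -(ε / 2)) (Or.inl hτ.ne')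
  refine ((h1.const_mul δ).const_sub γ).congr_deriv ?_
  rw [Real.rpow_sub_one hτ.ne']
  ring

theorem hasDerivAt_barrierProfile (γ δ : ℝ) {ε τ : ℝ} (hε : ε ≠ 0) (hτ : 0 < τ) :
    HasDerivAt (barrierProfile γ δ ε)
      (-(barrierSlope γ δ ε τ / (2 * τ)) * barrierProfile γ δ ε τ) τ := by
  have h1 := Real.hasDerivAt_rpow_const (x := τ) (p := -(ε / 2)) (Or.inl hτ.ne')
  have h2 := Real.hasDerivAt_rpow_const (x := τ) (p := -(γ / 2)) (Or.inl hτ.ne')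
  refine (h2.mul (h1.const_mul (-(δ / ε))).exp).congr_deriv ?_
  rw [Real.rpow_sub_one hτ.ne', Real.rpow_sub_one hτ.ne', barrierSlope, barrierProfile]
  field_simp
  ring

theorem contDiffAt_barrierProfile (γ δ ε : ℝ) {τ : ℝ} (hτ : 0 < τ) :
    ContDiffAt ℝ ∞ (barrierProfile γ δ ε) τ := by
  unfold barrierProfile
  exact (contDiffAt_id.rpow_const_of_ne hτ.ne').mul
    ((contDiffAt_const.mul (contDiffAt_id.rpow_const_of_ne hτ.ne')).exp)

/-- Lowering the slope below `γ₂` keeps the characteristic function nonpositive, and the variation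
of the slope contributes a positive term of the order `τ^(-α/2)` of the bound on `f`. The factor `2`
in `2 A` leaves room for a strict inequality between the potentials. -/
theorem exists_barrier_constants {N : ℕ} {p μ A α : ℝ} (hp : 1 < p) (hpN : p < N) (hμ : 0 ≤ μ)
    (hμ' : μ < (((N : ℝ) - p) / p) ^ p) (hA : 0 < A) (hα : p < α) :
    ∃ δ R₀ : ℝ, 0 < δ ∧ 1 < R₀ ∧ ∀ τ, R₀ ^ 2 ≤ τ →
      0 < barrierSlope (gamma₂ N p μ) δ (α - p) τ ∧
      barrierSlope (gamma₂ N p μ) δ (α - p) τ ≤ gamma₂ N p μ ∧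
      μ * τ ^ (-(p / 2)) + 2 * A * τ ^ (-(α / 2))
        ≤ barrierRate N p (gamma₂ N p μ) δ (α - p) τ := by
  obtain ⟨haγ, hΦ⟩ := gamma₂_spec hp hpN hμ hμ'
  set γ := gamma₂ N p μ with hγ
  set a : ℝ := ((N : ℝ) - p) / p with ha'
  have hp0 : 0 < p := by linarith
  have hp1 : 0 < p - 1 := by linarith
  have ha : 0 < a := div_pos (by linarith) hp0
  have hγ0 : 0 < γ := ha.trans haγ
  set ε := α - p with hε'
  have hε : 0 < ε := by linarith
  -- Lower bound of `w^(p-2)` on `[a, γ]`; the minimising endpoint depends on the sign of `p - 2`.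
  set m : ℝ := min (a ^ (p - 2)) (γ ^ (p - 2)) with hm'
  have hm : 0 < m := lt_min (Real.rpow_pos_of_pos ha _) (Real.rpow_pos_of_pos hγ0 _)
  have hmle : ∀ w, a ≤ w → w ≤ γ → m ≤ w ^ (p - 2) := by
    intro w h1 h2
    have hw : 0 < w := ha.trans_le h1
    rcases le_total 0 (p - 2) with h | h
    · exact (min_le_left _ _).trans (Real.rpow_le_rpow ha.le h1 h)
    · exact (min_le_right _ _).trans (Real.rpow_le_rpow_of_nonpos hw h2 h)
  -- Chosen so that `(p-1) m ε δ = 2 A`, the size demanded of the last term of the rate.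
  set δ : ℝ := 2 * A / ((p - 1) * ε * m) with hδ'
  have hδ : 0 < δ := by positivity
  have hδeq : (p - 1) * m * (ε * δ) = 2 * A := by
    rw [hδ']; field_simp
  have hlim : Tendsto (fun r : ℝ => δ * r ^ (-ε)) atTop (𝓝 0) := by
    simpa using (tendsto_rpow_neg_atTop hε).const_mul δ
  -- `R₀` is large enough that `δ R₀^(-ε) ≤ γ - a`, which keeps the slope in `[a, γ]`.
  obtain ⟨R₀, hR1, hR2⟩ := ((hlim.eventually (ge_mem_nhds (sub_pos.2 haγ))).and
    (eventually_gt_atTop (1 : ℝ))).exists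
  refine ⟨δ, R₀, hδ, hR2, fun τ hτ => ?_⟩
  have hR0 : 0 < R₀ := by linarith
  have hτ0 : 0 < τ := lt_of_lt_of_le (by positivity) hτ
  set t := τ ^ (-(ε / 2)) with ht'
  have ht0 : 0 < t := Real.rpow_pos_of_pos hτ0 _
  have ht : t ≤ R₀ ^ (-ε) := by
    have : R₀ ^ (-ε) = (R₀ ^ 2) ^ (-(ε / 2)) := by
      rw [← Real.rpow_natCast R₀ 2, ← Real.rpow_mul hR0.le]
      congr 1
      push_cast
      ring
    rw [this]
    exact Real.rpow_le_rpow_of_nonpos (by positivity) hτ (by linarith)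
  have hδt : δ * t ≤ γ - a := (mul_le_mul_of_nonneg_left ht hδ.le).trans hR1
  have hw1 : a ≤ barrierSlope γ δ ε τ := by rw [barrierSlope]; linarith
  have hw2 : barrierSlope γ δ ε τ ≤ γ := by
    rw [barrierSlope]; have := mul_pos hδ ht0; linarith
  refine ⟨ha.trans_le hw1, hw2, ?_⟩
  rw [barrierRate]
  set w := barrierSlope γ δ ε τ with hw'
  have h1 := hΦ w hw1 hw2
  have h2 := hmle w hw1 hw2
  have h3 : 2 * A * t ≤ (p - 1) * w ^ (p - 2) * (ε * δ * t) := by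
    rw [← hδeq]
    have : (p - 1) * m * (ε * δ) * t = (p - 1) * m * (ε * δ * t) := by ring
    rw [this]
    gcongr
  have h4 : τ ^ (-(α / 2)) = τ ^ (-(p / 2)) * t := by
    rw [ht', ← Real.rpow_add hτ0]
    congr 1
    rw [hε']
    ring
  rw [h4]
  have h5 : μ * τ ^ (-(p / 2)) + 2 * A * (τ ^ (-(p / 2)) * t)
      = τ ^ (-(p / 2)) * (μ + 2 * A * t) := by ring
  rw [h5]
  gcongr
  linarith

end Barrier

/-! ### The barrier as a function on space. -/

section BarrierFunction

variable {N : ℕ}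

/-- The radial barrier `x ↦ c |x| ^ (-γ) exp (-(δ / ε) |x| ^ (-ε))`. -/
def barrier (γ δ ε c : ℝ) (x : EuclideanSpace ℝ (Fin N)) : ℝ :=
  c * barrierProfile γ δ ε (‖x‖ ^ 2)

theorem barrier_pos (γ δ ε : ℝ) {c : ℝ} (hc : 0 < c) {x : EuclideanSpace ℝ (Fin N)}
    (hx : x ≠ 0) : 0 < barrier γ δ ε c x :=
  mul_pos hc (barrierProfile_pos γ δ ε (by have := norm_pos_iff.2 hx; positivity))

theorem contDiffAt_barrier (γ δ ε c : ℝ) {x : EuclideanSpace ℝ (Fin N)} (hx : x ≠ 0) :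
    ContDiffAt ℝ ∞ (barrier γ δ ε c) x := by
  have hτ : 0 < ‖x‖ ^ 2 := by have := norm_pos_iff.2 hx; positivity
  exact contDiffAt_const.mul ((contDiffAt_barrierProfile γ δ ε hτ).comp x
    (contDiff_norm_sq ℝ).contDiffAt)

theorem gradient_barrier (γ δ : ℝ) {ε : ℝ} (c : ℝ) (hε : ε ≠ 0) {x : EuclideanSpace ℝ (Fin N)}
    (hx : x ≠ 0) : gradient (barrier γ δ ε c) x
      = (-(barrierSlope γ δ ε (‖x‖ ^ 2) / ‖x‖ ^ 2) * barrier γ δ ε c x) • x := by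
  have hτ : 0 < ‖x‖ ^ 2 := by have := norm_pos_iff.2 hx; positivity
  have h1 : HasFDerivAt (fun x : EuclideanSpace ℝ (Fin N) => ‖x‖ ^ 2) _ x :=
    (hasStrictFDerivAt_norm_sq x).hasFDerivAt
  have h2 := ((hasDerivAt_barrierProfile γ δ hε hτ).const_mul c).comp_hasFDerivAt
      (f := fun x : EuclideanSpace ℝ (Fin N) => ‖x‖ ^ 2) x h1
  refine ext_inner_right ℝ fun y => ?_
  rw [inner_gradient_eq_fderiv, show fderiv ℝ (barrier γ δ ε c) x = _ from h2.fderiv,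
    real_inner_smul_left]
  simp only [barrier, smul_apply, innerSL_apply_apply, smul_eq_mul, nsmul_eq_mul]
  push_cast
  field_simp

theorem norm_gradient_barrier (γ δ : ℝ) {ε c : ℝ} (hε : ε ≠ 0) (hc : 0 < c)
    {x : EuclideanSpace ℝ (Fin N)} (hx : x ≠ 0) (hs : 0 ≤ barrierSlope γ δ ε (‖x‖ ^ 2)) :
    ‖gradient (barrier γ δ ε c) x‖
      = barrierSlope γ δ ε (‖x‖ ^ 2) / ‖x‖ * barrier γ δ ε c x := by
  have hx' := norm_pos_iff.2 hx
  have hV := barrier_pos γ δ ε hc hx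
  rw [gradient_barrier γ δ c hε hx, norm_smul, Real.norm_eq_abs, neg_mul, abs_neg,
    abs_of_nonneg (by positivity)]
  field_simp

/-- The barrier solves `-Δ_p V = rate * V ^ (p - 1)` weakly. -/
theorem barrier_weak_equation {D : Set (EuclideanSpace ℝ (Fin N))} (hDm : MeasurableSet D) {p γ δ ε c R : ℝ}
    (hε : ε ≠ 0) (hc : 0 < c) (hR : 0 < R) (hD : ∀ x ∈ D, R < ‖x‖)
    (hs : ∀ τ, R ^ 2 ≤ τ → 0 < barrierSlope γ δ ε τ)
    {φ : EuclideanSpace ℝ (Fin N) → ℝ} (hφ : IsTestFunction D φ) :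
    ∫ x in D, (inner ℝ (-(‖gradient (barrier γ δ ε c) x‖ ^ (p - 2) • gradient (barrier γ δ ε c) x))
      (gradient φ x) + barrierRate N p γ δ ε (‖x‖ ^ 2) * barrier γ δ ε c x ^ (p - 1) * φ x) = 0 := by
  have hDτ : ∀ x ∈ D, R ^ 2 < ‖x‖ ^ 2 := fun x hx => by have := hD x hx; gcongr
  have hτ0 : ∀ τ, R ^ 2 < τ → 0 < τ := fun τ h => lt_trans (by positivity) h
  set S := barrierSlope γ δ ε with hS
  set P := barrierProfile γ δ ε with hP
  -- Since `|∇V| = S V / |x|`, the field `-|∇V|^(p-2) ∇V` is `β(|x|²) x`; its divergence `2 τ β' + N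
  -- β` is then the rate times `V^(p-1)`.
  set β : ℝ → ℝ := fun τ => (S τ * (c * P τ)) ^ (p - 1) * τ ^ (-(p / 2)) with hβ
  set β' : ℝ → ℝ := fun τ => β τ * ((p - 1) * (δ * ε / 2 * τ ^ (-(ε / 2)) / τ / S τ
    - S τ / (2 * τ)) - p / (2 * τ)) with hβ'
  have hdβ : ∀ τ, R ^ 2 < τ → HasDerivAt β (β' τ) τ := by
    intro τ hτ
    have h0 := hτ0 τ hτ
    have hS0 : 0 < S τ := hs τ hτ.le
    have hP0 : 0 < P τ := barrierProfile_pos γ δ ε h0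
    have hb : 0 < S τ * (c * P τ) := by positivity
    have h1 := (hasDerivAt_barrierSlope γ δ ε h0).mul
      ((hasDerivAt_barrierProfile γ δ hε h0).const_mul c)
    have h2 := h1.rpow_const (p := p - 1) (Or.inl hb.ne')
    have h3 := Real.hasDerivAt_rpow_const (x := τ) (p := -(p / 2)) (Or.inl h0.ne')
    refine (h2.mul h3).congr_deriv ?_
    simp only [Pi.mul_apply]
    rw [Real.rpow_sub_one h0.ne', Real.rpow_sub_one hb.ne']
    simp only [hβ', hβ]
    rw [← hS, ← hP]
    field_simp
    ring
  have hcβ : ContinuousOn β' (Set.Ioi (R ^ 2)) := by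
    intro τ hτ
    have h0 := hτ0 τ hτ
    have c1 : ContinuousAt β τ := (hdβ τ hτ).continuousAt
    have c2 : ContinuousAt S τ := (hasDerivAt_barrierSlope γ δ ε h0).continuousAt
    have c3 : ContinuousAt (fun τ : ℝ => τ ^ (-(ε / 2))) τ :=
      Real.continuousAt_rpow_const _ _ (Or.inl h0.ne')
    have hS0 : S τ ≠ 0 := (hs τ (le_of_lt hτ)).ne'
    have c4 : ContinuousAt (fun τ : ℝ => 2 * τ) τ := by fun_prop
    have c5 : (2 * τ) ≠ 0 := by positivity
    exact (c1.mul ((continuousAt_const.mul ((((continuousAt_const.mul c3).div continuousAt_id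
      h0.ne').div c2 hS0).sub (c2.div c4 c5))).sub
      (continuousAt_const.div c4 c5))).continuousWithinAt
  rw [← integral_inner_radial_gradient hDτ hdβ hcβ hφ]
  refine setIntegral_congr_fun hDm fun x hx => ?_
  have hx0 : 0 < ‖x‖ := hR.trans (hD x hx)
  have hxne : x ≠ 0 := norm_pos_iff.1 hx0
  have hS0 : 0 < S (‖x‖ ^ 2) := hs _ (hDτ x hx).le
  have hV0 : 0 < barrier γ δ ε c x := barrier_pos γ δ ε hc hxne
  have h0 : 0 < ‖x‖ ^ 2 := by positivity
  have eV : c * P (‖x‖ ^ 2) = barrier γ δ ε c x := rfl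
  have eX : -(‖gradient (barrier γ δ ε c) x‖ ^ (p - 2) • gradient (barrier γ δ ε c) x)
      = β (‖x‖ ^ 2) • x := by
    rw [norm_gradient_barrier γ δ hε hc hxne hS0.le, gradient_barrier γ δ c hε hxne, smul_smul,
      ← neg_smul]
    congr 1
    simp only [hβ, eV]
    rw [← hS]
    set V := barrier γ δ ε c x
    have e1 : S (‖x‖ ^ 2) / ‖x‖ * V = (S (‖x‖ ^ 2) * V) * ‖x‖⁻¹ := by ring
    have e2 : (‖x‖ ^ 2) ^ (-(p / 2)) = ‖x‖⁻¹ ^ (p - 2) / ‖x‖ ^ 2 := by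
      rw [← Real.rpow_natCast ‖x‖ 2, ← Real.rpow_mul hx0.le, ← Real.rpow_neg_one,
        ← Real.rpow_mul hx0.le, ← Real.rpow_sub hx0]
      congr 1
      push_cast
      ring
    have e3 : (S (‖x‖ ^ 2) * V) ^ (p - 1) = (S (‖x‖ ^ 2) * V) ^ (p - 2) * (S (‖x‖ ^ 2) * V) := by
      rw [← Real.rpow_add_one (by positivity)]; ring_nf
    rw [e1, Real.mul_rpow (by positivity) (by positivity), e2, e3]
    ring
  have eR : barrierRate N p γ δ ε (‖x‖ ^ 2) * barrier γ δ ε c x ^ (p - 1)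
      = 2 * ‖x‖ ^ 2 * β' (‖x‖ ^ 2) + N * β (‖x‖ ^ 2) := by
    rw [barrierRate]
    simp only [hβ', hβ, eV]
    rw [← hS]
    set V := barrier γ δ ε c x
    set τ := ‖x‖ ^ 2
    have e3 : S τ ^ (p - 1) = S τ ^ (p - 2) * S τ := by
      rw [← Real.rpow_add_one hS0.ne']; ring_nf
    have e4 : S τ ^ p = S τ ^ (p - 2) * S τ * S τ := by
      rw [← Real.rpow_add_one hS0.ne', ← Real.rpow_add_one hS0.ne']; ring_nf
    rw [Real.mul_rpow hS0.le hV0.le, e3, e4]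
    field_simp
    ring
  rw [eX, eR]

end BarrierFunction

/-! ### The truncation of the quotient `u / V`. -/

section Truncation

/-- A smooth function vanishing for `s ≤ 1` and for `s ≥ 2 j`, equal to `1` on `[2, j]`. -/
def truncation (j s : ℝ) : ℝ := Real.smoothTransition (s - 1) * Real.smoothTransition (2 - s / j)

theorem truncation_nonneg (j s : ℝ) : 0 ≤ truncation j s :=
  mul_nonneg (Real.smoothTransition.nonneg _) (Real.smoothTransition.nonneg _)

theorem truncation_le_one (j s : ℝ) : truncation j s ≤ 1 :=
  mul_le_one₀ (Real.smoothTransition.le_one _) (Real.smoothTransition.nonneg _)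
    (Real.smoothTransition.le_one _)

theorem truncation_of_le_one (j : ℝ) {s : ℝ} (hs : s ≤ 1) : truncation j s = 0 := by
  rw [truncation, Real.smoothTransition.zero_of_nonpos (by linarith), zero_mul]

theorem truncation_of_two_mul_le {j s : ℝ} (hj : 0 < j) (hs : 2 * j ≤ s) : truncation j s = 0 := by
  rw [truncation, Real.smoothTransition.zero_of_nonpos (x := 2 - s / j), mul_zero]
  rw [sub_nonpos, le_div_iff₀ hj]
  exact hs

theorem truncation_mono {j j' s : ℝ} (hj : 0 < j) (hjj' : j ≤ j') :
    truncation j s ≤ truncation j' s := by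
  rcases le_total s 1 with hs | hs
  · rw [truncation_of_le_one j hs, truncation_of_le_one j' hs]
  · refine mul_le_mul_of_nonneg_left ?_ (Real.smoothTransition.nonneg _)
    refine Real.smoothTransition.monotone ?_
    have : s / j' ≤ s / j := div_le_div_of_nonneg_left (by linarith) hj hjj'
    linarith

theorem truncation_pos {j s : ℝ} (hj : 0 < j) (hs : 1 < s) (hs' : s ≤ j) : 0 < truncation j s := by
  refine mul_pos (Real.smoothTransition.pos_of_pos (by linarith))
    (Real.smoothTransition.pos_of_pos ?_)
  have := (div_le_one hj).2 hs'
  linarith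

theorem contDiff_truncation (j : ℝ) : ContDiff ℝ ∞ (truncation j) := by
  unfold truncation
  exact (Real.smoothTransition.contDiff.comp (contDiff_id.sub contDiff_const)).mul
    (Real.smoothTransition.contDiff.comp (contDiff_const.sub (contDiff_id.div_const _)))

/-- A zero of a nonnegative function is a minimum. -/
theorem deriv_truncation_eq_zero {j s : ℝ} (hs : truncation j s = 0) :
    deriv (truncation j) s = 0 :=
  IsLocalMin.deriv_eq_zero (Eventually.of_forall fun t => by rw [hs]; exact truncation_nonneg j t)

theorem hasCompactSupport_truncation {j : ℝ} (hj : 0 < j) : HasCompactSupport (truncation j) := by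
  refine HasCompactSupport.intro (isCompact_Icc (a := 1) (b := 2 * j)) fun s hs => ?_
  rw [Set.mem_Icc, not_and_or, not_le, not_le] at hs
  rcases hs with hs | hs
  · exact truncation_of_le_one j hs.le
  · exact truncation_of_two_mul_le hj hs.le

theorem deriv_smoothTransition_of_one_lt {t : ℝ} (ht : 1 < t) :
    deriv Real.smoothTransition t = 0 := by
  have : Real.smoothTransition =ᶠ[𝓝 t] fun _ => 1 := by
    filter_upwards [lt_mem_nhds ht] with y hy
    exact Real.smoothTransition.one_of_one_le (le_of_lt hy)
  rw [this.deriv_eq, deriv_const]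

theorem deriv_smoothTransition_of_neg {t : ℝ} (ht : t < 0) :
    deriv Real.smoothTransition t = 0 := by
  have : Real.smoothTransition =ᶠ[𝓝 t] fun _ => 0 := by
    filter_upwards [gt_mem_nhds ht] with y hy
    exact Real.smoothTransition.zero_of_nonpos (le_of_lt hy)
  rw [this.deriv_eq, deriv_const]

theorem exists_deriv_smoothTransition_le :
    ∃ C : ℝ, 0 ≤ C ∧ ∀ t, |deriv Real.smoothTransition t| ≤ C := by
  have hdc : Continuous (deriv Real.smoothTransition) :=
    (Real.smoothTransition.contDiff (n := 1)).continuous_deriv (by simp)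
  obtain ⟨C, hC⟩ := exists_bound_of_hasCompactSupport hdc
    (HasCompactSupport.intro (isCompact_Icc (a := (0 : ℝ)) (b := 1)) fun t ht => by
      rw [Set.mem_Icc, not_and_or, not_le, not_le] at ht
      exact ht.elim deriv_smoothTransition_of_neg deriv_smoothTransition_of_one_lt)
  exact ⟨C, (abs_nonneg _).trans (hC 0), hC⟩

/-- Below `j` only the increasing factor varies. The decreasing factor depends on `s / j` alone, and
`s` times its derivative is scale invariant, hence bounded uniformly in `j`. That uniformity lets `j
→ ∞` later. -/
theorem exists_neg_le_mul_deriv_truncation : ∃ C : ℝ, 0 ≤ C ∧ ∀ j s : ℝ, 0 < j → 0 ≤ s →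
    (s < j → 0 ≤ s * deriv (truncation j) s) ∧ -C ≤ s * deriv (truncation j) s := by
  have hd : Differentiable ℝ Real.smoothTransition :=
    (Real.smoothTransition.contDiff (n := 1)).differentiable (by simp)
  have hd0 : ∀ t, 0 ≤ deriv Real.smoothTransition t := fun t =>
    Real.smoothTransition.monotone.deriv_nonneg
  obtain ⟨C, hC0, hC⟩ := exists_deriv_smoothTransition_le
  refine ⟨2 * C, by positivity, fun j s hj hs => ?_⟩
  have h1 : HasDerivAt (fun s => Real.smoothTransition (s - 1))
      (deriv Real.smoothTransition (s - 1)) s := by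
    refine ((hd (s - 1)).hasDerivAt.comp s ((hasDerivAt_id s).sub_const 1)).congr_deriv ?_
    ring
  have h2 : HasDerivAt (fun s => Real.smoothTransition (2 - s / j))
      (-(deriv Real.smoothTransition (2 - s / j) / j)) s := by
    refine ((hd (2 - s / j)).hasDerivAt.comp s
      (((hasDerivAt_id s).div_const j).const_sub 2)).congr_deriv ?_
    ring
  have h3 : deriv (truncation j) s = deriv Real.smoothTransition (s - 1)
      * Real.smoothTransition (2 - s / j) + Real.smoothTransition (s - 1)
      * -(deriv Real.smoothTransition (2 - s / j) / j) := (h1.mul h2).deriv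
  have h4 : 0 ≤ s * (deriv Real.smoothTransition (s - 1) * Real.smoothTransition (2 - s / j)) :=
    mul_nonneg hs (mul_nonneg (hd0 _) (Real.smoothTransition.nonneg _))
  have h5 : s * deriv (truncation j) s
      = s * (deriv Real.smoothTransition (s - 1) * Real.smoothTransition (2 - s / j))
      - Real.smoothTransition (s - 1) * (s / j * deriv Real.smoothTransition (2 - s / j)) := by
    rw [h3]; ring
  rw [h5]
  constructor
  · intro hsj
    rw [deriv_smoothTransition_of_one_lt (t := 2 - s / j) (by have := (div_lt_one hj).2 hsj; linarith)]
    simpa using h4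
  · have h6 : s / j * deriv Real.smoothTransition (2 - s / j) ≤ 2 * C := by
      have hsj : 0 ≤ s / j := div_nonneg hs hj.le
      have h0 := hd0 (2 - s / j)
      have hle := (le_abs_self _).trans (hC (2 - s / j))
      rcases le_or_gt 0 (2 - s / j) with ht | ht
      · have h2 : s / j ≤ 2 := by linarith
        gcongr
      · rw [deriv_smoothTransition_of_neg ht]
        simpa using hC0
    have h7 : 0 ≤ s / j * deriv Real.smoothTransition (2 - s / j) :=
      mul_nonneg (div_nonneg hs hj.le) (hd0 _)
    have h8 := mul_le_of_le_one_left h7 (Real.smoothTransition.le_one (s - 1))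
    linarith

/-- The truncation vanishes below `1`, away from which the power is smooth. -/
theorem contDiff_rpow_mul_truncation (p j : ℝ) : ContDiff ℝ ∞ (fun s => s ^ p * truncation j s) := by
  rw [contDiff_iff_contDiffAt]
  intro s
  rcases lt_or_ge s 1 with hs | hs
  · have : (fun s => s ^ p * truncation j s) =ᶠ[𝓝 s] fun _ => 0 := by
      filter_upwards [gt_mem_nhds hs] with t ht
      rw [truncation_of_le_one j (le_of_lt ht), mul_zero]
    exact contDiffAt_const.congr_of_eventuallyEq this
  · exact (contDiffAt_id.rpow_const_of_ne (by simp; linarith)).mul (contDiff_truncation j).contDiffAt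

theorem deriv_rpow_mul_truncation (p j : ℝ) {s : ℝ} (hs : 0 < s) :
    deriv (fun s => s ^ p * truncation j s) s
      = p * s ^ (p - 1) * truncation j s + s ^ p * deriv (truncation j) s :=
  ((Real.hasDerivAt_rpow_const (Or.inl hs.ne')).mul
    ((contDiff_truncation j).differentiable (by simp) s).hasDerivAt).deriv

theorem deriv_mul_truncation (j s : ℝ) :
    deriv (fun s => s * truncation j s) s = truncation j s + s * deriv (truncation j) s := by
  have h : HasDerivAt (fun s => s * truncation j s) _ s := (hasDerivAt_id s).mul
    ((contDiff_truncation j).differentiable (by simp) s).hasDerivAt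
  simpa using h.deriv

end Truncation

/-! ### The excess of the subsolution over the barrier and Picone's identity. -/

section Comparison

variable {N : ℕ}

/-- The density of the excess of the subsolution `u` over the supersolution `V`. -/
def excessDensity (p j : ℝ) (V W b u : EuclideanSpace ℝ (Fin N) → ℝ)
    (G : EuclideanSpace ℝ (Fin N) → EuclideanSpace ℝ (Fin N)) (x : EuclideanSpace ℝ (Fin N)) : ℝ :=
  truncation j (u x / V x) * (‖G x‖ ^ p + (p - 1) * ‖(u x / V x) • gradient V x‖ ^ p
    - p * (‖(u x / V x) • gradient V x‖ ^ (p - 2) * inner ℝ ((u x / V x) • gradient V x) (G x)))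
  + u x / V x * deriv (truncation j) (u x / V x) *
    inner ℝ (‖G x‖ ^ (p - 2) • G x
      - ‖(u x / V x) • gradient V x‖ ^ (p - 2) • (u x / V x) • gradient V x)
      (G x - (u x / V x) • gradient V x)
  + (W x - b x) * (u x ^ p * truncation j (u x / V x))

/-- The flux of the excess of the subsolution `u` over the supersolution `V`. -/
def excessFlux (p j : ℝ) (V u : EuclideanSpace ℝ (Fin N) → ℝ)
    (G : EuclideanSpace ℝ (Fin N) → EuclideanSpace ℝ (Fin N)) (x : EuclideanSpace ℝ (Fin N)) :
    EuclideanSpace ℝ (Fin N) :=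
  (u x * truncation j (u x / V x)) • (‖G x‖ ^ (p - 2) • G x)
    - (V x * ((u x / V x) ^ p * truncation j (u x / V x))) •
      (‖gradient V x‖ ^ (p - 2) • gradient V x)

theorem memLp_rpow_sub_two_smul {p q : ℝ} (hpq : p.HolderConjugate q) {ν : Measure
    (EuclideanSpace ℝ (Fin N))} {G : EuclideanSpace ℝ (Fin N) → EuclideanSpace ℝ (Fin N)}
    (hG : MemLp G (ENNReal.ofReal p) ν) :
    MemLp (fun x => ‖G x‖ ^ (p - 2) • G x) (ENNReal.ofReal q) ν := by
  have hp := hpq.lt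
  have h := hG.norm_rpow_div (ENNReal.ofReal (p - 1))
  rw [ENNReal.toReal_ofReal (by linarith), ← ENNReal.ofReal_div_of_pos (by linarith),
    ← hpq.conjugate_eq] at h
  refine h.of_le ?_ (Eventually.of_forall fun x => ?_)
  · exact (hG.1.norm.aemeasurable.pow_const _).aestronglyMeasurable.smul hG.1
  · rw [norm_smul, Real.norm_of_nonneg (by positivity), norm_rpow_sub_two_mul_norm hp]
    exact le_abs_self _

/-- Picone's identity with truncation. Both test functions are `c V g(s)` with `s = u/V`, for `g = s
κ(s)` and `g = s^p κ(s)`. As `V ∇s = G - a` with `a = s ∇V`, and the powers of `s` turn `|∇V|^(p-2)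
∇V` into `|a|^(p-2) a`, the terms with `κ` form the Picone expression of `a` and `G`, those with
`κ'` the monotonicity expression, and those with `∇c` the flux. -/
theorem excess_pointwise {p j : ℝ} (hp : 1 < p) {c V W b u : EuclideanSpace ℝ (Fin N) → ℝ}
    {G : EuclideanSpace ℝ (Fin N) → EuclideanSpace ℝ (Fin N)} {x : EuclideanSpace ℝ (Fin N)}
    (hV : 0 < V x) :
    (inner ℝ (‖G x‖ ^ (p - 2) • G x) (compositeA c V (fun s => s * truncation j s) x (u x)
        + compositeB c V (fun s => s * truncation j s) x (u x) • G x)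
      + -(b x * (|u x| ^ (p - 2) * u x)) * (c x * V x * (u x / V x * truncation j (u x / V x))))
    + (inner ℝ (-(‖gradient V x‖ ^ (p - 2) • gradient V x))
        (compositeA c V (fun s => s ^ p * truncation j s) x (u x)
        + compositeB c V (fun s => s ^ p * truncation j s) x (u x) • G x)
      + W x * V x ^ (p - 1) * (c x * V x * ((u x / V x) ^ p * truncation j (u x / V x))))
    = inner ℝ (excessFlux p j V u G x) (gradient c x) + excessDensity p j V W b u G x * c x := by
  obtain ⟨s, hs⟩ : ∃ s, u x / V x = s := ⟨_, rfl⟩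
  have hu : u x = s * V x := by rw [← hs]; field_simp
  -- For `s ≤ 0` every term vanishes with the truncation, so real powers of negative numbers never
  -- matter.
  rcases le_or_gt s 0 with hs0 | hs0
  · have h1 : truncation j s = 0 := truncation_of_le_one j (by linarith)
    have h2 : deriv (truncation j) s = 0 := deriv_truncation_eq_zero (truncation_of_le_one j (by linarith))
    have h3 : deriv (fun s => s ^ p * truncation j s) s = 0 := by
      have : (fun s => s ^ p * truncation j s) =ᶠ[𝓝 s] fun _ => 0 := by
        filter_upwards [gt_mem_nhds (by linarith : s < 1)] with t ht
        rw [truncation_of_le_one j (le_of_lt ht), mul_zero]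
      rw [this.deriv_eq, deriv_const]
    simp only [compositeA, compositeB, excessFlux, excessDensity, hs, deriv_mul_truncation, h1, h2,
      h3]
    simp
  · have e1 : s ^ (p - 1) = s ^ (p - 2) * s := by
      rw [← Real.rpow_add_one hs0.ne']; ring_nf
    have e2 : s ^ p = s ^ (p - 2) * s * s := by
      rw [← Real.rpow_add_one hs0.ne', ← Real.rpow_add_one hs0.ne']; ring_nf
    have f1 : V x ^ (p - 1) = V x ^ (p - 2) * V x := by
      rw [← Real.rpow_add_one hV.ne']; ring_nf
    have f2 : V x ^ p = V x ^ (p - 2) * V x * V x := by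
      rw [← Real.rpow_add_one hV.ne', ← Real.rpow_add_one hV.ne']; ring_nf
    simp only [compositeA, compositeB, excessFlux, excessDensity, hs, deriv_mul_truncation,
      deriv_rpow_mul_truncation p j hs0]
    rw [norm_smul, Real.norm_of_nonneg hs0.le, Real.mul_rpow hs0.le (norm_nonneg _),
      Real.mul_rpow hs0.le (norm_nonneg _), ← rpow_sub_two_mul_inner_self hp (G x),
      ← rpow_sub_two_mul_inner_self hp (gradient V x), hu, abs_of_pos (by positivity),
      Real.mul_rpow hs0.le hV.le, Real.mul_rpow hs0.le hV.le, e1, e2, f1, f2]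
    simp only [inner_add_right, inner_sub_left, inner_sub_right, inner_neg_left,
      real_inner_smul_left, real_inner_smul_right]
    rw [real_inner_comm (G x) (gradient V x)]
    ring

theorem excess_inequality {D : Set (EuclideanSpace ℝ (Fin N))} (hD : IsOpen D)
    {u : EuclideanSpace ℝ (Fin N) → ℝ} {G : EuclideanSpace ℝ (Fin N) → EuclideanSpace ℝ (Fin N)}
    (hu : HasWeakGradient D u G) {p : ℝ} (hp : 1 < p)
    (hG : MemLp G (ENNReal.ofReal p) (volume.restrict D))
    {V W b : EuclideanSpace ℝ (Fin N) → ℝ}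
    (hV : ∀ x ∈ D, ContDiffAt ℝ ∞ V x) (hV0 : ∀ x ∈ D, 0 < V x) (hW : ContinuousOn W D)
    (hVeq : ∀ φ, IsTestFunction D φ →
      ∫ x in D, (inner ℝ (-(‖gradient V x‖ ^ (p - 2) • gradient V x)) (gradient φ x)
        + W x * V x ^ (p - 1) * φ x) = 0)
    (hb : LocallyIntegrableOn (fun x => b x * (|u x| ^ (p - 2) * u x)) D)
    (hsub : ∀ φ, IsTestFunction D φ → (∀ x, 0 ≤ φ x) →
      ∫ x in D, (inner ℝ (‖G x‖ ^ (p - 2) • G x) (gradient φ x)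
        + -(b x * (|u x| ^ (p - 2) * u x)) * φ x) ≤ 0)
    {j : ℝ} (hj : 0 < j)
    {c : EuclideanSpace ℝ (Fin N) → ℝ} (hc : IsTestFunction D c) (hc0 : ∀ x, 0 ≤ c x) :
    ∫ x in D, (inner ℝ (excessFlux p j V u G x) (gradient c x)
      + excessDensity p j V W b u G x * c x) ≤ 0 := by
  have hpq := Real.HolderConjugate.conjExponent hp
  set q := p.conjExponent
  have hKD := hc.2.2
  have hKc : IsCompact (tsupport c) := hc.2.1
  have : IsFiniteMeasure (volume.restrict (tsupport c)) := ⟨by simpa using hKc.measure_lt_top⟩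
  have hgV : ContinuousOn (gradient V) (tsupport c) := (continuousOn_gradient hV).mono hKD
  have hVc : ContinuousOn V (tsupport c) :=
    fun x hx => (hV x (hKD hx)).continuousAt.continuousWithinAt
  have hgVL : MemLp (gradient V) (ENNReal.ofReal p) (volume.restrict (tsupport c)) := by
    obtain ⟨C, hC⟩ := hKc.exists_bound_of_continuousOn hgV
    exact MemLp.of_bound (hgV.aestronglyMeasurable hKc.measurableSet) C
      ((ae_restrict_iff' hKc.measurableSet).2 (Eventually.of_forall hC))
  have t1 := weak_inequality_composite hD hu hpq hG hc hc0 hV hV0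
    (g := fun s => s * truncation j s) (contDiff_id.mul (contDiff_truncation j))
    ((hasCompactSupport_truncation hj).mul_left)
    (fun s => by
      rcases le_or_gt s 0 with h | h
      · rw [truncation_of_le_one j (by linarith), mul_zero]
      · exact mul_nonneg h.le (truncation_nonneg j s))
    (memLp_rpow_sub_two_smul hpq (hG.mono_measure (Measure.restrict_mono hKD le_rfl)))
    (hb.integrableOn_compact_subset hKD hKc).neg hsub
  have t2 := weak_inequality_composite hD hu hpq hG hc hc0 hV hV0
    (g := fun s => s ^ p * truncation j s) (contDiff_rpow_mul_truncation p j)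
    ((hasCompactSupport_truncation hj).mul_left)
    (fun s => by
      rcases le_or_gt s 0 with h | h
      · rw [truncation_of_le_one j (by linarith), mul_zero]
      · exact mul_nonneg (Real.rpow_nonneg h.le _) (truncation_nonneg j s))
    (memLp_rpow_sub_two_smul hpq hgVL).neg
    (H := fun x => W x * V x ^ (p - 1))
    (((hW.mono hKD).mul (hVc.rpow_const fun x hx => Or.inl
      (hV0 x (hKD hx)).ne')).integrableOn_compact hKc)
    (fun φ hφ _ => (hVeq φ hφ).le)
  refine le_trans (le_of_eq ?_) (add_nonpos t1.2 t2.2)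
  rw [← integral_add t1.1 t2.1]
  refine setIntegral_congr_fun hD.measurableSet fun x hx => ?_
  exact (excess_pointwise hp (hV0 x hx)).symm

/-- The Picone term is dropped, and so is the monotonicity term wherever `s < j`; for `s ≥ j` it is
bounded below through `s κ' ≥ -C`. -/
theorem excessDensity_ge {p : ℝ} (hp : 1 < p) {C : ℝ} (hC0 : 0 ≤ C)
    (hC : ∀ j s : ℝ, 0 < j → 0 ≤ s →
      (s < j → 0 ≤ s * deriv (truncation j) s) ∧ -C ≤ s * deriv (truncation j) s)
    {j : ℝ} (hj : 0 < j) {V W b u : EuclideanSpace ℝ (Fin N) → ℝ}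
    {G : EuclideanSpace ℝ (Fin N) → EuclideanSpace ℝ (Fin N)} {x : EuclideanSpace ℝ (Fin N)} :
    (W x - b x) * (u x ^ p * truncation j (u x / V x))
      - (if j ≤ u x / V x then
        3 * C * (‖(u x / V x) • gradient V x‖ ^ p + ‖G x‖ ^ p) else 0)
      ≤ excessDensity p j V W b u G x := by
  rw [excessDensity]
  set s := u x / V x
  set a := s • gradient V x
  have h1 := mul_nonneg (truncation_nonneg j s) (picone_nonneg hp a (G x))
  have h2 := monotone_nonneg hp a (G x)
  have h3 := monotone_le hp a (G x)
  set Q := inner ℝ (‖G x‖ ^ (p - 2) • G x - ‖a‖ ^ (p - 2) • a) (G x - a)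
  have h4 : -(if j ≤ s then 3 * C * (‖a‖ ^ p + ‖G x‖ ^ p) else 0)
      ≤ s * deriv (truncation j) s * Q := by
    rcases lt_or_ge s 0 with hs | hs
    · rw [if_neg (by linarith), deriv_truncation_eq_zero (truncation_of_le_one j (by linarith))]
      simp
    · obtain ⟨c1, c2⟩ := hC j s hj hs
      split_ifs with h
      · nlinarith [mul_le_mul_of_nonneg_right c2 h2, mul_le_mul_of_nonneg_left h3 hC0]
      · rw [neg_zero]
        exact mul_nonneg (c1 (not_le.1 h)) h2
  linarith

end Comparison

/-! ### Test functions that do not vanish on the boundary. -/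

section BoundaryCutoff

variable {N : ℕ}

/-- The smooth step `h` with `h = 0` on `(-∞, σ / 2]` and `h = 1` on `[σ, ∞)`. -/
def smoothStep (σ s : ℝ) : ℝ := Real.smoothTransition (2 * s / σ - 1)

theorem contDiff_smoothStep (σ : ℝ) : ContDiff ℝ ∞ (smoothStep σ) :=
  Real.smoothTransition.contDiff.comp
    (((contDiff_const.mul contDiff_id).div_const _).sub contDiff_const)

theorem smoothStep_of_nonpos {σ s : ℝ} (hσ : 0 < σ) (hs : s ≤ 0) : smoothStep σ s = 0 := by
  refine Real.smoothTransition.zero_of_nonpos ?_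
  have : 2 * s / σ ≤ 0 := div_nonpos_of_nonpos_of_nonneg (by linarith) hσ.le
  linarith

theorem smoothStep_of_lt {σ s : ℝ} (hσ : 0 < σ) (hs : σ < s) : smoothStep σ s = 1 := by
  refine Real.smoothTransition.one_of_one_le ?_
  have : 2 ≤ 2 * s / σ := by rw [le_div_iff₀ hσ]; linarith
  linarith

theorem deriv_smoothStep_of_lt {σ s : ℝ} (hσ : 0 < σ) (hs : σ < s) :
    deriv (smoothStep σ) s = 0 := by
  have : smoothStep σ =ᶠ[𝓝 s] fun _ => 1 := by
    filter_upwards [lt_mem_nhds hs] with y hy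
    exact smoothStep_of_lt hσ hy
  rw [this.deriv_eq, deriv_const]

theorem exists_deriv_smoothStep_le (σ : ℝ) : ∃ C : ℝ, ∀ s, |deriv (smoothStep σ) s| ≤ C := by
  obtain ⟨C, -, hC⟩ := exists_deriv_smoothTransition_le
  refine ⟨C * |2 / σ|, fun s => ?_⟩
  have h : HasDerivAt (smoothStep σ) (deriv Real.smoothTransition (2 * s / σ - 1) * (2 / σ)) s := by
    have hd : Differentiable ℝ Real.smoothTransition :=
      (Real.smoothTransition.contDiff (n := 1)).differentiable (by simp)
    refine ((hd _).hasDerivAt.comp s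
      ((((hasDerivAt_id s).const_mul 2).div_const σ).sub_const 1)).congr_deriv ?_
    simp
  rw [h.deriv, abs_mul]
  exact mul_le_mul_of_nonneg_right (hC _) (abs_nonneg _)

/-- A weak inequality for test functions vanishing near the boundary extends to test functions
which do not vanish there, if its data vanish where a function with zero boundary values is
small. -/
theorem weak_inequality_up_to_boundary {D : Set (EuclideanSpace ℝ (Fin N))} (hD : IsOpen D)
    {p q : ℝ} (hpq : p.HolderConjugate q)
    {η : EuclideanSpace ℝ (Fin N) → ℝ} (hη : ContDiff ℝ ∞ η) (hηs : HasCompactSupport η)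
    (hη0 : ∀ x, 0 ≤ η x)
    {Z : EuclideanSpace ℝ (Fin N) → EuclideanSpace ℝ (Fin N)} {P : EuclideanSpace ℝ (Fin N) → ℝ}
    (hZ : MemLp Z (ENNReal.ofReal q) (volume.restrict (D ∩ tsupport η)))
    (hP : IntegrableOn P (D ∩ tsupport η))
    (hineq : ∀ c, IsTestFunction D c → (∀ x, 0 ≤ c x) →
      ∫ x in D, (inner ℝ (Z x) (gradient c x) + P x * c x) ≤ 0)
    {w Θ : EuclideanSpace ℝ (Fin N) → ℝ} (hw : MemW0 p D w) (hΘ : ContDiff ℝ ∞ Θ)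
    (hΘD : tsupport Θ ⊆ D) {σ : ℝ} (hσ : 0 < σ)
    (hvan : ∀ᵐ x ∂(volume.restrict (D ∩ tsupport η)), w x + Θ x ≤ σ → Z x = 0 ∧ P x = 0) :
    ∫ x in D, (inner ℝ (Z x) (gradient η x) + P x * η x) ≤ 0 := by
  obtain ⟨Gw, -, hwL, hGw, φ, hφt, hφw, hφG⟩ := hw
  set S := D ∩ tsupport η with hS
  have hSm : MeasurableSet S := hD.measurableSet.inter (isClosed_tsupport η).measurableSet
  have hSD : S ⊆ D := Set.inter_subset_left
  have hSν : volume.restrict S ≤ volume.restrict D := Measure.restrict_mono hSD le_rfl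
  have : IsFiniteMeasure (volume.restrict S) :=
    ⟨by simpa using (measure_mono Set.inter_subset_right).trans_lt hηs.measure_lt_top⟩
  have hp0 : ENNReal.ofReal p ≠ 0 := by simpa using hpq.pos
  have hφc : ∀ n, Continuous (φ n) := fun n => (hφt n).1.continuous
  have hmeas := tendstoInMeasure_of_tendsto_eLpNorm hp0
    (fun n => (hφc n).aestronglyMeasurable) hwL.1 hφw
  -- A subsequence of the approximating test functions converges almost everywhere.
  obtain ⟨ns, hns, hae⟩ := hmeas.exists_seq_tendsto_ae
  obtain ⟨C1, hC1⟩ := hη.continuous.bounded_above_of_compact_support hηs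
  have hgη : Continuous (gradient η) := continuous_gradient hη
  have hgΘ : Continuous (gradient Θ) := continuous_gradient hΘ
  have hgηs : HasCompactSupport (gradient η) := HasCompactSupport.intro hηs fun x hx =>
    gradient_of_notMem_tsupport hx
  obtain ⟨C2, hC2⟩ := hgη.bounded_above_of_compact_support hgηs
  obtain ⟨C3, hC3⟩ := exists_deriv_smoothStep_le σ
  obtain ⟨C4, hC4⟩ := hηs.exists_bound_of_continuousOn hgΘ.continuousOn
  have hC1' : 0 ≤ C1 := (norm_nonneg _).trans (hC1 0)
  have hC2' : 0 ≤ C2 := (norm_nonneg _).trans (hC2 0)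
  have hC3' : 0 ≤ C3 := (abs_nonneg _).trans (hC3 0)
  have hs0 : ∀ s, 0 ≤ smoothStep σ s := fun s => Real.smoothTransition.nonneg _
  have hs1 : ∀ s, smoothStep σ s ≤ 1 := fun s => Real.smoothTransition.le_one _
  have hsc : Continuous (smoothStep σ) := (contDiff_smoothStep σ).continuous
  have hsd : Continuous (deriv (smoothStep σ)) := (contDiff_smoothStep σ).continuous_deriv (by simp)
  have hv : ∀ n, ContDiff ℝ ∞ (fun x => φ n x + Θ x) := fun n => (hφt n).1.add hΘ
  have hgv : ∀ n x, gradient (fun x => φ n x + Θ x) x = gradient (φ n) x + gradient Θ x := by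
    intro n x
    refine ext_inner_right ℝ fun y => ?_
    rw [inner_add_left, inner_gradient_eq_fderiv, inner_gradient_eq_fderiv,
      inner_gradient_eq_fderiv, fderiv_fun_add ((hφt n).1.differentiable (by simp) x)
      (hΘ.differentiable (by simp) x)]
    rfl
  have hΘL : MemLp (gradient Θ) (ENNReal.ofReal p) (volume.restrict S) := by
    refine MemLp.of_bound hgΘ.aestronglyMeasurable C4 ?_
    exact (ae_restrict_iff' hSm).2 (Eventually.of_forall fun x hx => hC4 x hx.2)
  have key := tendsto_integral_composite (ν := volume.restrict S) hpq hZ hP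
    (v := fun m x => φ (ns m) x + Θ x) (u := fun x => w x + Θ x)
    (Dv := fun m => gradient (fun x => φ (ns m) x + Θ x)) (G := fun x => Gw x + gradient Θ x)
    ((hae.filter_mono (ae_mono hSν)).mono fun x hx => hx.add_const _)
    (fun m => (continuous_gradient (hv _)).aestronglyMeasurable) ?_
    ((hGw.mono_measure hSν).add hΘL)
    (F := fun x s => η x * smoothStep σ s) (A := fun x s => smoothStep σ s • gradient η x)
    (B := fun x s => η x * deriv (smoothStep σ) s) (C := C1 + C2 + C1 * C3)
    (Eventually.of_forall fun x => by fun_prop) (Eventually.of_forall fun x => by fun_prop)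
    (Eventually.of_forall fun x => by fun_prop) ?_ ?_ ?_ ?_ ?_ ?_
  · have hle : ∀ m, ∫ x in S, (inner ℝ (Z x) (smoothStep σ (φ (ns m) x + Θ x) • gradient η x
        + (η x * deriv (smoothStep σ) (φ (ns m) x + Θ x)) •
          gradient (fun x => φ (ns m) x + Θ x) x)
        + P x * (η x * smoothStep σ (φ (ns m) x + Θ x))) ≤ 0 := by
      intro m
      -- The step function vanishes off the supports of `φ` and `Θ`, both inside `D`, so this is a
      -- test function in `D` although `η` is not.
      set c : EuclideanSpace ℝ (Fin N) → ℝ := fun x => η x * smoothStep σ (φ (ns m) x + Θ x)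
      have hcs : ContDiff ℝ ∞ c := hη.mul ((contDiff_smoothStep σ).comp (hv _))
      have hts1 : tsupport c ⊆ tsupport η := closure_mono fun x hx => by
        contrapose! hx
        simp only [Function.mem_support, not_not] at hx ⊢
        simp [c, hx]
      have hts2 : tsupport c ⊆ tsupport (φ (ns m)) ∪ tsupport Θ := by
        refine closure_minimal (fun x hx => ?_)
          ((isClosed_tsupport _).union (isClosed_tsupport _))
        by_contra h
        rw [Set.mem_union, not_or] at h
        refine hx ?_
        simp only [c]
        rw [image_eq_zero_of_notMem_tsupport h.1, image_eq_zero_of_notMem_tsupport h.2,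
          smoothStep_of_nonpos hσ (by simp), mul_zero]
      have hct : IsTestFunction D c := ⟨hcs, hηs.of_isClosed_subset (isClosed_tsupport _) hts1,
        hts2.trans (Set.union_subset (hφt _).2.2 hΘD)⟩
      have h := hineq c hct fun x => mul_nonneg (hη0 x) (hs0 _)
      rw [setIntegral_eq_of_subset_of_forall_sdiff_eq_zero hD.measurableSet hSD] at h
      · refine le_trans (le_of_eq (setIntegral_congr_fun hSm fun x hx => ?_)) h
        have hgc : gradient c x = smoothStep σ (φ (ns m) x + Θ x) • gradient η x
            + (η x * deriv (smoothStep σ) (φ (ns m) x + Θ x)) •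
              gradient (fun x => φ (ns m) x + Θ x) x := by
          have d1 := (hη.differentiable (by simp) x).hasFDerivAt
          have d2 := ((contDiff_smoothStep σ).differentiable (by simp)
            (φ (ns m) x + Θ x)).hasDerivAt
          have d3 := d1.mul (d2.comp_hasFDerivAt (f := fun x => φ (ns m) x + Θ x) x
            ((hv (ns m)).differentiable (by simp) x).hasFDerivAt)
          refine ext_inner_right ℝ fun y => ?_
          rw [inner_gradient_eq_fderiv, show fderiv ℝ c x = _ from d3.fderiv]
          simp only [inner_add_left, real_inner_smul_left, inner_gradient_eq_fderiv]
          simp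
          ring
        rw [hgc]
      · intro x hx
        have hx' : x ∉ tsupport c := fun h' => hx.2 ⟨hx.1, hts1 h'⟩
        rw [gradient_of_notMem_tsupport hx', image_eq_zero_of_notMem_tsupport hx']
        simp
    have hlim := le_of_tendsto' key.2 hle
    rw [setIntegral_eq_of_subset_of_forall_sdiff_eq_zero hD.measurableSet hSD]
    · refine le_trans (le_of_eq (integral_congr_ae ?_)) hlim
      filter_upwards [hvan] with x hx
      -- Either the data vanish at `x`, or the limit cutoff is locally constant in its argument and
      -- equal to `1`, leaving exactly `η`.
      rcases le_or_gt (w x + Θ x) σ with h | h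
      · obtain ⟨h1, h2⟩ := hx h
        simp [h1, h2]
      · rw [smoothStep_of_lt hσ h, deriv_smoothStep_of_lt hσ h]
        simp
    · intro x hx
      have hx' : x ∉ tsupport η := fun h' => hx.2 ⟨hx.1, h'⟩
      rw [gradient_of_notMem_tsupport hx', image_eq_zero_of_notMem_tsupport hx']
      simp
  · refine tendsto_of_tendsto_of_tendsto_of_le_of_le tendsto_const_nhds
      (hφG.comp hns.tendsto_atTop) (fun _ => zero_le) fun m => ?_
    refine (le_of_eq ?_).trans (eLpNorm_mono_measure _ hSν)
    refine eLpNorm_congr_ae (Eventually.of_forall fun x => ?_)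
    simp only [hgv]
    abel
  · refine Eventually.of_forall fun x s => ?_
    rw [abs_mul, abs_of_nonneg (hs0 s)]
    have h1 : |η x| * smoothStep σ s ≤ C1 :=
      (mul_le_of_le_one_right (abs_nonneg _) (hs1 s)).trans (hC1 x)
    have := mul_nonneg hC1' hC3'
    linarith
  · refine Eventually.of_forall fun x s => ?_
    rw [norm_smul, Real.norm_of_nonneg (hs0 s)]
    have h1 := (mul_le_of_le_one_left (norm_nonneg (gradient η x)) (hs1 s)).trans (hC2 x)
    have := mul_nonneg hC1' hC3'
    linarith
  · refine Eventually.of_forall fun x s => ?_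
    rw [abs_mul]
    have h1 := mul_le_mul (hC1 x) (hC3 s) (abs_nonneg _) hC1'
    rw [Real.norm_eq_abs] at h1
    linarith
  · exact fun m => (hη.continuous.mul (hsc.comp (hv _).continuous)).aestronglyMeasurable
  · exact fun m => ((hsc.comp (hv _).continuous).smul hgη).aestronglyMeasurable
  · exact fun m => (hη.continuous.mul (hsd.comp (hv _).continuous)).aestronglyMeasurable

end BoundaryCutoff

/-! ### Exterior pairs and integrability of the excess. -/

section ExteriorComparison

variable {N : ℕ}

/-- A weak subsolution `u` and a smooth positive weak solution `V` of
`-Δ_p v = W v ^ (p - 1)` outside a ball, where the potential `b` of `u` is smaller than `W`. -/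
structure IsExteriorPair (p γ R : ℝ) (V W b u : EuclideanSpace ℝ (Fin N) → ℝ)
    (G : EuclideanSpace ℝ (Fin N) → EuclideanSpace ℝ (Fin N)) : Prop where
  one_lt : 1 < p
  lt_dim : p < N
  one_lt_radius : 1 < R
  slope_nonneg : 0 ≤ γ
  hasD1pGradient : HasD1pGradient p (closedBall (0 : EuclideanSpace ℝ (Fin N)) R)ᶜ u G
  smooth : ∀ x, R ≤ ‖x‖ → ContDiffAt ℝ ∞ V x
  pos : ∀ x, R ≤ ‖x‖ → 0 < V x
  norm_gradient_le : ∀ x, R ≤ ‖x‖ → ‖gradient V x‖ ≤ γ / ‖x‖ * V x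
  continuousOn : ContinuousOn W {x | R ≤ ‖x‖}
  equation : ∀ φ, IsTestFunction (closedBall (0 : EuclideanSpace ℝ (Fin N)) R)ᶜ φ →
    ∫ x in (closedBall (0 : EuclideanSpace ℝ (Fin N)) R)ᶜ,
      (inner ℝ (-(‖gradient V x‖ ^ (p - 2) • gradient V x)) (gradient φ x)
        + W x * V x ^ (p - 1) * φ x) = 0
  locallyIntegrable :
    LocallyIntegrableOn (fun x => b x * (|u x| ^ (p - 2) * u x))
      (closedBall (0 : EuclideanSpace ℝ (Fin N)) R)ᶜ
  integrableOn : ∀ K, IsCompact K → IntegrableOn b ((closedBall 0 R)ᶜ ∩ K)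
  subsolution : ∀ φ, IsTestFunction (closedBall (0 : EuclideanSpace ℝ (Fin N)) R)ᶜ φ →
    (∀ x, 0 ≤ φ x) → ∫ x in (closedBall (0 : EuclideanSpace ℝ (Fin N)) R)ᶜ,
      (inner ℝ (‖G x‖ ^ (p - 2) • G x) (gradient φ x)
        + -(b x * (|u x| ^ (p - 2) * u x)) * φ x) ≤ 0
  lt : ∀ᵐ x ∂(volume.restrict (closedBall (0 : EuclideanSpace ℝ (Fin N)) R)ᶜ), b x < W x

namespace IsExteriorPair

variable {p γ R : ℝ} {V W b u : EuclideanSpace ℝ (Fin N) → ℝ}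
  {G : EuclideanSpace ℝ (Fin N) → EuclideanSpace ℝ (Fin N)}

/-- `V` and `W` are controlled on the closed exterior, so the bounds persist up to the sphere, where
the later test functions do not vanish. -/
theorem exists_bound (h : IsExteriorPair p γ R V W b u G) {K : Set (EuclideanSpace ℝ (Fin N))}
    (hK : IsCompact K) : ∃ M, 0 ≤ M ∧ ∀ x ∈ (closedBall 0 R)ᶜ ∩ K,
      V x ≤ M ∧ ‖gradient V x‖ ≤ M ∧ |W x| ≤ M := by
  have hc : IsCompact ({x : EuclideanSpace ℝ (Fin N) | R ≤ ‖x‖} ∩ K) :=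
    hK.inter_left (isClosed_le continuous_const continuous_norm)
  have h1 : ContinuousOn V ({x : EuclideanSpace ℝ (Fin N) | R ≤ ‖x‖} ∩ K) :=
    fun x hx => (h.smooth x hx.1).continuousAt.continuousWithinAt
  have h2 : ContinuousOn (gradient V) ({x : EuclideanSpace ℝ (Fin N) | R ≤ ‖x‖} ∩ K) :=
    (continuousOn_gradient (fun x hx => h.smooth x hx)).mono Set.inter_subset_left
  obtain ⟨C1, hC1⟩ := hc.exists_bound_of_continuousOn h1
  obtain ⟨C2, hC2⟩ := hc.exists_bound_of_continuousOn h2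
  obtain ⟨C3, hC3⟩ := hc.exists_bound_of_continuousOn (h.continuousOn.mono Set.inter_subset_left)
  have a1 := abs_nonneg C1
  have a2 := abs_nonneg C2
  have a3 := abs_nonneg C3
  refine ⟨|C1| + |C2| + |C3|, by positivity, fun x hx => ?_⟩
  have hx' : x ∈ {x : EuclideanSpace ℝ (Fin N) | R ≤ ‖x‖} ∩ K :=
    ⟨by simpa using (by simpa using hx.1 : R < ‖x‖).le, hx.2⟩
  have e1 := (le_abs_self _).trans ((hC1 x hx').trans (le_abs_self C1))
  have e2 := (hC2 x hx').trans (le_abs_self C2)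
  have e3 := (hC3 x hx').trans (le_abs_self C3)
  rw [Real.norm_eq_abs] at e3
  exact ⟨by linarith, by linarith, by linarith⟩

theorem aestronglyMeasurable_quotient (h : IsExteriorPair p γ R V W b u G) :
    AEStronglyMeasurable (fun x => u x / V x) (volume.restrict (closedBall 0 R)ᶜ) := by
  have hV : AEStronglyMeasurable V (volume.restrict (closedBall 0 R)ᶜ) := by
    refine ContinuousOn.aestronglyMeasurable (fun x hx => ?_) isClosed_closedBall.measurableSet.compl
    exact (h.smooth x (by simpa using (by simpa using hx : R < ‖x‖).le)).continuousAt.continuousWithinAt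
  exact (h.hasD1pGradient.1.1.aemeasurable.div hV.aemeasurable).aestronglyMeasurable

theorem of_truncation_ne_zero {j s : ℝ} (hj : 0 < j) (hs : truncation j s ≠ 0) :
    1 < s ∧ s < 2 * j := by
  constructor
  · by_contra! hle
    exact hs (truncation_of_le_one j hle)
  · by_contra! hle
    exact hs (truncation_of_two_mul_le hj hle)

/-- Where the truncation does not vanish, `V < u < 2 j V`, so `u` is bounded there and the flux is
at most a multiple of `|G|^(p-1)` plus a constant. -/
theorem memLp_excessFlux (h : IsExteriorPair p γ R V W b u G) {q : ℝ} (hpq : p.HolderConjugate q)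
    {j : ℝ} (hj : 0 < j) {K : Set (EuclideanSpace ℝ (Fin N))} (hK : IsCompact K) :
    MemLp (excessFlux p j V u G) (ENNReal.ofReal q) (volume.restrict ((closedBall 0 R)ᶜ ∩ K)) := by
  obtain ⟨M, hM0, hM⟩ := h.exists_bound hK
  set D : Set (EuclideanSpace ℝ (Fin N)) := (closedBall 0 R)ᶜ with hD
  have hDm : MeasurableSet D := isClosed_closedBall.measurableSet.compl
  have hSm : MeasurableSet (D ∩ K) := hDm.inter hK.measurableSet
  have hle : volume.restrict (D ∩ K) ≤ volume.restrict D :=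
    Measure.restrict_mono Set.inter_subset_left le_rfl
  have : IsFiniteMeasure (volume.restrict (D ∩ K)) :=
    ⟨by simpa using (measure_mono Set.inter_subset_right).trans_lt hK.measure_lt_top⟩
  have hRx : ∀ x ∈ D, R ≤ ‖x‖ := fun x hx => (by simpa [hD] using hx : R < ‖x‖).le
  have hY := (memLp_rpow_sub_two_smul hpq h.hasD1pGradient.2.2).mono_measure hle
  have hsm := h.aestronglyMeasurable_quotient.mono_measure hle
  have hκm := (contDiff_truncation j).continuous.comp_aestronglyMeasurable hsm
  have hum := h.hasD1pGradient.1.1.mono_measure hle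
  have hVm : AEStronglyMeasurable V (volume.restrict (D ∩ K)) :=
    ContinuousOn.aestronglyMeasurable
      (fun x hx => (h.smooth x (hRx x hx.1)).continuousAt.continuousWithinAt) hSm
  have hgm : AEStronglyMeasurable (gradient V) (volume.restrict (D ∩ K)) :=
    ((continuousOn_gradient (fun x hx => h.smooth x hx)).mono
      fun x hx => hRx x hx.1).aestronglyMeasurable hSm
  have hp := hpq.lt
  have hbound : MemLp (fun x => 2 * j * M * ‖‖G x‖ ^ (p - 2) • G x‖
      + M * (2 * j) ^ p * M ^ (p - 1)) (ENNReal.ofReal q) (volume.restrict (D ∩ K)) :=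
    (hY.norm.const_mul _).add (memLp_const _)
  refine hbound.of_le ?_ ((ae_restrict_iff' hSm).2 (Eventually.of_forall fun x hx => ?_))
  · exact ((hum.mul hκm).smul hY.1).sub
      ((hVm.mul ((hsm.aemeasurable.pow_const p).aestronglyMeasurable.mul hκm)).smul
        ((hgm.norm.aemeasurable.pow_const (p - 2)).aestronglyMeasurable.smul hgm))
  · refine le_trans ?_ (le_abs_self _)
    obtain ⟨m1, m2, -⟩ := hM x hx
    have hV := h.pos x (hRx x hx.1)
    rw [excessFlux]
    by_cases h0 : truncation j (u x / V x) = 0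
    · rw [h0]
      simp
      positivity
    · obtain ⟨s1, s2⟩ := of_truncation_ne_zero hj h0
      have s0 : 0 ≤ u x / V x := by linarith
      have hu0 : 0 ≤ u x := by
        by_contra! hneg
        have := div_neg_of_neg_of_pos hneg hV
        linarith
      have hu : u x ≤ 2 * j * M := by
        have := (div_lt_iff₀ hV).1 s2
        have : 2 * j * V x ≤ 2 * j * M := by gcongr
        linarith
      have k0 := truncation_nonneg j (u x / V x)
      have k1 := truncation_le_one j (u x / V x)
      refine (norm_sub_le _ _).trans (add_le_add ?_ ?_)
      · rw [norm_smul, Real.norm_of_nonneg (by positivity)]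
        exact mul_le_mul_of_nonneg_right ((mul_le_of_le_one_right hu0 k1).trans hu)
          (norm_nonneg _)
      · rw [norm_smul, Real.norm_of_nonneg (by positivity), norm_smul,
          Real.norm_of_nonneg (by positivity), norm_rpow_sub_two_mul_norm hp]
        have e1 : (u x / V x) ^ p * truncation j (u x / V x) ≤ (2 * j) ^ p :=
          (mul_le_of_le_one_right (by positivity) k1).trans (by gcongr)
        have e2 : ‖gradient V x‖ ^ (p - 1) ≤ M ^ (p - 1) :=
          Real.rpow_le_rpow (norm_nonneg _) m2 (by linarith)
        gcongr

/-- The truncation again makes `u` bounded; the density is then dominated by constants, `|G|^p` and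
`|b|`. -/
theorem integrableOn_excessDensity (h : IsExteriorPair p γ R V W b u G)
    {j : ℝ} (hj : 0 < j) {K : Set (EuclideanSpace ℝ (Fin N))} (hK : IsCompact K) :
    IntegrableOn (excessDensity p j V W b u G) ((closedBall 0 R)ᶜ ∩ K) := by
  obtain ⟨M, hM0, hM⟩ := h.exists_bound hK
  set D : Set (EuclideanSpace ℝ (Fin N)) := (closedBall 0 R)ᶜ with hD
  have hDm : MeasurableSet D := isClosed_closedBall.measurableSet.compl
  have hSm : MeasurableSet (D ∩ K) := hDm.inter hK.measurableSet
  have hle : volume.restrict (D ∩ K) ≤ volume.restrict D :=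
    Measure.restrict_mono Set.inter_subset_left le_rfl
  have : IsFiniteMeasure (volume.restrict (D ∩ K)) :=
    ⟨by simpa using (measure_mono Set.inter_subset_right).trans_lt hK.measure_lt_top⟩
  have hRx : ∀ x ∈ D, R ≤ ‖x‖ := fun x hx => (by simpa [hD] using hx : R < ‖x‖).le
  have hp := h.one_lt
  have hG := h.hasD1pGradient.2.2.mono_measure hle
  have hGp : Integrable (fun x => ‖G x‖ ^ p) (volume.restrict (D ∩ K)) := by
    have := hG.integrable_norm_rpow'
    rwa [ENNReal.toReal_ofReal (by linarith)] at this
  have hsm := h.aestronglyMeasurable_quotient.mono_measure hle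
  have hκm := (contDiff_truncation j).continuous.comp_aestronglyMeasurable hsm
  have hdc : Continuous (deriv (truncation j)) := (contDiff_truncation j).continuous_deriv (by simp)
  have hκ'm := hdc.comp_aestronglyMeasurable hsm
  have hum := h.hasD1pGradient.1.1.mono_measure hle
  have hgm : AEStronglyMeasurable (gradient V) (volume.restrict (D ∩ K)) :=
    ((continuousOn_gradient (fun x hx => h.smooth x hx)).mono
      fun x hx => hRx x hx.1).aestronglyMeasurable hSm
  have hWm : AEStronglyMeasurable W (volume.restrict (D ∩ K)) :=
    (h.continuousOn.mono fun x hx => hRx x hx.1).aestronglyMeasurable hSm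
  have hbi := h.integrableOn K hK
  have ham : AEStronglyMeasurable (fun x => (u x / V x) • gradient V x)
    (volume.restrict (D ∩ K)) := hsm.smul hgm
  have hpow : ∀ {Y : EuclideanSpace ℝ (Fin N) → EuclideanSpace ℝ (Fin N)} (r : ℝ),
      AEStronglyMeasurable Y (volume.restrict (D ∩ K)) →
      AEStronglyMeasurable (fun x => ‖Y x‖ ^ r) (volume.restrict (D ∩ K)) := fun r hY =>
    (hY.norm.aemeasurable.pow_const r).aestronglyMeasurable
  obtain ⟨C, hC⟩ := exists_bound_of_hasCompactSupport (g := fun s => s * deriv (truncation j) s)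
    (continuous_id.mul hdc) ((hasCompactSupport_truncation hj).deriv.mul_left)
  have hC0 : 0 ≤ C := (abs_nonneg _).trans (hC 0)
  set T : ℝ := (2 * j * M) ^ p with hT
  have hT0 : 0 ≤ T := by positivity
  have hbound : Integrable (fun x => (2 * p + 3 * C) * (T + ‖G x‖ ^ p) + (M + |b x|) * T)
      (volume.restrict (D ∩ K)) :=
    (((integrable_const _).add hGp).const_mul _).add
      (((integrable_const _).add hbi.abs).mul_const _)
  refine hbound.mono' ?_ ((ae_restrict_iff' hSm).2 (Eventually.of_forall fun x hx => ?_))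
  · exact ((hκm.mul (((hpow p hG.1).add ((hpow p ham).const_mul _)).sub
      (((hpow (p - 2) ham).mul (ham.inner hG.1)).const_mul _))).add
      ((hsm.mul hκ'm).mul ((((hpow (p - 2) hG.1).smul hG.1).sub
        ((hpow (p - 2) ham).smul ham)).inner (hG.1.sub ham)))).add
      ((hWm.sub hbi.1).mul ((hum.aemeasurable.pow_const p).aestronglyMeasurable.mul hκm))
  · obtain ⟨m1, m2, m3⟩ := hM x hx
    have hV := h.pos x (hRx x hx.1)
    rw [excessDensity]
    by_cases h0 : truncation j (u x / V x) = 0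
    · rw [deriv_truncation_eq_zero h0, h0]
      simp
      positivity
    · obtain ⟨s1, s2⟩ := of_truncation_ne_zero hj h0
      have s0 : 0 ≤ u x / V x := by linarith
      have hu0 : 0 ≤ u x := by
        by_contra! hneg
        have := div_neg_of_neg_of_pos hneg hV
        linarith
      have hu : u x ≤ 2 * j * M := by
        have := (div_lt_iff₀ hV).1 s2
        have : 2 * j * V x ≤ 2 * j * M := by gcongr
        linarith
      have k0 := truncation_nonneg j (u x / V x)
      have k1 := truncation_le_one j (u x / V x)
      set a := (u x / V x) • gradient V x with ha
      have hap : ‖a‖ ^ p ≤ T := by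
        refine Real.rpow_le_rpow (norm_nonneg _) ?_ (by linarith)
        rw [ha, norm_smul, Real.norm_of_nonneg s0]
        gcongr
      have q1 := picone_nonneg hp a (G x)
      have q2 := picone_le hp a (G x)
      have q3 := monotone_nonneg hp a (G x)
      have q4 := monotone_le hp a (G x)
      have hup : u x ^ p ≤ T := Real.rpow_le_rpow hu0 hu (by linarith)
      have hGp0 : 0 ≤ ‖G x‖ ^ p := by positivity
      have hTG : ‖a‖ ^ p + ‖G x‖ ^ p ≤ T + ‖G x‖ ^ p := by linarith
      have e1 : |truncation j (u x / V x) * (‖G x‖ ^ p + (p - 1) * ‖a‖ ^ p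
          - p * (‖a‖ ^ (p - 2) * inner ℝ a (G x)))| ≤ 2 * p * (T + ‖G x‖ ^ p) := by
        rw [abs_of_nonneg (mul_nonneg k0 q1)]
        refine (mul_le_of_le_one_left q1 k1).trans (q2.trans ?_)
        gcongr
      have e2 : |u x / V x * deriv (truncation j) (u x / V x) *
          inner ℝ (‖G x‖ ^ (p - 2) • G x - ‖a‖ ^ (p - 2) • a) (G x - a)|
          ≤ C * (3 * (T + ‖G x‖ ^ p)) := by
        rw [abs_mul, abs_of_nonneg q3]
        refine mul_le_mul (hC _) (q4.trans ?_) q3 hC0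
        gcongr
      have e3 : |(W x - b x) * (u x ^ p * truncation j (u x / V x))| ≤ (M + |b x|) * T := by
        rw [abs_mul, abs_of_nonneg (a := u x ^ p * truncation j (u x / V x)) (by positivity)]
        refine mul_le_mul ((abs_sub _ _).trans (by linarith)) ?_ (by positivity) (by positivity)
        exact (mul_le_of_le_one_right (by positivity) k1).trans hup
      refine (norm_add₃_le).trans ?_
      rw [Real.norm_eq_abs, Real.norm_eq_abs, Real.norm_eq_abs]
      linarith

end IsExteriorPair

end ExteriorComparison

/-! ### Cutoffs at infinity. -/

section RadialCutoff

variable {N : ℕ}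

/-- A smooth cutoff equal to `1` on the ball of radius `ρ` and supported in the ball of radius
`2 ρ`. -/
def radialCutoff (ρ : ℝ) (x : EuclideanSpace ℝ (Fin N)) : ℝ :=
  Real.smoothTransition (2 - ‖x‖ ^ 2 / ρ ^ 2)

theorem contDiff_radialCutoff (ρ : ℝ) :
    ContDiff ℝ ∞ (radialCutoff ρ : EuclideanSpace ℝ (Fin N) → ℝ) :=
  Real.smoothTransition.contDiff.comp (contDiff_const.sub ((contDiff_norm_sq ℝ).div_const _))

theorem radialCutoff_nonneg (ρ : ℝ) (x : EuclideanSpace ℝ (Fin N)) : 0 ≤ radialCutoff ρ x :=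
  Real.smoothTransition.nonneg _

theorem radialCutoff_le_one (ρ : ℝ) (x : EuclideanSpace ℝ (Fin N)) : radialCutoff ρ x ≤ 1 :=
  Real.smoothTransition.le_one _

theorem radialCutoff_of_le {ρ : ℝ} (hρ : 0 < ρ) {x : EuclideanSpace ℝ (Fin N)} (hx : ‖x‖ ≤ ρ) :
    radialCutoff ρ x = 1 := by
  refine Real.smoothTransition.one_of_one_le ?_
  have : ‖x‖ ^ 2 / ρ ^ 2 ≤ 1 := by
    rw [div_le_one (by positivity)]
    gcongr
  linarith

theorem tsupport_radialCutoff_subset {ρ : ℝ} (hρ : 0 < ρ) :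
    tsupport (radialCutoff ρ) ⊆ closedBall (0 : EuclideanSpace ℝ (Fin N)) (2 * ρ) := by
  refine closure_minimal (fun x hx => ?_) isClosed_closedBall
  rw [mem_closedBall, dist_zero_right]
  by_contra! h
  refine hx (Real.smoothTransition.zero_of_nonpos ?_)
  have : 2 ≤ ‖x‖ ^ 2 / ρ ^ 2 := by
    rw [le_div_iff₀ (by positivity)]
    nlinarith
  linarith

theorem hasCompactSupport_radialCutoff {ρ : ℝ} (hρ : 0 < ρ) :
    HasCompactSupport (radialCutoff ρ : EuclideanSpace ℝ (Fin N) → ℝ) :=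
  (isCompact_closedBall _ _).of_isClosed_subset (isClosed_tsupport _)
    (tsupport_radialCutoff_subset hρ)

theorem gradient_radialCutoff (ρ : ℝ) (x : EuclideanSpace ℝ (Fin N)) :
    gradient (radialCutoff ρ) x
      = (-(2 * deriv Real.smoothTransition (2 - ‖x‖ ^ 2 / ρ ^ 2) / ρ ^ 2)) • x := by
  have hd : Differentiable ℝ Real.smoothTransition :=
    (Real.smoothTransition.contDiff (n := 1)).differentiable (by simp)
  have h1 : HasFDerivAt (fun x : EuclideanSpace ℝ (Fin N) => ‖x‖ ^ 2) _ x :=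
    (hasStrictFDerivAt_norm_sq x).hasFDerivAt
  have h2 := ((hd _).hasDerivAt.comp (‖x‖ ^ 2)
    (((hasDerivAt_id (‖x‖ ^ 2)).div_const (ρ ^ 2)).const_sub 2)).comp_hasFDerivAt
      (f := fun x : EuclideanSpace ℝ (Fin N) => ‖x‖ ^ 2) x h1
  refine ext_inner_right ℝ fun y => ?_
  rw [inner_gradient_eq_fderiv, show fderiv ℝ (radialCutoff ρ) x = _ from h2.fderiv,
    real_inner_smul_left]
  simp
  ring

theorem exists_norm_gradient_radialCutoff_le : ∃ C : ℝ, 0 ≤ C ∧ ∀ ρ : ℝ, 0 < ρ →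
    ∀ x : EuclideanSpace ℝ (Fin N), (‖x‖ < ρ → gradient (radialCutoff ρ) x = 0) ∧
      ‖gradient (radialCutoff ρ) x‖ ≤ C / ρ := by
  obtain ⟨C, hC0, hC⟩ := exists_deriv_smoothTransition_le
  refine ⟨4 * C, by positivity, fun ρ hρ x => ⟨fun hx => ?_, ?_⟩⟩
  · have : ‖x‖ ^ 2 / ρ ^ 2 < 1 := by
      rw [div_lt_one (by positivity)]
      gcongr
    rw [gradient_radialCutoff, deriv_smoothTransition_of_one_lt (by linarith)]
    simp
  · by_cases hx : x ∈ tsupport (radialCutoff ρ)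
    · have hx' := tsupport_radialCutoff_subset hρ hx
      rw [mem_closedBall, dist_zero_right] at hx'
      rw [gradient_radialCutoff, norm_smul, norm_neg, norm_div, norm_mul, Real.norm_eq_abs,
        Real.norm_eq_abs, Real.norm_eq_abs, abs_of_pos (by positivity : (0 : ℝ) < ρ ^ 2),
        abs_of_pos (by norm_num : (0 : ℝ) < 2)]
      calc _ ≤ 2 * C / ρ ^ 2 * (2 * ρ) := by
            gcongr
            exact hC _
        _ = 4 * C / ρ := by field_simp; ring
    · rw [gradient_of_notMem_tsupport hx, norm_zero]
      positivity

end RadialCutoff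

/-! ### The excess inequality up to the sphere and bounds on its terms. -/

section ExteriorComparison

variable {N : ℕ}

namespace IsExteriorPair

variable {p γ R : ℝ} {V W b u : EuclideanSpace ℝ (Fin N) → ℝ}
  {G : EuclideanSpace ℝ (Fin N) → EuclideanSpace ℝ (Fin N)}

/-- Near the sphere `V` exceeds `t` by `2σ`. Where `u⁺ ≤ t + σ` there, `u ≤ V`, so flux and density
vanish; this is what removes the requirement that `η` vanish on the sphere. -/
theorem integral_excess_nonpos (h : IsExteriorPair p γ R V W b u G) {j : ℝ} (hj : 0 < j)
    {t R' σ : ℝ} (ht : LeOnBoundary p (closedBall 0 R)ᶜ (fun y => max (u y) 0) t)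
    (hR' : R < R') (hσ : 0 < σ) (hVt : ∀ x, R < ‖x‖ → ‖x‖ ≤ R' → t + 2 * σ ≤ V x)
    {η : EuclideanSpace ℝ (Fin N) → ℝ} (hη : ContDiff ℝ ∞ η) (hηs : HasCompactSupport η)
    (hη0 : ∀ x, 0 ≤ η x) :
    ∫ x in (closedBall (0 : EuclideanSpace ℝ (Fin N)) R)ᶜ,
      (inner ℝ (excessFlux p j V u G x) (gradient η x)
        + excessDensity p j V W b u G x * η x) ≤ 0 := by
  have hpq := Real.HolderConjugate.conjExponent h.one_lt
  set D : Set (EuclideanSpace ℝ (Fin N)) := (closedBall 0 R)ᶜ with hD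
  have hDo : IsOpen D := isClosed_closedBall.isOpen_compl
  have hRx : ∀ x ∈ D, R < ‖x‖ := fun x hx => by simpa [hD] using hx
  have hR0 : 0 < R := by linarith [h.one_lt_radius]
  obtain ⟨r, hr⟩ := hηs.isBounded.subset_closedBall (0 : EuclideanSpace ℝ (Fin N))
  -- The boundary condition is local; this bump equals `1` on the support of `η`, so the
  -- localisation is invisible there.
  let ζ : ContDiffBump (0 : EuclideanSpace ℝ (Fin N)) :=
    ⟨|r| + 1, |r| + 2, by positivity, by linarith⟩
  have hζ1 : ∀ x ∈ tsupport η, ζ x = 1 := fun x hx =>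
    ζ.one_of_mem_closedBall (closedBall_subset_closedBall
      (show r ≤ |r| + 1 by linarith [le_abs_self r]) (hr hx))
  have hw := ht ζ ζ.contDiff ζ.hasCompactSupport
  have hR'0 : 0 < R' := by linarith
  have hRR : R ^ 2 < R' ^ 2 := by gcongr
  set m : ℝ := (R ^ 2 + R' ^ 2) / 2 with hm
  have hm1 : R ^ 2 < m := by rw [hm]; linarith
  have hm2 : m < R' ^ 2 := by rw [hm]; linarith
  -- `Θ` vanishes near the sphere and equals `2σ` beyond `R'`. It forces `w + Θ > σ` there, so the
  -- smallness condition concerns only the shell where `V ≥ t + 2σ`.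
  set Θ : EuclideanSpace ℝ (Fin N) → ℝ := fun x =>
    2 * σ * Real.smoothTransition ((‖x‖ ^ 2 - m) / (R' ^ 2 - m)) with hΘ
  have hΘs : ContDiff ℝ ∞ Θ := contDiff_const.mul (Real.smoothTransition.contDiff.comp
    (((contDiff_norm_sq ℝ).sub contDiff_const).div_const _))
  have hΘ0 : ∀ x, 0 ≤ Θ x := fun x => mul_nonneg (by positivity) (Real.smoothTransition.nonneg _)
  have hΘ1 : ∀ x, R' < ‖x‖ → Θ x = 2 * σ := by
    intro x hx
    have : R' ^ 2 < ‖x‖ ^ 2 := by gcongr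
    simp only [hΘ]
    rw [Real.smoothTransition.one_of_one_le, mul_one]
    rw [le_div_iff₀ (by linarith)]
    linarith
  have hΘD : tsupport Θ ⊆ D := by
    have h1 : tsupport Θ ⊆ {x | m ≤ ‖x‖ ^ 2} := by
      refine closure_minimal (fun x hx => ?_) (isClosed_le continuous_const (by fun_prop))
      by_contra hlt
      refine hx ?_
      simp only [hΘ]
      rw [Real.smoothTransition.zero_of_nonpos, mul_zero]
      rw [Set.mem_ofPred_eq, not_le] at hlt
      exact div_nonpos_of_nonpos_of_nonneg (by linarith) (by linarith)
    intro x hx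
    have h2 : m ≤ ‖x‖ ^ 2 := h1 hx
    have : R < ‖x‖ := lt_of_pow_lt_pow_left₀ 2 (norm_nonneg x) (by linarith)
    simpa [hD] using this
  refine weak_inequality_up_to_boundary hDo hpq hη hηs hη0 (h.memLp_excessFlux hpq hj hηs)
    (h.integrableOn_excessDensity hj hηs) ?_ hw hΘs hΘD hσ ?_
  · intro c hc hc0
    exact excess_inequality hDo h.hasD1pGradient.2.1 h.one_lt h.hasD1pGradient.2.2
      (fun x hx => h.smooth x (hRx x hx).le) (fun x hx => h.pos x (hRx x hx).le)
      (h.continuousOn.mono fun x hx => (hRx x hx).le) h.equation h.locallyIntegrable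
      h.subsolution hj hc hc0
  · filter_upwards [ae_restrict_mem (hDo.measurableSet.inter (isClosed_tsupport η).measurableSet)]
      with x hx hle
    have hxR := hRx x hx.1
    rw [hζ1 x hx.2, one_mul] at hle
    have hmax := le_max_right (max (u x) 0 - t) 0
    have hx' : ‖x‖ ≤ R' := by
      by_contra! hlt
      rw [hΘ1 x hlt] at hle
      linarith
    have huV : u x ≤ V x := by
      have h1 := hVt x hxR hx'
      have h2 := le_max_left (max (u x) 0 - t) 0
      have h3 := le_max_left (u x) 0
      linarith [hΘ0 x]
    have hk : truncation j (u x / V x) = 0 :=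
      truncation_of_le_one j ((div_le_one (h.pos x hxR.le)).2 huV)
    simp [excessFlux, excessDensity, hk, deriv_truncation_eq_zero hk]

/-- A bound uniform in `j`: the logarithmic gradient bound on `V` turns `V s^p |∇V|^(p-1)` into
`(γ/|x|)^(p-1) |u|^p`. -/
theorem norm_excessFlux_le (h : IsExteriorPair p γ R V W b u G) {j : ℝ} (hj : 0 < j)
    {x : EuclideanSpace ℝ (Fin N)} (hx : R ≤ ‖x‖) :
    ‖excessFlux p j V u G x‖ ≤ ‖G x‖ ^ (p - 1) * |u x| + (γ / ‖x‖) ^ (p - 1) * |u x| ^ p := by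
  have hp := h.one_lt
  have hγ := h.slope_nonneg
  have hV := h.pos x hx
  rw [excessFlux]
  by_cases h0 : truncation j (u x / V x) = 0
  · rw [h0]
    simp
    positivity
  · obtain ⟨s1, s2⟩ := of_truncation_ne_zero hj h0
    have s0 : 0 ≤ u x / V x := by linarith
    have hu0 : 0 ≤ u x := by
      by_contra! hneg
      have := div_neg_of_neg_of_pos hneg hV
      linarith
    have k0 := truncation_nonneg j (u x / V x)
    have k1 := truncation_le_one j (u x / V x)
    refine (norm_sub_le _ _).trans (add_le_add ?_ ?_)
    · rw [norm_smul, Real.norm_of_nonneg (by positivity), norm_smul,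
        Real.norm_of_nonneg (by positivity), norm_rpow_sub_two_mul_norm hp, abs_of_nonneg hu0,
        mul_comm]
      have := mul_le_of_le_one_right hu0 k1
      gcongr
    · rw [norm_smul, Real.norm_of_nonneg (by positivity), norm_smul,
        Real.norm_of_nonneg (by positivity), norm_rpow_sub_two_mul_norm hp, abs_of_nonneg hu0]
      have e1 : ‖gradient V x‖ ^ (p - 1) ≤ (γ / ‖x‖) ^ (p - 1) * V x ^ (p - 1) := by
        rw [← Real.mul_rpow (by positivity) hV.le]
        exact Real.rpow_le_rpow (norm_nonneg _) (h.norm_gradient_le x hx) (by linarith)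
      have e2 : V x * (u x / V x) ^ p * V x ^ (p - 1) = u x ^ p := by
        rw [Real.div_rpow hu0 hV.le, Real.rpow_sub_one hV.ne']
        have := (Real.rpow_pos_of_pos hV p).ne'
        field_simp
      calc V x * ((u x / V x) ^ p * truncation j (u x / V x)) * ‖gradient V x‖ ^ (p - 1)
          ≤ V x * ((u x / V x) ^ p * 1) * ((γ / ‖x‖) ^ (p - 1) * V x ^ (p - 1)) := by gcongr
        _ = (γ / ‖x‖) ^ (p - 1) * (V x * (u x / V x) ^ p * V x ^ (p - 1)) := by ring
        _ = _ := by rw [e2]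

theorem norm_smul_gradient_rpow_le (h : IsExteriorPair p γ R V W b u G)
    {x : EuclideanSpace ℝ (Fin N)} (hx : R ≤ ‖x‖) :
    ‖(u x / V x) • gradient V x‖ ^ p ≤ γ ^ p * |u x| ^ p := by
  have hp := h.one_lt
  have hγ := h.slope_nonneg
  have hV := h.pos x hx
  rw [← Real.mul_rpow hγ (abs_nonneg _)]
  refine Real.rpow_le_rpow (norm_nonneg _) ?_ (by linarith)
  rw [norm_smul, norm_div, Real.norm_eq_abs, Real.norm_of_nonneg hV.le]
  have h1 : γ / ‖x‖ ≤ γ := div_le_self hγ (h.one_lt_radius.le.trans hx)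
  calc |u x| / V x * ‖gradient V x‖ ≤ |u x| / V x * (γ * V x) := by
        gcongr
        exact (h.norm_gradient_le x hx).trans (by gcongr)
    _ = γ * |u x| := by field_simp

theorem rpow_mul_truncation_nonneg (h : IsExteriorPair p γ R V W b u G) (j : ℝ)
    {x : EuclideanSpace ℝ (Fin N)} (hx : R ≤ ‖x‖) :
    0 ≤ u x ^ p * truncation j (u x / V x) := by
  rcases le_or_gt (u x) 0 with hu | hu
  · have : u x / V x ≤ 0 := div_nonpos_of_nonpos_of_nonneg hu (h.pos x hx).le
    rw [truncation_of_le_one j (by linarith), mul_zero]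
  · exact mul_nonneg (Real.rpow_nonneg hu.le _) (truncation_nonneg _ _)

end IsExteriorPair

end ExteriorComparison

/-! ### The comparison principle outside a ball. -/

section ExteriorComparison

variable {N : ℕ}

theorem mul_le_rpow_add_rpow {a a' x y : ℝ} (h : a.HolderConjugate a') (hx : 0 ≤ x) (hy : 0 ≤ y) :
    x * y ≤ x ^ a + y ^ a' :=
  (Real.young_inequality_of_nonneg hx hy h).trans (add_le_add
    (div_le_self (Real.rpow_nonneg hx _) h.lt.le) (div_le_self (Real.rpow_nonneg hy _) h.symm.lt.le))

theorem holderConjugate_dim {p : ℝ} (hp : 1 < p) (hpN : p < N) :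
    ((N : ℝ) / (N - p)).HolderConjugate (N / p) := by
  have hN : (0 : ℝ) < N := by linarith
  have h1 : (0 : ℝ) < N - p := by linarith
  rw [Real.holderConjugate_iff]
  refine ⟨(one_lt_div h1).2 (by linarith), ?_⟩
  field_simp
  ring

theorem integrable_norm_rpow_of_memLp {E F : Type*} [MeasurableSpace E] [NormedAddCommGroup F]
    {ν : Measure E} {r : ℝ} (hr : 0 < r) {g : E → F} (hg : MemLp g (ENNReal.ofReal r) ν) :
    Integrable (fun x => ‖g x‖ ^ r) ν := by
  have := hg.integrable_norm_rpow (by simpa using hr) ENNReal.ofReal_ne_top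
  rwa [ENNReal.toReal_ofReal hr.le] at this

theorem lt_sobolevExponent {p : ℝ} (hp : 1 < p) (hpN : p < N) : p < sobolevExponent N p := by
  have h1 : (0 : ℝ) < N - p := by linarith
  rw [sobolevExponent, lt_div_iff₀ h1]
  nlinarith

namespace IsExteriorPair

variable {p γ R : ℝ} {V W b u : EuclideanSpace ℝ (Fin N) → ℝ}
  {G : EuclideanSpace ℝ (Fin N) → EuclideanSpace ℝ (Fin N)}

/-- The gradient of the cutoff is `O(1/ρ)` and vanishes for `|x| < ρ`, so the flux error is
controlled by `|G|^p + |u|^p ρ^(-p)`. Young's inequality with exponents `N/(N-p)` and `N/p` and a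
free parameter `θ` splits the second term into `|u|^{p*}` and a multiple of `ρ^(-N)`, whose integral
over a ball of radius `2ρ` is independent of `ρ` and small for large `θ`. -/
theorem exists_cutoff_error_le (h : IsExteriorPair p γ R V W b u G) :
    ∃ C : ℝ, 0 ≤ C ∧ ∀ θ : ℝ, 0 < θ → ∀ j ρ : ℝ, 0 < j → R ≤ ρ →
      ∀ x : EuclideanSpace ℝ (Fin N), R ≤ ‖x‖ →
      -(if ρ ≤ ‖x‖ then ‖G x‖ ^ p
          + C * θ ^ ((N : ℝ) / (N - p)) * |u x| ^ sobolevExponent N p else 0)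
        - C * θ⁻¹ ^ ((N : ℝ) / p) * (ρ ^ N)⁻¹
      ≤ inner ℝ (excessFlux p j V u G x) (gradient (radialCutoff ρ) x) := by
  obtain ⟨C, hC0, hC⟩ := exists_norm_gradient_radialCutoff_le (N := N)
  have hp := h.one_lt
  have hγ := h.slope_nonneg
  have hR := h.one_lt_radius
  -- `C^p` comes from Young's inequality for `|G|^(p-1) |u| C/ρ`, and `γ^(p-1) C` from the part of
  -- the flux due to `V`.
  set C2 : ℝ := C ^ p + γ ^ (p - 1) * C with hC2
  have hC20 : 0 ≤ C2 := by positivity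
  refine ⟨C2, hC20, fun θ hθ j ρ hj hρ x hx => ?_⟩
  have hρ0 : 0 < ρ := by linarith
  obtain ⟨g1, g2⟩ := hC ρ hρ0 x
  have hlast : 0 ≤ C2 * θ⁻¹ ^ ((N : ℝ) / p) * (ρ ^ N)⁻¹ := by positivity
  split_ifs with hρx
  · have n1 := h.norm_excessFlux_le hj hx
    have n2 : |inner ℝ (excessFlux p j V u G x) (gradient (radialCutoff ρ) x)|
        ≤ (‖G x‖ ^ (p - 1) * |u x| + (γ / ρ) ^ (p - 1) * |u x| ^ p) * (C / ρ) := by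
      refine (abs_real_inner_le_norm _ _).trans (mul_le_mul (n1.trans ?_) g2 (norm_nonneg _)
        (by positivity))
      have : (γ / ‖x‖) ^ (p - 1) ≤ (γ / ρ) ^ (p - 1) :=
        Real.rpow_le_rpow (by positivity) (by gcongr) (by linarith)
      gcongr
    have n3 : ‖G x‖ ^ (p - 1) * (|u x| * (C / ρ)) ≤ ‖G x‖ ^ p + (|u x| * (C / ρ)) ^ p :=
      rpow_sub_one_mul_le_add hp (norm_nonneg _) (by positivity)
    have n4 : (|u x| * (C / ρ)) ^ p = C ^ p * (|u x| ^ p * ρ⁻¹ ^ p) := by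
      rw [div_eq_mul_inv, Real.mul_rpow (abs_nonneg _) (by positivity),
        Real.mul_rpow hC0 (by positivity)]
      ring
    have n5 : (γ / ρ) ^ (p - 1) * |u x| ^ p * (C / ρ) = γ ^ (p - 1) * C * (|u x| ^ p * ρ⁻¹ ^ p) := by
      have : ρ⁻¹ ^ p = ρ⁻¹ ^ (p - 1) * ρ⁻¹ := by
        rw [← Real.rpow_add_one (by positivity)]; ring_nf
      rw [div_eq_mul_inv, Real.mul_rpow hγ (by positivity), this]
      ring
    have n6 : |u x| ^ p * ρ⁻¹ ^ p ≤ θ ^ ((N : ℝ) / (N - p)) * |u x| ^ sobolevExponent N p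
        + θ⁻¹ ^ ((N : ℝ) / p) * (ρ ^ N)⁻¹ := by
      have y := mul_le_rpow_add_rpow (holderConjugate_dim hp h.lt_dim)
        (x := θ * |u x| ^ p) (y := θ⁻¹ * ρ⁻¹ ^ p) (by positivity) (by positivity)
      rw [Real.mul_rpow hθ.le (by positivity), Real.mul_rpow (by positivity) (by positivity),
        ← Real.rpow_mul (abs_nonneg _), ← Real.rpow_mul (by positivity)] at y
      have y1 : θ * |u x| ^ p * (θ⁻¹ * ρ⁻¹ ^ p) = |u x| ^ p * ρ⁻¹ ^ p := by field_simp
      have y2 : p * (N / (N - p)) = sobolevExponent N p := by rw [sobolevExponent]; ring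
      have y3 : ρ⁻¹ ^ (p * (N / p)) = (ρ ^ N)⁻¹ := by
        rw [mul_div_cancel₀ _ (by linarith : p ≠ 0), Real.rpow_natCast, inv_pow]
      rwa [y1, y2, y3] at y
    have n7 := mul_le_mul_of_nonneg_left n6 hC20
    have n8 := neg_abs_le (inner ℝ (excessFlux p j V u G x) (gradient (radialCutoff ρ) x))
    rw [hC2] at n7 ⊢
    linarith
  · rw [g1 (not_le.1 hρx), inner_zero_right]
    linarith

/-- Three limits are taken in the order `j → ∞` at fixed `ρ`, `ρ → ∞` at fixed `θ`, `θ → ∞`. They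
show that the nonnegative density `(W - b) u^p κ_{j₀}(u/V)` has zero integral on every bounded part
of the exterior. As `W > b`, the set `u > V` is null. -/
theorem le_of_leOnBoundary (h : IsExteriorPair p γ R V W b u G)
    {t R' σ : ℝ} (ht : LeOnBoundary p (closedBall 0 R)ᶜ (fun y => max (u y) 0) t)
    (hR' : R < R') (hσ : 0 < σ) (hVt : ∀ x, R < ‖x‖ → ‖x‖ ≤ R' → t + 2 * σ ≤ V x) :
    ∀ᵐ x ∂(volume.restrict (closedBall (0 : EuclideanSpace ℝ (Fin N)) R)ᶜ), u x ≤ V x := by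
  have hp := h.one_lt
  have hpN := h.lt_dim
  have hγ := h.slope_nonneg
  have hR0 : 0 < R := by linarith [h.one_lt_radius]
  have hpq := Real.HolderConjugate.conjExponent hp
  set D : Set (EuclideanSpace ℝ (Fin N)) := (closedBall 0 R)ᶜ with hD
  have hDm : MeasurableSet D := isClosed_closedBall.measurableSet.compl
  have hRx : ∀ x ∈ D, R < ‖x‖ := fun x hx => by simpa [hD] using hx
  obtain ⟨C1, hC10, hC1⟩ := exists_neg_le_mul_deriv_truncation
  obtain ⟨C2, hC20, hC2⟩ := h.exists_cutoff_error_le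
  have hps := lt_sobolevExponent hp hpN
  set ps := sobolevExponent N p
  have hps0 : 0 < ps := by linarith
  have hGp : IntegrableOn (fun x => ‖G x‖ ^ p) D :=
    integrable_norm_rpow_of_memLp (by linarith) h.hasD1pGradient.2.2
  have hus : IntegrableOn (fun x => |u x| ^ ps) D :=
    integrable_norm_rpow_of_memLp hps0 h.hasD1pGradient.1
  set S : ℝ → Set (EuclideanSpace ℝ (Fin N)) := fun ρ => D ∩ closedBall 0 (2 * ρ) with hS
  have hSm : ∀ ρ, MeasurableSet (S ρ) := fun ρ => hDm.inter measurableSet_closedBall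
  have hSD : ∀ ρ, S ρ ⊆ D := fun ρ => Set.inter_subset_left
  have hSlt : ∀ ρ, volume (S ρ) < ⊤ := fun ρ =>
    (measure_mono Set.inter_subset_right).trans_lt measure_closedBall_lt_top
  have hSfin : ∀ ρ, IsFiniteMeasure (volume.restrict (S ρ)) := fun ρ => ⟨by simpa using hSlt ρ⟩
  have hup : ∀ ρ, IntegrableOn (fun x => |u x| ^ p) (S ρ) := by
    intro ρ
    have := hSfin ρ
    exact integrable_norm_rpow_of_memLp (by linarith) ((h.hasD1pGradient.1.mono_measure
      (Measure.restrict_mono (hSD ρ) le_rfl)).mono_exponent (ENNReal.ofReal_le_ofReal hps.le))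
  have hsm := h.aestronglyMeasurable_quotient
  have hWb : ∀ᵐ x ∂(volume.restrict D), 0 < W x - b x := h.lt.mono fun x hx => sub_pos.2 hx
  set L : ℝ → EuclideanSpace ℝ (Fin N) → ℝ := fun j x =>
    (W x - b x) * (u x ^ p * truncation j (u x / V x)) with hL
  have hLD : ∀ j, ∀ᵐ x ∂(volume.restrict D), 0 ≤ L j x := by
    intro j
    filter_upwards [hWb, ae_restrict_mem hDm] with x hx hxD
    exact mul_nonneg hx.le (h.rpow_mul_truncation_nonneg j (hRx x hxD).le)
  have key : ∀ j₀ : ℝ, 0 < j₀ → ∀ᵐ x ∂(volume.restrict D), L j₀ x = 0 := by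
    intro j₀ hj₀
    -- Both `j₀` and `ρ₀` stay fixed while `j` and `ρ` grow, so the left-hand side does not move in
    -- the limits.
    set L1 : ℝ → EuclideanSpace ℝ (Fin N) → ℝ := fun ρ₀ x => if ‖x‖ ≤ ρ₀ then L j₀ x else 0
      with hL1
    have hL1D : ∀ ρ₀, ∀ᵐ x ∂(volume.restrict D), 0 ≤ L1 ρ₀ x := by
      intro ρ₀
      filter_upwards [hLD j₀] with x hx
      simp only [hL1]
      split_ifs
      · exact hx
      · exact le_rfl
    set E : EuclideanSpace ℝ (Fin N) → ℝ := fun x => 3 * C1 * (γ ^ p * |u x| ^ p + ‖G x‖ ^ p)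
      with hE
    have hE0 : ∀ x, 0 ≤ E x := fun x => by positivity
    have hEi : ∀ ρ, IntegrableOn E (S ρ) := fun ρ =>
      (((hup ρ).const_mul _).add (hGp.mono_set (hSD ρ))).const_mul _
    -- The error from the decreasing part of the truncation. Its majorant `E` is integrable only on
    -- bounded sets, as `|u|^p` need not be integrable at infinity, so `j → ∞` must precede `ρ → ∞`.
    set Ej : ℝ → EuclideanSpace ℝ (Fin N) → ℝ := fun j => {x | j ≤ u x / V x}.indicator E with hEj
    have hEjle : ∀ j x, ‖Ej j x‖ ≤ E x := fun j x => by
      rw [hEj, norm_indicator_eq_indicator_norm]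
      exact (Set.indicator_le_self' (fun _ _ => norm_nonneg _) x).trans
        (Real.norm_of_nonneg (hE0 x)).le
    have hEjm : ∀ ρ j, AEStronglyMeasurable (Ej j) (volume.restrict (S ρ)) := fun ρ j =>
      (hEi ρ).1.indicator₀ (nullMeasurableSet_le aemeasurable_const
        (hsm.mono_measure (Measure.restrict_mono (hSD ρ) le_rfl)).aemeasurable)
    -- The flux error without its `ρ^(-N)` part; it is integrable on the whole exterior, so its
    -- tails tend to zero.
    set Q : ℝ → EuclideanSpace ℝ (Fin N) → ℝ := fun θ x =>
      ‖G x‖ ^ p + C2 * θ ^ ((N : ℝ) / (N - p)) * |u x| ^ ps with hQ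
    have hQi : ∀ θ, IntegrableOn (Q θ) D := fun θ => hGp.add (hus.const_mul _)
    have hQ0 : ∀ θ x, 0 < θ → 0 ≤ Q θ x := fun θ x hθ => by positivity
    set err : ℝ → ℝ → EuclideanSpace ℝ (Fin N) → ℝ := fun θ ρ => {x | ρ ≤ ‖x‖}.indicator (Q θ)
      with herr
    have hmρ : ∀ ρ, MeasurableSet {x : EuclideanSpace ℝ (Fin N) | ρ ≤ ‖x‖} := fun ρ =>
      measurableSet_le measurable_const measurable_norm
    have herri : ∀ θ ρ, IntegrableOn (err θ ρ) D := fun θ ρ => (hQi θ).indicator (hmρ ρ)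
    set v : ℝ := (volume (closedBall (0 : EuclideanSpace ℝ (Fin N)) 1)).toReal with hv
    have hvol : ∀ ρ, 0 < ρ → (volume (S ρ)).toReal ≤ (2 * ρ) ^ N * v := by
      intro ρ hρ
      have e := Measure.addHaar_closedBall' (volume : Measure (EuclideanSpace ℝ (Fin N))) 0
        (by positivity : 0 ≤ 2 * ρ)
      rw [finrank_euclideanSpace_fin] at e
      have e2 : (volume (closedBall (0 : EuclideanSpace ℝ (Fin N)) (2 * ρ))).toReal
          = (2 * ρ) ^ N * v := by
        rw [e, ENNReal.toReal_mul, ENNReal.toReal_ofReal (by positivity)]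
      rw [← e2]
      exact ENNReal.toReal_mono measure_closedBall_lt_top.ne (measure_mono Set.inter_subset_right)
    have step : ∀ ρ₀ ρ j θ : ℝ, R ≤ ρ → ρ₀ ≤ ρ → j₀ ≤ j → 0 < θ →
        IntegrableOn (L1 ρ₀) (S ρ) ∧ ∫ x in S ρ, L1 ρ₀ x ≤ (∫ x in S ρ, Ej j x)
          + (∫ x in D, err θ ρ x) + C2 * θ⁻¹ ^ ((N : ℝ) / p) * (2 ^ N * v) := by
      intro ρ₀ ρ j θ hRρ hρ hjj hθ
      have hρ0 : 0 < ρ := by linarith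
      have hj : 0 < j := by linarith
      have := hSfin ρ
      have hle := Measure.restrict_mono (μ := volume) (hSD ρ) le_rfl
      set c : ℝ := C2 * θ⁻¹ ^ ((N : ℝ) / p) * (ρ ^ N)⁻¹ with hc
      have hc0 : 0 ≤ c := by positivity
      have hηs : HasCompactSupport (radialCutoff ρ : EuclideanSpace ℝ (Fin N) → ℝ) :=
        hasCompactSupport_radialCutoff hρ0
      have hηd : ContDiff ℝ ∞ (radialCutoff ρ : EuclideanSpace ℝ (Fin N) → ℝ) :=
        contDiff_radialCutoff ρ
      have hX := h.integral_excess_nonpos hj ht hR' hσ hVt hηd hηs (radialCutoff_nonneg ρ)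
      set X : EuclideanSpace ℝ (Fin N) → ℝ := fun x =>
        inner ℝ (excessFlux p j V u G x) (gradient (radialCutoff ρ) x)
          + excessDensity p j V W b u G x * radialCutoff ρ x with hXdef
      have hXi : IntegrableOn X (S ρ) := by
        refine Integrable.add (integrable_inner_of_memLp hpq
          (h.memLp_excessFlux hpq hj (isCompact_closedBall _ _)) ?_) ?_
        · obtain ⟨C, hC⟩ := (isCompact_closedBall (0 : EuclideanSpace ℝ (Fin N))
            (2 * ρ)).exists_bound_of_continuousOn (continuous_gradient hηd).continuousOn
          exact MemLp.of_bound (continuous_gradient hηd).aestronglyMeasurable C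
            ((ae_restrict_iff' (hSm ρ)).2 (Eventually.of_forall fun x hx => hC x hx.2))
        · refine (h.integrableOn_excessDensity hj (isCompact_closedBall _ _)).mul_bdd (c := 1)
            hηd.continuous.aestronglyMeasurable (Eventually.of_forall fun x => ?_)
          rw [Real.norm_of_nonneg (radialCutoff_nonneg ρ x)]
          exact radialCutoff_le_one ρ x
      have hXle : ∫ x in S ρ, X x ≤ 0 := by
        refine le_trans (le_of_eq ?_) hX
        refine (setIntegral_eq_of_subset_of_forall_sdiff_eq_zero hDm (hSD ρ) fun x hx => ?_).symm
        have hx' : x ∉ tsupport (radialCutoff ρ) := fun h' =>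
          hx.2 ⟨hx.1, tsupport_radialCutoff_subset hρ0 h'⟩
        simp only [hXdef]
        rw [gradient_of_notMem_tsupport hx', image_eq_zero_of_notMem_tsupport hx']
        simp
      have hEi' : IntegrableOn (Ej j) (S ρ) :=
        (hEi ρ).mono' (hEjm ρ j) (Eventually.of_forall fun x => hEjle j x)
      have hUi : IntegrableOn (fun x => X x + Ej j x + err θ ρ x + c) (S ρ) :=
        ((hXi.add hEi').add ((herri θ ρ).mono_set (hSD ρ))).add (integrable_const _)
      have hpt : ∀ᵐ x ∂(volume.restrict (S ρ)), L1 ρ₀ x ≤ X x + Ej j x + err θ ρ x + c := by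
        filter_upwards [(hLD j).filter_mono (ae_mono hle), hWb.filter_mono (ae_mono hle),
          ae_restrict_mem (hSm ρ)] with x hx hxW hxS
        have hxR := (hRx x hxS.1).le
        have d1 := hC2 θ hθ j ρ hj hRρ x hxR
        have d2 := excessDensity_ge hp hC10 hC1 hj (V := V) (W := W) (b := b) (u := u) (G := G)
          (x := x)
        have d3 : (if j ≤ u x / V x then
            3 * C1 * (‖(u x / V x) • gradient V x‖ ^ p + ‖G x‖ ^ p) else 0) ≤ Ej j x := by
          simp only [hEj, Set.indicator_apply, Set.mem_ofPred_eq]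
          split_ifs
          · have := h.norm_smul_gradient_rpow_le hxR
            simp only [hE]
            gcongr
          · exact le_rfl
        have d4 : err θ ρ x = if ρ ≤ ‖x‖ then ‖G x‖ ^ p
          + C2 * θ ^ ((N : ℝ) / (N - p)) * |u x| ^ ps else 0 := by
          simp only [herr, Set.indicator_apply, Set.mem_ofPred_eq, hQ]
        rw [← d4] at d1
        have hEj0 : 0 ≤ Ej j x := Set.indicator_nonneg (fun y _ => hE0 y) x
        have k0 := radialCutoff_nonneg ρ x
        have k1 := radialCutoff_le_one ρ x
        have d5 : L j x * radialCutoff ρ x - Ej j x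
            ≤ excessDensity p j V W b u G x * radialCutoff ρ x := by
          have := mul_le_mul_of_nonneg_right (d2.trans' (sub_le_sub_left d3 _)) k0
          have := mul_le_of_le_one_right hEj0 k1
          simp only [hL]
          linarith
        -- The truncations increase with `j` and the cutoff is `1` on the ball of radius `ρ₀`.
        have d6 : L1 ρ₀ x ≤ L j x * radialCutoff ρ x := by
          simp only [hL1]
          split_ifs with hxρ
          · rw [radialCutoff_of_le hρ0 (hxρ.trans hρ), mul_one]
            simp only [hL]
            refine mul_le_mul_of_nonneg_left ?_ hxW.le
            rcases le_or_gt (u x) 0 with hu | hu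
            · have : u x / V x ≤ 1 := by
                have := div_nonpos_of_nonpos_of_nonneg hu (h.pos x hxR).le
                linarith
              rw [truncation_of_le_one j₀ this, truncation_of_le_one j this]
            · exact mul_le_mul_of_nonneg_left (truncation_mono hj₀ hjj) (by positivity)
          · exact mul_nonneg hx k0
        simp only [hXdef]
        linarith
      have hLi : IntegrableOn (L1 ρ₀) (S ρ) := by
        refine hUi.mono' ?_ ?_
        · have hm1 : AEStronglyMeasurable (L j₀) (volume.restrict (S ρ)) := by
            have hWm : AEStronglyMeasurable W (volume.restrict (S ρ)) :=
              (h.continuousOn.mono fun x hx => (hRx x hx.1).le).aestronglyMeasurable (hSm ρ)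
            exact (hWm.sub (h.integrableOn _ (isCompact_closedBall _ _)).1).mul
              (((h.hasD1pGradient.1.1.mono_measure hle).aemeasurable.pow_const
                p).aestronglyMeasurable.mul ((contDiff_truncation
                  j₀).continuous.comp_aestronglyMeasurable (hsm.mono_measure hle)))
          exact hm1.indicator (s := {x | ‖x‖ ≤ ρ₀}) (measurableSet_le measurable_norm
            measurable_const)
        · filter_upwards [hpt, (hL1D ρ₀).filter_mono (ae_mono hle)] with x h1 h2
          rwa [Real.norm_of_nonneg h2]
      refine ⟨hLi, ?_⟩
      have i1 := integral_mono_ae hLi hUi hpt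
      have herrS := (herri θ ρ).mono_set (hSD ρ)
      rw [integral_add (f := fun x => X x + Ej j x + err θ ρ x) ((hXi.add hEi').add herrS)
        (integrable_const _), integral_add (f := fun x => X x + Ej j x) (hXi.add hEi') herrS,
        integral_add hXi hEi'] at i1
      have i2 : ∫ x in S ρ, err θ ρ x ≤ ∫ x in D, err θ ρ x :=
        setIntegral_mono_set (herri θ ρ) (Eventually.of_forall fun x =>
          Set.indicator_nonneg (fun y _ => hQ0 θ y hθ) x) (LE.le.eventuallyLE (hSD ρ))
      -- The volume of `S ρ` is at most `(2ρ)^N v`, which cancels the factor `ρ^(-N)` in `c`.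
      have i3 : ∫ _ in S ρ, c ≤ C2 * θ⁻¹ ^ ((N : ℝ) / p) * (2 ^ N * v) := by
        rw [setIntegral_const, smul_eq_mul, measureReal_def]
        calc (volume (S ρ)).toReal * c ≤ ((2 * ρ) ^ N * v) * c := by
              gcongr
              exact hvol ρ hρ0
          _ = _ := by
              rw [hc, mul_pow]
              field_simp
      linarith
    have hint : ∀ ρ₀ : ℝ, R ≤ ρ₀ → ∫ x in S ρ₀, L1 ρ₀ x ≤ 0 := by
      intro ρ₀ hρ₀
      have hρ00 : 0 < ρ₀ := by linarith
      have s1 : ∀ ρ θ : ℝ, ρ₀ ≤ ρ → 0 < θ → ∫ x in S ρ₀, L1 ρ₀ x ≤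
          (∫ x in D, err θ ρ x) + C2 * θ⁻¹ ^ ((N : ℝ) / p) * (2 ^ N * v) := by
        intro ρ θ hρ hθ
        have e1 : ∫ x in S ρ, L1 ρ₀ x = ∫ x in S ρ₀, L1 ρ₀ x := by
          refine setIntegral_eq_of_subset_of_forall_sdiff_eq_zero (hSm ρ)
            (Set.inter_subset_inter_right _ (closedBall_subset_closedBall (by linarith)))
            fun x hx => if_neg fun hle => hx.2 ⟨hx.1.1, ?_⟩
          rw [mem_closedBall, dist_zero_right]
          linarith
        rw [← e1]
        have lim : Tendsto (fun n : ℕ => ∫ x in S ρ, Ej n x) atTop (𝓝 0) := by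
          have := tendsto_integral_of_dominated_convergence (μ := volume.restrict (S ρ))
            (F := fun n : ℕ => Ej n) (f := fun _ => 0) E (fun n => hEjm ρ n) (hEi ρ)
            (fun n => Eventually.of_forall fun x => hEjle n x)
            (Eventually.of_forall fun x => by
              obtain ⟨n, hn⟩ := exists_nat_gt (u x / V x)
              refine tendsto_const_nhds.congr' ?_
              filter_upwards [eventually_ge_atTop n] with m hm
              refine (Set.indicator_of_notMem ?_ _).symm
              have : (n : ℝ) ≤ m := by exact_mod_cast hm
              simpa using (by linarith : u x / V x < m))
          simpa using this
        have lim2 := (lim.add_const (∫ x in D, err θ ρ x)).add_const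
          (C2 * θ⁻¹ ^ ((N : ℝ) / p) * (2 ^ N * v))
        rw [zero_add] at lim2
        obtain ⟨n₀, hn₀⟩ := exists_nat_ge j₀
        refine ge_of_tendsto lim2 ?_
        filter_upwards [eventually_ge_atTop n₀] with n hn
        have : (n₀ : ℝ) ≤ n := by exact_mod_cast hn
        exact (step ρ₀ ρ n θ (by linarith) hρ (by linarith) hθ).2
      have s2 : ∀ θ : ℝ, 0 < θ → ∫ x in S ρ₀, L1 ρ₀ x ≤
          C2 * θ⁻¹ ^ ((N : ℝ) / p) * (2 ^ N * v) := by
        intro θ hθ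
        have lim : Tendsto (fun n : ℕ => ∫ x in D, err θ n x) atTop (𝓝 0) := by
          have := tendsto_integral_of_dominated_convergence (μ := volume.restrict D)
            (F := fun n : ℕ => err θ n) (f := fun _ => 0) (Q θ) (fun n => (herri θ n).1) (hQi θ)
            (fun n => Eventually.of_forall fun x => by
              rw [Real.norm_of_nonneg (Set.indicator_nonneg (fun y _ => hQ0 θ y hθ) x)]
              exact Set.indicator_le_self' (fun y _ => hQ0 θ y hθ) x)
            (Eventually.of_forall fun x => by
              obtain ⟨n, hn⟩ := exists_nat_gt ‖x‖
              refine tendsto_const_nhds.congr' ?_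
              filter_upwards [eventually_ge_atTop n] with m hm
              refine (Set.indicator_of_notMem ?_ _).symm
              have : (n : ℝ) ≤ m := by exact_mod_cast hm
              simpa using (by linarith : ‖x‖ < m))
          simpa using this
        have lim2 := lim.add_const (C2 * θ⁻¹ ^ ((N : ℝ) / p) * (2 ^ N * v))
        rw [zero_add] at lim2
        obtain ⟨n₀, hn₀⟩ := exists_nat_ge ρ₀
        refine ge_of_tendsto lim2 ?_
        filter_upwards [eventually_ge_atTop n₀] with n hn
        have : (n₀ : ℝ) ≤ n := by exact_mod_cast hn
        exact s1 n θ (by linarith) hθ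
      have hNp : 0 < (N : ℝ) / p := div_pos (by linarith) (by linarith)
      have lim : Tendsto (fun θ : ℝ => C2 * θ⁻¹ ^ ((N : ℝ) / p) * (2 ^ N * v)) atTop (𝓝 0) := by
        have h1 := (tendsto_inv_atTop_zero (𝕜 := ℝ)).rpow_const (p := (N : ℝ) / p)
          (Or.inr hNp.le)
        rw [Real.zero_rpow hNp.ne'] at h1
        simpa using (h1.const_mul C2).mul_const (2 ^ N * v)
      refine ge_of_tendsto lim ?_
      filter_upwards [eventually_gt_atTop (0 : ℝ)] with θ hθ
      exact s2 θ hθ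
    have hzero : ∀ n : ℕ, ∀ᵐ x ∂(volume.restrict D), x ∈ S (R + n) → L1 (R + n) x = 0 := by
      intro n
      have hρ₀ : R ≤ R + n := by have := n.cast_nonneg (α := ℝ); linarith
      have hle := Measure.restrict_mono (μ := volume) (hSD (R + n)) le_rfl
      have hnn := (hL1D (R + n)).filter_mono (ae_mono hle)
      have hi := (step (R + n) (R + n) j₀ 1 hρ₀ le_rfl le_rfl one_pos).1
      have h0 : ∫ x in S (R + n), L1 (R + n) x = 0 :=
        le_antisymm (hint _ hρ₀) (integral_nonneg_of_ae hnn)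
      have h1 := (integral_eq_zero_iff_of_nonneg_ae hnn hi).1 h0
      have h2 := (ae_restrict_iff' (hSm (R + n))).1 h1
      exact ae_restrict_of_ae h2
    filter_upwards [ae_all_iff.2 hzero, ae_restrict_mem hDm] with x hx hxD
    obtain ⟨n, hn⟩ := exists_nat_ge ‖x‖
    have hxn : ‖x‖ ≤ R + n := by linarith
    have hxS : x ∈ S (R + n) := ⟨hxD, by
      rw [mem_closedBall, dist_zero_right]
      have := n.cast_nonneg (α := ℝ)
      linarith⟩
    have := hx n hxS
    simpa only [hL1, if_pos hxn] using this
  have key2 : ∀ᵐ x ∂(volume.restrict D), ∀ n : ℕ, L (n + 1) x = 0 :=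
    ae_all_iff.2 fun n => key _ (by positivity)
  filter_upwards [key2, hWb, ae_restrict_mem hDm] with x hx hx2 hxD
  by_contra! hlt
  have hV := h.pos x (hRx x hxD).le
  have hs : 1 < u x / V x := (one_lt_div hV).2 hlt
  obtain ⟨n, hn⟩ := exists_nat_ge (u x / V x)
  have h1 := truncation_pos (j := n + 1) (by positivity) hs (by linarith)
  have h2 : 0 < u x ^ p := Real.rpow_pos_of_pos (hV.trans hlt) _
  exact (mul_pos hx2 (mul_pos h2 h1)).ne' (hx n)

end IsExteriorPair

end ExteriorComparison

/-! ### Comparison with the barrier and decay of subsolutions. -/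

section SubsolutionDecay

variable {N : ℕ}

theorem HasWeakGradient.mono {D Ω : Set (EuclideanSpace ℝ (Fin N))} (hΩ : MeasurableSet Ω)
    (hDΩ : D ⊆ Ω) {u : EuclideanSpace ℝ (Fin N) → ℝ}
    {G : EuclideanSpace ℝ (Fin N) → EuclideanSpace ℝ (Fin N)} (h : HasWeakGradient Ω u G) :
    HasWeakGradient D u G := by
  refine ⟨h.1.mono_set hDΩ, h.2.1.mono_set hDΩ, fun φ hφ i => ?_⟩
  have hφ0 : ∀ x ∈ Ω \ D, x ∉ tsupport φ := fun x hx h' => hx.2 (hφ.2.2 h')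
  rw [← setIntegral_eq_of_subset_of_forall_sdiff_eq_zero hΩ hDΩ,
    ← setIntegral_eq_of_subset_of_forall_sdiff_eq_zero hΩ hDΩ]
  · exact h.2.2 φ ⟨hφ.1, hφ.2.1, hφ.2.2.trans hDΩ⟩ i
  · intro x hx
    rw [image_eq_zero_of_notMem_tsupport (hφ0 x hx), mul_zero]
  · intro x hx
    rw [gradient_of_notMem_tsupport (hφ0 x hx)]
    simp

theorem HasD1pGradient.mono {p : ℝ} {D Ω : Set (EuclideanSpace ℝ (Fin N))} (hΩ : MeasurableSet Ω)
    (hDΩ : D ⊆ Ω) {u : EuclideanSpace ℝ (Fin N) → ℝ}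
    {G : EuclideanSpace ℝ (Fin N) → EuclideanSpace ℝ (Fin N)} (h : HasD1pGradient p Ω u G) :
    HasD1pGradient p D u G :=
  ⟨h.1.mono_measure (Measure.restrict_mono hDΩ le_rfl), h.2.1.mono hΩ hDΩ,
    h.2.2.mono_measure (Measure.restrict_mono hDΩ le_rfl)⟩

theorem rpow_le_one_add_rpow {x a b : ℝ} (hx : 0 ≤ x) (ha : 0 ≤ a) (hab : a ≤ b) :
    x ^ a ≤ 1 + x ^ b := by
  rcases le_total x 1 with h | h
  · have := Real.rpow_le_one hx h ha
    have := Real.rpow_nonneg hx b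
    linarith
  · have := Real.rpow_le_rpow_of_exponent_le h hab
    linarith

/-- Young's inequality with `N/p` and `N/(N-p)`: the power of `|u|` produced, `(p-1) N/(N-p)`, is
below `p*`, hence dominated by `1 + |u|^{p*}` on a finite measure space. -/
theorem integrable_potential_mul {p : ℝ} (hp : 1 < p) (hpN : p < N)
    {ν : Measure (EuclideanSpace ℝ (Fin N))} [IsFiniteMeasure ν]
    {g u : EuclideanSpace ℝ (Fin N) → ℝ} (hg : MemLp g (ENNReal.ofReal ((N : ℝ) / p)) ν)
    (hu : MemLp u (ENNReal.ofReal (sobolevExponent N p)) ν) :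
    Integrable (fun x => g x * (|u x| ^ (p - 2) * u x)) ν := by
  have hc := holderConjugate_dim hp hpN
  have h1 := integrable_norm_rpow_of_memLp hc.symm.pos hg
  have h2 := integrable_norm_rpow_of_memLp
    (by linarith [lt_sobolevExponent hp hpN] : 0 < sobolevExponent N p) hu
  refine (h1.add ((integrable_const (1 : ℝ)).add h2)).mono' ?_ (Eventually.of_forall fun x => ?_)
  · exact hg.1.mul ((hu.1.norm.aemeasurable.pow_const (p - 2)).aestronglyMeasurable.mul hu.1)
  · rw [norm_mul, norm_mul, Real.norm_of_nonneg (by positivity : 0 ≤ |u x| ^ (p - 2)),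
      ← Real.norm_eq_abs, norm_rpow_sub_two_mul_norm hp]
    refine (mul_le_rpow_add_rpow hc.symm (norm_nonneg _) (by positivity)).trans ?_
    refine add_le_add le_rfl ?_
    rw [← Real.rpow_mul (norm_nonneg _)]
    have hN : (0 : ℝ) < N := by linarith
    have hNp : (0 : ℝ) < N - p := by linarith
    refine rpow_le_one_add_rpow (norm_nonneg _) ?_ ?_
    · have : 0 < p - 1 := by linarith
      positivity
    · rw [sobolevExponent, mul_div_assoc', div_le_div_iff_of_pos_right hNp]
      nlinarith

theorem sq_rpow_neg_half {r : ℝ} (hr : 0 ≤ r) (q : ℝ) : (r ^ 2) ^ (-(q / 2)) = r ^ (-q) := by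
  rw [← Real.rpow_natCast r 2, ← Real.rpow_mul hr]
  congr 1
  push_cast
  ring

theorem continuousOn_barrierRate {p γ δ ε R : ℝ} (hR : 0 < R)
    (hs : ∀ τ, R ^ 2 ≤ τ → 0 < barrierSlope γ δ ε τ) :
    ContinuousOn (fun x : EuclideanSpace ℝ (Fin N) => barrierRate N p γ δ ε (‖x‖ ^ 2))
      {x | R ≤ ‖x‖} := by
  have h : ContinuousOn (barrierRate N p γ δ ε) (Set.Ici (R ^ 2)) := by
    have hpos : ∀ τ ∈ Set.Ici (R ^ 2), τ ≠ 0 := fun τ hτ =>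
      (lt_of_lt_of_le (by positivity) hτ : (0 : ℝ) < τ).ne'
    have h1 : ∀ q : ℝ, ContinuousOn (fun τ : ℝ => τ ^ q) (Set.Ici (R ^ 2)) := fun q =>
      continuousOn_id.rpow_const fun τ hτ => Or.inl (hpos τ hτ)
    have h2 : ContinuousOn (barrierSlope γ δ ε) (Set.Ici (R ^ 2)) :=
      continuousOn_const.sub (continuousOn_const.mul (h1 _))
    have h3 : ∀ q : ℝ, ContinuousOn (fun τ : ℝ => barrierSlope γ δ ε τ ^ q) (Set.Ici (R ^ 2)) :=
      fun q => h2.rpow_const fun τ hτ => Or.inl (hs τ hτ).ne'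
    exact (h1 _).mul (((continuousOn_const.mul (h3 _)).sub (continuousOn_const.mul (h3 _))).add
      ((continuousOn_const.mul (h3 _)).mul (continuousOn_const.mul (h1 _))))
  refine h.comp (by fun_prop) fun x hx => ?_
  rw [Set.mem_ofPred_eq] at hx
  rw [Set.mem_Ici]
  gcongr

/-- Only an upper bound on `f` enters the comparison of potentials; integrability of `b` and of `b
|u|^(p-2) u` comes from `f ∈ L^{N/p}` and from `|x| > 1`, which bounds the Hardy potential. -/
theorem isExteriorPair_barrier {p μ A α γ δ R : ℝ} (hp : 1 < p) (hpN : p < N) (hA : 0 < A)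
    (hα : p < α) (hμ : 0 ≤ μ) (hR : 1 < R) (hγ : 0 ≤ γ)
    (hs : ∀ τ, R ^ 2 ≤ τ → 0 < barrierSlope γ δ (α - p) τ ∧ barrierSlope γ δ (α - p) τ ≤ γ ∧
      μ * τ ^ (-(p / 2)) + 2 * A * τ ^ (-(α / 2)) ≤ barrierRate N p γ δ (α - p) τ)
    {c : ℝ} (hc : 0 < c)
    {Ω : Set (EuclideanSpace ℝ (Fin N))} (hΩ : MeasurableSet Ω) (hDΩ : (closedBall 0 R)ᶜ ⊆ Ω)
    {f u : EuclideanSpace ℝ (Fin N) → ℝ}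
    {G : EuclideanSpace ℝ (Fin N) → EuclideanSpace ℝ (Fin N)}
    (hf : MemLp f (ENNReal.ofReal ((N : ℝ) / p)) (volume.restrict Ω))
    (hfA : ∀ᵐ x ∂(volume.restrict Ω), f x ≤ A * ‖x‖ ^ (-α))
    (hG : HasD1pGradient p Ω u G)
    (hsub : ∀ φ, IsTestFunction Ω φ → (∀ x, 0 ≤ φ x) →
      ∫ x in Ω, (‖G x‖ ^ (p - 2) * inner ℝ (G x) (gradient φ x)
          - μ / ‖x‖ ^ p * (|u x| ^ (p - 2) * u x * φ x))
        ≤ ∫ x in Ω, f x * (|u x| ^ (p - 2) * u x * φ x)) :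
    IsExteriorPair p γ R (barrier γ δ (α - p) c)
      (fun x => barrierRate N p γ δ (α - p) (‖x‖ ^ 2)) (fun x => μ / ‖x‖ ^ p + f x) u G := by
  set D : Set (EuclideanSpace ℝ (Fin N)) := (closedBall 0 R)ᶜ with hD
  have hDm : MeasurableSet D := isClosed_closedBall.measurableSet.compl
  have hDo : IsOpen D := isClosed_closedBall.isOpen_compl
  have hRx : ∀ x ∈ D, R < ‖x‖ := fun x hx => by simpa [hD] using hx
  have hε : α - p ≠ 0 := by linarith
  have hR0 : 0 < R := by linarith
  have hne : ∀ x : EuclideanSpace ℝ (Fin N), R ≤ ‖x‖ → x ≠ 0 := fun x hx =>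
    norm_pos_iff.1 (by linarith)
  have hsq : ∀ x : EuclideanSpace ℝ (Fin N), R ≤ ‖x‖ → R ^ 2 ≤ ‖x‖ ^ 2 := fun x hx => by gcongr
  have hGD := hG.mono hΩ hDΩ
  have hNp := (holderConjugate_dim hp hpN).symm
  have hle : volume.restrict D ≤ volume.restrict Ω := Measure.restrict_mono hDΩ le_rfl
  have hfin : ∀ K, IsCompact K → IsFiniteMeasure (volume.restrict (D ∩ K)) := fun K hK =>
    ⟨by simpa using (measure_mono Set.inter_subset_right).trans_lt hK.measure_lt_top⟩
  have hleK : ∀ K, volume.restrict (D ∩ K) ≤ volume.restrict D := fun K =>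
    Measure.restrict_mono Set.inter_subset_left le_rfl
  have hfK : ∀ K, MemLp f (ENNReal.ofReal ((N : ℝ) / p)) (volume.restrict (D ∩ K)) := fun K =>
    hf.mono_measure ((hleK K).trans hle)
  have hμK : ∀ K, IsCompact K → MemLp (fun x : EuclideanSpace ℝ (Fin N) => μ / ‖x‖ ^ p)
      (ENNReal.ofReal ((N : ℝ) / p)) (volume.restrict (D ∩ K)) := by
    intro K hK
    have := hfin K hK
    refine MemLp.of_bound (measurable_const.div
      (measurable_norm.pow_const p)).aestronglyMeasurable μ ((ae_restrict_iff' (hDm.inter hK.measurableSet)).2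
      (Eventually.of_forall fun x hx => ?_))
    rw [Real.norm_of_nonneg (by positivity)]
    exact div_le_self hμ (Real.one_le_rpow (by linarith [hRx x hx.1]) (by linarith))
  have hint : ∀ g : EuclideanSpace ℝ (Fin N) → ℝ, ∀ K, IsCompact K →
      MemLp g (ENNReal.ofReal ((N : ℝ) / p)) (volume.restrict (D ∩ K)) →
      IntegrableOn (fun x => g x * (|u x| ^ (p - 2) * u x)) (D ∩ K) := by
    intro g K hK hg
    have := hfin K hK
    exact integrable_potential_mul hp hpN hg (hGD.1.mono_measure (hleK K))
  refine ⟨hp, hpN, hR, hγ, hGD, fun x hx => contDiffAt_barrier _ _ _ _ (hne x hx),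
    fun x hx => barrier_pos _ _ _ hc (hne x hx), fun x hx => ?_, ?_,
    fun φ hφ => barrier_weak_equation hDm hε hc hR0 hRx (fun τ hτ => (hs τ hτ).1) hφ, ?_, ?_,
    fun φ hφ hφ0 => ?_, ?_⟩
  · obtain ⟨s1, s2, -⟩ := hs _ (hsq x hx)
    rw [norm_gradient_barrier γ δ hε hc (hne x hx) s1.le]
    have := barrier_pos γ δ (α - p) hc (hne x hx)
    gcongr
  · exact continuousOn_barrierRate hR0 fun τ hτ => (hs τ hτ).1
  · rw [locallyIntegrableOn_iff hDo.isLocallyClosed]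
    intro K hKD hK
    have := hint _ K hK ((hμK K hK).add (hfK K))
    rwa [Set.inter_eq_right.2 hKD] at this
  · intro K hK
    have := hfin K hK
    exact memLp_one_iff_integrable.1 (((hμK K hK).add (hfK K)).mono_exponent
      (by simpa using hNp.lt.le))
  · set K := tsupport φ with hK
    have hKc : IsCompact K := hφ.2.1
    have hKD : K ⊆ D := hφ.2.2
    have hDK : D ∩ K = K := Set.inter_eq_right.2 hKD
    have h0 := hsub φ ⟨hφ.1, hφ.2.1, hφ.2.2.trans hDΩ⟩ hφ0
    have z1 : ∀ x, x ∉ K → φ x = 0 := fun x hx => image_eq_zero_of_notMem_tsupport hx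
    have z2 : ∀ x, x ∉ K → gradient φ x = 0 := fun x hx => gradient_of_notMem_tsupport hx
    have hKΩ : K ⊆ Ω := hKD.trans hDΩ
    rw [setIntegral_eq_of_subset_of_forall_sdiff_eq_zero hΩ hKΩ
      (fun x hx => by rw [z1 x hx.2, z2 x hx.2]; simp),
      setIntegral_eq_of_subset_of_forall_sdiff_eq_zero hΩ hKΩ
      (fun x hx => by rw [z1 x hx.2]; simp)] at h0
    rw [setIntegral_eq_of_subset_of_forall_sdiff_eq_zero hDm hKD
      (fun x hx => by rw [z1 x hx.2, z2 x hx.2]; simp)]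
    have hpq := Real.HolderConjugate.conjExponent hp
    obtain ⟨Cφ, hCφ⟩ := hφ.1.continuous.bounded_above_of_compact_support hφ.2.1
    obtain ⟨Cg, hCg⟩ := hKc.exists_bound_of_continuousOn (continuous_gradient hφ.1).continuousOn
    have := hfin K hKc
    rw [hDK] at this
    have j1 : IntegrableOn (fun x => ‖G x‖ ^ (p - 2) * inner ℝ (G x) (gradient φ x)) K := by
      have := integrable_inner_of_memLp hpq ((memLp_rpow_sub_two_smul hpq hGD.2.2).mono_measure
        (Measure.restrict_mono hKD le_rfl)) (W := gradient φ)
        (MemLp.of_bound (continuous_gradient hφ.1).aestronglyMeasurable Cg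
          ((ae_restrict_iff' hKc.measurableSet).2 (Eventually.of_forall hCg)))
      simpa only [IntegrableOn, real_inner_smul_left] using this
    have jmul : ∀ g : EuclideanSpace ℝ (Fin N) → ℝ,
        MemLp g (ENNReal.ofReal ((N : ℝ) / p)) (volume.restrict (D ∩ K)) →
        IntegrableOn (fun x => g x * (|u x| ^ (p - 2) * u x * φ x)) K := by
      intro g hg
      have h1 := hint g K hKc hg
      rw [hDK] at h1
      have h2 := h1.mul_bdd (c := Cφ) hφ.1.continuous.aestronglyMeasurable
        (Eventually.of_forall hCφ)
      simpa only [IntegrableOn, mul_assoc] using h2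
    have j2 := jmul _ (hμK K hKc)
    have j3 := jmul _ (hfK K)
    have h4 := sub_nonpos.2 h0
    rw [← integral_sub (f := fun x => ‖G x‖ ^ (p - 2) * inner ℝ (G x) (gradient φ x)
      - μ / ‖x‖ ^ p * (|u x| ^ (p - 2) * u x * φ x)) (j1.sub j2) j3] at h4
    refine le_trans (le_of_eq (integral_congr_ae (Eventually.of_forall fun x => ?_))) h4
    simp only [real_inner_smul_left]
    ring
  -- The rate dominates `μ |x|^(-p) + 2 A |x|^(-α)` while `f ≤ A |x|^(-α)`, so the gap is at least
  -- `A |x|^(-α) > 0`.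
  · filter_upwards [hfA.filter_mono (ae_mono hle), ae_restrict_mem hDm] with x hx hxD
    have hxR := hRx x hxD
    have h3 := (hs _ (hsq x hxR.le)).2.2
    rw [sq_rpow_neg_half (norm_nonneg x), sq_rpow_neg_half (norm_nonneg x)] at h3
    have h4 : 0 < A * ‖x‖ ^ (-α) :=
      mul_pos hA (Real.rpow_pos_of_pos (by linarith) _)
    have h5 : μ / ‖x‖ ^ p = μ * ‖x‖ ^ (-p) := by
      rw [Real.rpow_neg (norm_nonneg x), div_eq_mul_inv]
    rw [h5]
    linarith

/-- The decay estimate with an admissible boundary bound `t` in place of the supremum. -/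
theorem le_of_leOnBoundary_sphere {p μ A α δ R : ℝ} (hp : 1 < p) (hpN : p < N) (hA : 0 < A)
    (hα : p < α) (hμ : 0 ≤ μ) (hR : 1 < R) {γ : ℝ} (hγ : 0 ≤ γ) (hδ : 0 < δ)
    (hs : ∀ τ, R ^ 2 ≤ τ → 0 < barrierSlope γ δ (α - p) τ ∧ barrierSlope γ δ (α - p) τ ≤ γ ∧
      μ * τ ^ (-(p / 2)) + 2 * A * τ ^ (-(α / 2)) ≤ barrierRate N p γ δ (α - p) τ)
    {Ω : Set (EuclideanSpace ℝ (Fin N))} (hΩ : MeasurableSet Ω) (hDΩ : (closedBall 0 R)ᶜ ⊆ Ω)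
    {f u : EuclideanSpace ℝ (Fin N) → ℝ}
    (hf : MemLp f (ENNReal.ofReal ((N : ℝ) / p)) (volume.restrict Ω))
    (hfA : ∀ᵐ x ∂(volume.restrict Ω), f x ≤ A * ‖x‖ ^ (-α))
    (hsub : IsWeakSubsolution p μ Ω f u) {t : ℝ} (ht0 : 0 ≤ t)
    (ht : LeOnBoundary p (closedBall 0 R)ᶜ (fun y => max (u y) 0) t) :
    ∀ᵐ x ∂(volume.restrict (closedBall (0 : EuclideanSpace ℝ (Fin N)) R)ᶜ),
      u x ≤ Real.exp (δ / (α - p)) * (‖x‖ / R) ^ (-γ) * t := by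
  obtain ⟨G, hG, hsub⟩ := hsub
  have hε : 0 < α - p := by linarith
  have hR0 : 0 < R := by linarith
  have hDm : MeasurableSet (closedBall (0 : EuclideanSpace ℝ (Fin N)) R)ᶜ :=
    isClosed_closedBall.measurableSet.compl
  set P := barrierProfile γ δ (α - p) with hP
  have hPR : 0 < P (R ^ 2) := barrierProfile_pos _ _ _ (by positivity)
  have step : ∀ n : ℕ, ∀ᵐ x ∂(volume.restrict (closedBall (0 : EuclideanSpace ℝ (Fin N)) R)ᶜ),
      u x ≤ Real.exp (δ / (α - p)) * (‖x‖ / R) ^ (-γ) * (t + 1 / ((n : ℝ) + 1)) := by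
    intro n
    set e : ℝ := 1 / ((n : ℝ) + 1) with he
    have he0 : 0 < e := by positivity
    -- Normalises the barrier to `t + e` on the sphere. By continuity it stays above `t + e/2` on a
    -- thin shell, which gives the margin `2σ` with `σ = e/4`; the excess `e` is removed at the end.
    set c : ℝ := (t + e) / P (R ^ 2) with hc
    have hc0 : 0 < c := by positivity
    have hcP : c * P (R ^ 2) = t + e := by rw [hc]; field_simp
    have hpair := isExteriorPair_barrier hp hpN hA hα hμ hR hγ hs hc0 hΩ hDΩ hf hfA hG hsub
    have hcont : ContinuousAt (fun r : ℝ => c * P (r ^ 2)) R := by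
      refine continuousAt_const.mul (ContinuousAt.comp (f := fun r : ℝ => r ^ 2) (g := P) ?_
        (by fun_prop))
      exact (hasDerivAt_barrierProfile γ δ hε.ne' (by positivity)).continuousAt
    have hev : ∀ᶠ r in 𝓝 R, t + 2 * (e / 4) < c * P (r ^ 2) :=
      hcont.eventually (lt_mem_nhds (by
        show t + 2 * (e / 4) < c * P (R ^ 2)
        rw [hcP]; linarith))
    obtain ⟨d, hd, hball⟩ := Metric.eventually_nhds_iff_ball.1 hev
    have hmain := hpair.le_of_leOnBoundary ht (R' := R + d / 2) (σ := e / 4) (by linarith)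
      (by linarith) (fun x h1 h2 => (hball ‖x‖ (by
        rw [Real.ball_eq_Ioo]
        constructor <;> linarith)).le)
    filter_upwards [hmain, ae_restrict_mem hDm] with x hx hxD
    have hxR : R < ‖x‖ := by simpa using hxD
    have hx0 : 0 < ‖x‖ := by linarith
    refine hx.trans ?_
    have b1 : P (‖x‖ ^ 2) ≤ ‖x‖ ^ (-γ) := barrierProfile_sq_le hδ.le hε hx0.le
    have b2 : R ^ (-γ) * Real.exp (-(δ / (α - p))) ≤ P (R ^ 2) :=
      le_barrierProfile_sq hδ.le hε hR.le
    have hRγ : 0 < R ^ (-γ) := Real.rpow_pos_of_pos hR0 _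
    have hexp := Real.exp_pos (-(δ / (α - p)))
    -- The loss `exp(δ/ε)` comes from bounding the exponential factor by `1` at `x` and below by
    -- `exp(-δ/ε)` on the sphere.
    calc barrier γ δ (α - p) c x = c * P (‖x‖ ^ 2) := rfl
      _ ≤ (t + e) / (R ^ (-γ) * Real.exp (-(δ / (α - p)))) * ‖x‖ ^ (-γ) := by
        rw [hc]
        have b3 : 0 < P (‖x‖ ^ 2) := barrierProfile_pos _ _ _ (by positivity)
        gcongr
      _ = Real.exp (δ / (α - p)) * (‖x‖ / R) ^ (-γ) * (t + e) := by
        rw [Real.div_rpow hx0.le hR0.le, Real.exp_neg]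
        field_simp
  filter_upwards [ae_all_iff.2 step] with x hx
  have lim : Tendsto (fun n : ℕ => Real.exp (δ / (α - p)) * (‖x‖ / R) ^ (-γ)
      * (t + 1 / ((n : ℝ) + 1))) atTop
      (𝓝 (Real.exp (δ / (α - p)) * (‖x‖ / R) ^ (-γ) * (t + 0))) :=
    (tendsto_one_div_add_atTop_nhds_zero_nat.const_add t).const_mul _
  rw [add_zero] at lim
  exact ge_of_tendsto' lim hx

/-- The infimum over admissible boundary bounds may be taken inside an almost-everywhere
inequality. -/
theorem ae_le_mul_boundarySup {p : ℝ} {D : Set (EuclideanSpace ℝ (Fin N))}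
    {ν : Measure (EuclideanSpace ℝ (Fin N))} {w u k : EuclideanSpace ℝ (Fin N) → ℝ}
    (hk : ∀ᵐ x ∂ν, 0 < k x)
    (h : ∀ t : ℝ≥0, LeOnBoundary p D w t → ∀ᵐ x ∂ν, u x ≤ k x * t) :
    ∀ᵐ x ∂ν, ENNReal.ofReal (u x) ≤ ENNReal.ofReal (k x) * boundarySup p D w := by
  set T : Set ℝ≥0∞ := {s | ∃ t : ℝ≥0, LeOnBoundary p D w t ∧ (t : ℝ≥0∞) = s} with hT
  have hsup : boundarySup p D w = sInf T := by
    rw [boundarySup]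
    refine le_antisymm (le_sInf ?_) (le_iInf₂ fun t ht => sInf_le ⟨t, ht, rfl⟩)
    rintro s ⟨t, ht, rfl⟩
    exact iInf₂_le t ht
  rw [hsup]
  -- With no admissible bound the supremum is `∞`, and positivity of `k` is needed because `0 * ∞ =
  -- 0`. Otherwise a sequence approaching the infimum leaves only countably many null sets.
  rcases T.eq_empty_or_nonempty with hemp | hne
  · filter_upwards [hk] with x hx
    rw [hemp, sInf_empty, ENNReal.mul_top (by simpa using hx)]
    exact le_top
  · obtain ⟨s, -, hs, hsT⟩ := exists_seq_tendsto_sInf hne (OrderBot.bddBelow T)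
    have hall : ∀ᵐ x ∂ν, ∀ n, ENNReal.ofReal (u x) ≤ ENNReal.ofReal (k x) * s n := by
      refine ae_all_iff.2 fun n => ?_
      obtain ⟨t, ht, hts⟩ := hsT n
      filter_upwards [h t ht, hk] with x hx hkx
      rw [← hts, ← ENNReal.ofReal_coe_nnreal, ← ENNReal.ofReal_mul hkx.le]
      exact ENNReal.ofReal_le_ofReal hx
    filter_upwards [hall] with x hx
    exact ge_of_tendsto' (ENNReal.Tendsto.const_mul hs (Or.inr ENNReal.ofReal_ne_top)) hx

end SubsolutionDecay

end HardySobolev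

end

theorem theorem1p5 (N : ℕ) (p μ A α : ℝ) (hp : 1 < p) (hpN : p < N)
    (hμ : 0 ≤ μ) (hμ' : μ < (((N : ℝ) - p) / p) ^ p) (hA : 0 < A) (hα : p < α) :
    ∃ R₀ C : ℝ, 1 < R₀ ∧ 0 < C ∧
      ∀ (Ω : Set (EuclideanSpace ℝ (Fin N))) (f u : EuclideanSpace ℝ (Fin N) → ℝ),
        HardySobolev.IsExteriorDomain Ω →
        MemLp f (ENNReal.ofReal ((N : ℝ) / p)) (volume.restrict Ω) →
        (∀ᵐ x ∂(volume.restrict Ω), f x ≤ A * ‖x‖ ^ (-α)) →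
        HardySobolev.MemD1p p Ω u →
        HardySobolev.IsWeakSubsolution p μ Ω f u →
        ∀ R₁ : ℝ, R₀ ≤ R₁ → Ωᶜ ⊆ ball 0 R₁ →
          ∀ᵐ x ∂(volume.restrict (ball (0 : EuclideanSpace ℝ (Fin N)) R₁)ᶜ),
            ENNReal.ofReal (u x) ≤
              ENNReal.ofReal (C * (‖x‖ / R₁) ^ (-HardySobolev.gamma₂ N p μ)) *
                HardySobolev.boundarySup p (closedBall 0 R₁)ᶜ (fun y => max (u y) 0) := by
  obtain ⟨δ, R₀, hδ, hR₀, hs⟩ := HardySobolev.exists_barrier_constants hp hpN hμ hμ' hA hα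
  refine ⟨R₀, Real.exp (δ / (α - p)), hR₀, Real.exp_pos _, ?_⟩
  intro Ω f u hΩ hf hfA _ hsub R₁ hR₁ hΩR
  have hR1 : 1 < R₁ := hR₀.trans_le hR₁
  have hγ : 0 ≤ HardySobolev.gamma₂ N p μ :=
    (div_nonneg (by linarith) (by linarith)).trans (HardySobolev.gamma₂_spec hp hpN hμ hμ').1.le
  have hDΩ : (closedBall (0 : EuclideanSpace ℝ (Fin N)) R₁)ᶜ ⊆ Ω := by
    rw [Set.compl_subset_comm]
    exact hΩR.trans ball_subset_closedBall
  have hDm : MeasurableSet (closedBall (0 : EuclideanSpace ℝ (Fin N)) R₁)ᶜ :=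
    isClosed_closedBall.measurableSet.compl
  have hmain : ∀ᵐ x ∂(volume.restrict (closedBall (0 : EuclideanSpace ℝ (Fin N)) R₁)ᶜ),
      ENNReal.ofReal (u x) ≤
        ENNReal.ofReal (Real.exp (δ / (α - p)) * (‖x‖ / R₁) ^ (-HardySobolev.gamma₂ N p μ)) *
          HardySobolev.boundarySup p (closedBall 0 R₁)ᶜ (fun y => max (u y) 0) := by
    refine HardySobolev.ae_le_mul_boundarySup
      (k := fun x => Real.exp (δ / (α - p)) * (‖x‖ / R₁) ^ (-HardySobolev.gamma₂ N p μ))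
      ?_ fun t ht => ?_
    · filter_upwards [ae_restrict_mem hDm] with x hx
      have hxR : R₁ < ‖x‖ := by simpa using hx
      have : 0 < ‖x‖ / R₁ := div_pos (by linarith) (by linarith)
      positivity
    · exact HardySobolev.le_of_leOnBoundary_sphere hp hpN hA hα hμ hR1 hγ hδ
        (fun τ hτ => hs τ (le_trans (by gcongr) hτ)) hΩ.isOpen.measurableSet hDΩ hf hfA hsub
        t.coe_nonneg ht
  -- The comparison takes place strictly outside the closed ball; the sphere itself is a null set.
  have hsphere : ∀ᵐ x ∂(volume : Measure (EuclideanSpace ℝ (Fin N))), x ∉ sphere 0 R₁ :=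
    measure_eq_zero_iff_ae_notMem.1 (Measure.addHaar_sphere_of_ne_zero _ _ (by linarith))
  rw [ae_restrict_iff' hDm] at hmain
  refine (ae_restrict_iff' measurableSet_ball.compl).2 ?_
  filter_upwards [hmain, hsphere] with x h1 h2 h3
  refine h1 fun h4 => ?_
  simp only [mem_closedBall, mem_sphere, Set.mem_compl_iff, mem_ball, not_lt] at h2 h3 h4
  exact h2 (le_antisymm h4 h3)
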